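/- Let $K$ be a field with a nontrivial real valuation $\mathrm{val}:K\to\mathbb{R}\cup\{\infty\}$ and let $n\ge 3$. For $f=\sum_\alpha c_\alpha x^\alpha\in K[x_1,\dots,x_n]$, $f\neq 0$, let $\mathcal{T}(f)\subseteq\mathbb{R}^n$ be the set of points $w$ at which the minimum $\min_\alpha(\mathrm{val}(c_\alpha)+\alpha\cdot w)$ over the exponents of $f$ is attained at least twice; put $\mathcal{T}(0)=\mathbb{R}^n$. For an ideal $I$ put $\mathcal{T}(I)=\bigcap_{f\in I}\mathcal{T}(f)$. The hypersurface $\mathcal{T}(f)$ has degree $d$ if $f$ has total degree $d$ and no variable $x_j$ divides $f$. A tropical line in $\mathbb{R}^n$ is a set $\mathcal{T}(I)$, where $I$ is the vanishing ideal of an affine line in $K^n$, that contains half-rays in all the $n+1$ directions $e^{(1)},\dots,e^{(n)},-\sum_i e^{(i)}$. A rational projection $\pi:\mathbb{R}^n\to\mathbb{R}^2$ is a map $x\mapsto Ax$ with $A\in\mathbb{Q}^{2\times n}$ of rank $2$. The faces of a tropical curve are its vertices (the points at which it is not locally a straight line) and its closed edges; a self-intersection point of a tropical curve under $\pi$ is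 a point that lies in both $\pi(F_1)$ and $\pi(F_2)$ for two disjoint (non-adjacent) faces $F_1,F_2$ of the curve. For the intersection of hypersurfaces $\mathcal{T}(f_j)$, $j\in J$, the cells are the sets $C$ of all $w'$ at which, for every $j\in J$, all monomials of $f_j$ that are minimal at a fixed point $w$ of the intersection are again minimal; let $C_j^\vee$ be the convex hull of the exponents of $f_j$ that are minimal at $w$. The intersection is proper if its dimension is $n-|J|$, transversal along $C$ if $\dim\big(\sum_{j\in J} C_j^\vee\big)=\sum_{j\in J}\dim C_j^\vee$ (the left-hand sum being the Minkowski sum), and $\mathcal{T}(f_1),\dots,\mathcal{T}(f_k)$ intersect transversally if for every $J\subseteq\{1,\dots,k\}$ with $|J|\ge2$ the intersection over $J$ is proper and transversal along each of its cells. (a) There exist a tropical line $L_n\subseteq\mathbb{R}^n$ and a rational projection $\pi:\mathbb{R}^n\to\mathbb{R}^2$ under which $L_n$ has exactly $$\sum_{i=1}^{n-2} i=\binom{n-1}{2}$$ self-intersection points. (b) For all integers $d_1,\dots,d_{n-1}\ge 1$ there exist polynomials $f_1,\dots,f_{n-1}\in K[x_1,\dots,x_n]$ such that $\mathcal{T}(f_i)$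 has degree $d_i$ for each $i$, the hypersurfaces $\mathcal{T}(f_1),\dots,\mathcal{T}(f_{n-1})$ intersect transversally, and $\mathcal{C}=\bigcap_i\mathcal{T}(f_i)=\mathcal{T}(\langle f_1,\dots,f_{n-1}\rangle)$ is a tropical curve, and there exists a rational projection $\pi:\mathbb{R}^n\to\mathbb{R}^2$ such that the number of self-intersection points of $\mathcal{C}$ under $\pi$ is finite and at least $$(d_1\cdots d_{n-1})^2\cdot\binom{n-1}{2}.$$ -/

import Mathlib

open scoped Pointwise

noncomputable section

namespace TropProj

variable {K : Type*} [Field K] {n k : ℕ}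

/-- The value at `w` of the tropical monomial `val(c_α) ⊙ x^α` belonging to the exponent `α`
of `f`, that is `val(c_α) + α₁ w₁ + ⋯ + αₙ wₙ`. -/
def tropTerm (v : AddValuation K (WithTop ℝ)) (f : MvPolynomial (Fin n) K) (w : Fin n → ℝ)
    (α : Fin n →₀ ℕ) : WithTop ℝ :=
  v (f.coeff α) + ((∑ i, (α i : ℝ) * w i : ℝ) : WithTop ℝ)

/-- The exponents of `f` at which the minimum in `trop(f)(w)` is attained. -/
def argmin (v : AddValuation K (WithTop ℝ)) (f : MvPolynomial (Fin n) K) (w : Fin n → ℝ) :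
    Set (Fin n →₀ ℕ) :=
  {α | α ∈ f.support ∧ ∀ β ∈ f.support, tropTerm v f w α ≤ tropTerm v f w β}

/-- The tropical hypersurface `𝒯(f)`: the points at which the minimum in `trop(f)` is attained
at least twice (by convention all of `ℝⁿ` for the zero polynomial). -/
def tropHypersurface (v : AddValuation K (WithTop ℝ)) (f : MvPolynomial (Fin n) K) :
    Set (Fin n → ℝ) :=
  {w | f = 0 ∨ (argmin v f w).Nontrivial}

/-- The tropical variety `𝒯(I) = ⋂_{f ∈ I} 𝒯(f)` of an ideal. -/
def tropVariety (v : AddValuation K (WithTop ℝ)) (I : Ideal (MvPolynomial (Fin n) K)) :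
    Set (Fin n → ℝ) :=
  ⋂ f ∈ I, tropHypersurface v f

/-- `f` defines a tropical hypersurface of degree `d`: it has total degree `d` and no monomial
factor (a monomial factor would change the degree of `f` but not the hypersurface). -/
def HasTropDegree (f : MvPolynomial (Fin n) K) (d : ℕ) : Prop :=
  f.totalDegree = d ∧ ∀ j, ¬ MvPolynomial.X j ∣ f

/-- A tropical line in `ℝⁿ` over `(K, v)`: the tropical variety of the ideal of an affine line
in `Kⁿ` which has half-rays in all the `n + 1` directions `e₁, …, eₙ` and `-(e₁ + ⋯ + eₙ)`. -/
def IsTropLine (v : AddValuation K (WithTop ℝ)) (L : Set (Fin n → ℝ)) : Prop :=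
  (∃ l : AffineSubspace K (Fin n → K), Module.finrank K l.direction = 1 ∧
    L = tropVariety v (MvPolynomial.vanishingIdeal K (l : Set (Fin n → K)))) ∧
  (∀ i : Fin n, ∃ p : Fin n → ℝ, ∀ t : ℝ, 0 ≤ t → p + t • Pi.single i (1 : ℝ) ∈ L) ∧
  (∃ p : Fin n → ℝ, ∀ t : ℝ, 0 ≤ t → p + t • (fun _ => (-1 : ℝ)) ∈ L)

/-! ### Transversal intersections -/

/-- The dimension of (the affine hull of) a polyhedron. -/
def polyDim (P : Set (Fin n → ℝ)) : ℕ := Module.finrank ℝ (vectorSpan ℝ P)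

/-- The intersection of the hypersurfaces `𝒯(f j)` with `j ∈ J`. -/
def interOf (v : AddValuation K (WithTop ℝ)) (f : Fin k → MvPolynomial (Fin n) K)
    (J : Finset (Fin k)) : Set (Fin n → ℝ) :=
  ⋂ j ∈ J, tropHypersurface v (f j)

/-- The smallest cell containing `w` of the intersection of the `𝒯(f j)` with `j ∈ J`. It is the
intersection over `j ∈ J` of the smallest cells of the `𝒯(f j)` containing `w`; all cells of the
intersection are of this form. -/
def cell (v : AddValuation K (WithTop ℝ)) (f : Fin k → MvPolynomial (Fin n) K)
    (J : Finset (Fin k)) (w : Fin n → ℝ) : Set (Fin n → ℝ) :=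
  {w' | ∀ j ∈ J, argmin v (f j) w ⊆ argmin v (f j) w'}

/-- The cell of the privileged subdivision of the Newton polytope of `f` which is dual to the
smallest cell of `𝒯(f)` containing `w`. -/
def dualCell (v : AddValuation K (WithTop ℝ)) (f : MvPolynomial (Fin n) K) (w : Fin n → ℝ) :
    Set (Fin n → ℝ) :=
  convexHull ℝ ((fun (α : Fin n →₀ ℕ) (i : Fin n) => (α i : ℝ)) '' argmin v f w)

/-- The intersection over `J` is proper: its dimension, the largest dimension of its cells,
is `n - |J|`. -/
def IsProperInter (v : AddValuation K (WithTop ℝ)) (f : Fin k → MvPolynomial (Fin n) K)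
    (J : Finset (Fin k)) : Prop :=
  IsGreatest ((fun w => polyDim (cell v f J w) + J.card) '' interOf v f J) n

/-- The intersection over `J` is transversal along its smallest cell containing `w`: the
dimension of the Minkowski sum of the dual cells is the sum of their dimensions. -/
def IsTransversalAlong (v : AddValuation K (WithTop ℝ)) (f : Fin k → MvPolynomial (Fin n) K)
    (J : Finset (Fin k)) (w : Fin n → ℝ) : Prop :=
  polyDim (∑ j ∈ J, dualCell v (f j) w) = ∑ j ∈ J, polyDim (dualCell v (f j) w)

/-- The hypersurfaces `𝒯(f j)` intersect transversally: for every set `J` of at least two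
indices the intersection over `J` is proper and transversal along each of its cells. -/
def IsTransversalInter (v : AddValuation K (WithTop ℝ))
    (f : Fin k → MvPolynomial (Fin n) K) : Prop :=
  ∀ J : Finset (Fin k), 2 ≤ J.card →
    IsProperInter v f J ∧ ∀ w ∈ interOf v f J, IsTransversalAlong v f J w

/-! ### Self-intersections -/

/-- The local cone of `X` at `x`, translated to the origin. -/
def localCone (X : Set (Fin n → ℝ)) (x : Fin n → ℝ) : Set (Fin n → ℝ) :=
  {y | ∃ ε : ℝ, 0 < ε ∧ ∀ ρ : ℝ, 0 ≤ ρ → ρ ≤ ε → x + ρ • y ∈ X}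

/-- The (closed) faces of a polyhedral curve `X`: the closures of the connected components of
the loci in `X` on which the local cone is constant. These are the vertices of `X` (the points
at which `X` is not locally a straight line) and its edges (segments, half-rays, lines). -/
def faces (X : Set (Fin n → ℝ)) : Set (Set (Fin n → ℝ)) :=
  (fun x => closure (connectedComponentIn {z ∈ X | localCone X z = localCone X x} x)) '' X

/-- The linear map `ℝⁿ → ℝ²`, `x ↦ A x`, of a rational matrix `A`. -/
def ratMap (A : Matrix (Fin 2) (Fin n) ℚ) : (Fin n → ℝ) →ₗ[ℝ] (Fin 2 → ℝ) :=
  (A.map (fun q : ℚ => (q : ℝ))).mulVecLin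

/-- The self-intersection points of `X` under the linear map `p`: the points in which the images
of two non-adjacent (that is, disjoint) faces of `X` intersect. -/
def selfIntersections (p : (Fin n → ℝ) →ₗ[ℝ] (Fin 2 → ℝ)) (X : Set (Fin n → ℝ)) :
    Set (Fin 2 → ℝ) :=
  {a | ∃ F₁ ∈ faces X, ∃ F₂ ∈ faces X, Disjoint F₁ F₂ ∧ a ∈ p '' F₁ ∧ a ∈ p '' F₂}

end TropProj

end

/-! Put `m = n - 1` and take `fᵢ = pᵢ(x₀) + qᵢ(x_{i+1})` of degree `dᵢ`. Each hypersurface is a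
cylinder over a plane curve `Γᵢ` in the coordinates `(x₀, x_{i+1})`, so the intersection is the
fibre product of the `Γᵢ` over the `x₀`-axis. With strictly convex coefficient values, `Γᵢ` has `dᵢ`
vertical rays, over the tropical roots of `pᵢ`, and at least `dᵢ` points over every positive `x₀`.
The roots are positive, and those of `pᵢ` lie to the left of those of `pⱼ` for `i < j`. A root of
`pᵢ` together with a sheet of every other `Γⱼ` gives a ray, hence `d₁⋯d_m` rays in each of the
directions `e₁, …, e_m`.

A projection that sends `e₀` far out along the horizontal axis and `e₁, …, e_m` to vectors in
counterclockwise order makes any two rays of different directions cross. These are open conditions,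
so a rational projection can satisfy them and also avoid finitely many degeneracies: overlapping
parallel rays and three concurrent rays of distinct directions. The crossings are then `(∏ dᵢ)² *
m.choose 2` distinct points (`FiberedCurve.exists_projection`). The faces that cross are disjoint,
because `x₀` is constant on each of them, with different values (`rayFace_zero`). Finiteness holds
because the curve lies in finitely many lines (`finite_selfIntersections`).

The equality with the variety of the ideal comes from lifting: each point of the intersection is the
tropicalization of a common zero over a valued extension field (`exists_common_zero`). One
coordinate is chosen generic, and the others are found as roots of one-variable polynomials by the
Newton polygon argument (`exists_root_of_two_min`).

Transversality is linear algebra. The dual cells span subspaces of coordinate planes that share only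
the `x₀`-axis, and since no two `Γᵢ` have a common critical value of `x₀`, at most one of these
subspaces contains that axis (`finrank_iSup_of_coordinate_planes`, `isTransversalInter_splitPoly`).

For (a) all degrees are one. The curve is then a monotone spine from which one ray branches off at
each root, and a further open condition on the projection excludes every crossing other than those
of the rays (`selfIntersections_subset`). -/

noncomputable section

namespace TropProj

/-! ### Algebraically closed valued extensions with a generic element -/

section

open Polynomial
open scoped NNReal

universe u

/-- The order-reversing map `x ↦ exp (-x)` from `ℝ ∪ {∞}` to the non-negative reals. -/
def expNeg : WithTop ℝ → ℝ := WithTop.recTopCoe 0 (fun r => Real.exp (-r))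

@[simp] lemma expNeg_top : expNeg ⊤ = 0 := rfl

@[simp] lemma expNeg_coe (r : ℝ) : expNeg (r : WithTop ℝ) = Real.exp (-r) := rfl

@[simp] lemma expNeg_zero : expNeg 0 = 1 := by
  rw [← WithTop.coe_zero, expNeg_coe, neg_zero, Real.exp_zero]

lemma expNeg_nonneg (x : WithTop ℝ) : 0 ≤ expNeg x := by
  induction x with
  | top => simp
  | coe r => simpa using (Real.exp_pos _).le

lemma expNeg_add (x y : WithTop ℝ) : expNeg (x + y) = expNeg x * expNeg y := by
  induction x with
  | top => simp
  | coe r =>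
    induction y with
    | top => simp
    | coe s => rw [← WithTop.coe_add, expNeg_coe, neg_add, Real.exp_add]; simp

lemma expNeg_strictAnti : StrictAnti expNeg := by
  intro x y h
  induction y with
  | top =>
    obtain ⟨r, rfl⟩ := WithTop.ne_top_iff_exists.1 h.ne
    simpa using Real.exp_pos _
  | coe s =>
    obtain ⟨r, rfl⟩ := WithTop.ne_top_iff_exists.1 (h.trans (WithTop.coe_lt_top s)).ne
    simpa using WithTop.coe_lt_coe.1 h

lemma expNeg_le_iff {x y : WithTop ℝ} : expNeg x ≤ expNeg y ↔ y ≤ x :=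
  expNeg_strictAnti.le_iff_ge

lemma exists_expNeg_eq {r : ℝ} (hr : 0 ≤ r) : ∃ x, expNeg x = r := by
  rcases hr.eq_or_lt with rfl | h
  · exact ⟨⊤, rfl⟩
  · exact ⟨((-Real.log r : ℝ) : WithTop ℝ), by rw [expNeg_coe, neg_neg, Real.exp_log h]⟩

variable {K : Type*} [Field K]

/-- The absolute value `exp (-v x)` of an additive valuation. -/
def absOfVal (v : AddValuation K (WithTop ℝ)) : AbsoluteValue K ℝ where
  toFun x := expNeg (v x)
  map_mul' x y := by simp [expNeg_add]
  nonneg' x := expNeg_nonneg _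
  eq_zero' x := by
    rw [← expNeg_top, expNeg_strictAnti.injective.eq_iff, AddValuation.top_iff]
  add_le' x y := by
    rcases min_le_iff.1 (v.map_add x y) with h | h
    · linarith [expNeg_le_iff.2 h, expNeg_nonneg (v y)]
    · linarith [expNeg_le_iff.2 h, expNeg_nonneg (v x)]

lemma absOfVal_apply (v : AddValuation K (WithTop ℝ)) (x : K) : absOfVal v x = expNeg (v x) := rfl

lemma absOfVal_nonarch (v : AddValuation K (WithTop ℝ)) : IsNonarchimedean (absOfVal v) := by
  intro x y
  simp only [absOfVal_apply]
  rcases min_le_iff.1 (v.map_add x y) with h | h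
  · exact le_max_of_le_left (expNeg_le_iff.2 h)
  · exact le_max_of_le_right (expNeg_le_iff.2 h)

/-- The additive valuation belonging to a multiplicative ultrametric norm. -/
lemma exists_addValuation_of_norm {L : Type*} [Field L] (N : L → ℝ) (h0 : N 0 = 0) (h1 : N 1 = 1)
    (hnn : ∀ x, 0 ≤ N x) (hmul : ∀ x y, N (x * y) = N x * N y)
    (hadd : ∀ x y, N (x + y) ≤ max (N x) (N y)) :
    ∃ V : AddValuation L (WithTop ℝ), ∀ x, expNeg (V x) = N x := by
  choose φ hφ using fun x => exists_expNeg_eq (hnn x)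
  refine ⟨AddValuation.of φ ?_ ?_ ?_ ?_, hφ⟩
  · apply expNeg_strictAnti.injective; rw [hφ, h0, expNeg_top]
  · apply expNeg_strictAnti.injective; rw [hφ, h1]; exact expNeg_zero.symm
  · intro x y
    rw [min_le_iff, ← expNeg_le_iff, ← expNeg_le_iff, hφ, hφ, hφ]
    exact le_max_iff.1 (hadd x y)
  · intro x y
    apply expNeg_strictAnti.injective; rw [hφ, hmul, expNeg_add, hφ, hφ]

/-- A non-trivial ultrametric absolute value extends to an algebraically closed field. -/
lemma exists_algClosed_extension {F : Type u} [Field F] (N : AbsoluteValue F ℝ)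
    (hna : IsNonarchimedean N) (hnt : ∃ x, 1 < N x) :
    ∃ (L : Type u) (_ : Field L) (_ : Algebra F L) (_ : IsAlgClosed L)
      (V : AddValuation L (WithTop ℝ)), ∀ x, expNeg (V (algebraMap F L x)) = N x := by
  let E := WithAbs N
  have hE : ∀ x : E, ‖x‖ = N (WithAbs.equiv N x) := fun x => rfl
  -- The passage to the completion makes the spectral norm on the algebraic closure multiplicative.
  let C := UniformSpace.Completion E
  have : IsUltrametricDist C := by
    apply IsUltrametricDist.isUltrametricDist_of_forall_norm_add_le_max_norm
    intro x y
    induction x, y using UniformSpace.Completion.induction_on₂ with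
    | hp => exact isClosed_le (by fun_prop) (by fun_prop)
    | ih a b =>
      rw [← UniformSpace.Completion.coe_add, UniformSpace.Completion.norm_coe,
        UniformSpace.Completion.norm_coe, UniformSpace.Completion.norm_coe]
      exact hna (WithAbs.equiv N a) (WithAbs.equiv N b)
  let : NontriviallyNormedField C :=
    { (inferInstance : NormedField C) with
      non_trivial := by
        obtain ⟨x, hx⟩ := hnt
        refine ⟨(((WithAbs.equiv N).symm x : E) : C), ?_⟩
        rw [UniformSpace.Completion.norm_coe, hE]
        simpa using hx }
  let L := AlgebraicClosure C
  obtain ⟨V, hV⟩ := exists_addValuation_of_norm (fun x : L => spectralMulAlgNorm C L x)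
    (map_zero _) (map_one _) (fun x => apply_nonneg _ x) (map_mul _)
    (fun x y => isNonarchimedean_spectralNorm x y)
  let φ : F →+* L := (algebraMap C L).comp
    ((UniformSpace.Completion.coeRingHom (α := E)).comp (WithAbs.equiv N).symm.toRingHom)
  refine ⟨L, inferInstance, φ.toAlgebra, inferInstance, V, fun x => ?_⟩
  rw [hV]
  change spectralNorm C L (algebraMap C L _) = _
  rw [spectralNorm_extends]
  change ‖((WithAbs.equiv N).symm x : C)‖ = _
  rw [UniformSpace.Completion.norm_coe, hE]
  simp

/-- Every non-trivially valued field embeds in an algebraically closed valued field which contains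
an element `t` of prescribed value `w` that is generic, in the sense that the value of a polynomial
at `t` is the tropical value of the polynomial at `w`. -/
theorem exists_generic_extension {K : Type u} [Field K] (v : AddValuation K (WithTop ℝ))
    (hv : ∃ x : K, x ≠ 0 ∧ v x ≠ 0) (w : ℝ) :
    ∃ (L : Type u) (_ : Field L) (_ : Algebra K L) (_ : IsAlgClosed L)
      (V : AddValuation L (WithTop ℝ)) (t : L), (∀ x, V (algebraMap K L x) = v x) ∧
      ∀ p : K[X], (∀ a, V (aeval t p) ≤ v (p.coeff a) + ((a * w : ℝ) : WithTop ℝ)) ∧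
        ∃ a, V (aeval t p) = v (p.coeff a) + ((a * w : ℝ) : WithTop ℝ) := by
  -- With this radius the Gauss norm `max |pₐ| cᵃ` is `exp (-·)` of the tropical value of `p` at
  -- `w`; the generic element will be the variable of `K(X)`.
  set c : ℝ := Real.exp (-w)
  have hc : 0 < c := Real.exp_pos _
  have hcoe : ∀ (x : K) (a : ℕ),
      absOfVal v x * c ^ a = expNeg (v x + ((a * w : ℝ) : WithTop ℝ)) := fun x a => by
    rw [expNeg_add, expNeg_coe, absOfVal_apply, ← Real.exp_nat_mul, mul_neg]
  have hna := absOfVal_nonarch v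
  let G : Valuation K[X] ℝ≥0 :=
    { toFun := fun p => ⟨gaussNorm (absOfVal v) c p, gaussNorm_nonneg _ _ hc.le⟩
      map_zero' := Subtype.ext (gaussNorm_zero (absOfVal v) c)
      map_one' := Subtype.ext (by simpa using gaussNorm_C (absOfVal v) c (1 : K))
      map_mul' := fun p q => Subtype.ext (gaussNorm_mul hna hc p q)
      map_add_le_max' := fun p q => isNonarchimedean_gaussNorm _ hna hc.le p q }
  have hG : ∀ p, (G p : ℝ) = gaussNorm (absOfVal v) c p := fun p => rfl
  -- Only the zero polynomial has Gauss norm zero, so the Gauss valuation extends to the field of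
  -- fractions.
  have hS : nonZeroDivisors K[X] ≤ G.supp.primeCompl := by
    intro p hp h
    have h0 : gaussNorm (absOfVal v) c p = 0 := by
      rw [← hG, (Valuation.mem_supp_iff _ _).1 h, NNReal.coe_zero]
    exact nonZeroDivisors.ne_zero hp ((gaussNorm_eq_zero_iff (absOfVal v) p
      (fun x hx => (AbsoluteValue.eq_zero _).1 hx) hc).1 h0)
  let W : Valuation (RatFunc K) ℝ≥0 := G.extendToLocalization hS (RatFunc K)
  have hW : ∀ p : K[X], W (algebraMap K[X] (RatFunc K) p) = G p := fun p =>
    Valuation.extendToLocalization_apply_map_apply _ _ _ _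
  let N : AbsoluteValue (RatFunc K) ℝ :=
    { toFun := fun x => W x
      map_mul' := fun x y => by simp
      nonneg' := fun x => NNReal.coe_nonneg _
      eq_zero' := fun x => by simp
      add_le' := fun x y => by
        have h : (W (x + y) : ℝ) ≤ max (W x : ℝ) (W y) := by exact_mod_cast W.map_add x y
        exact h.trans (max_le_add_of_nonneg (NNReal.coe_nonneg _) (NNReal.coe_nonneg _)) }
  have hN : ∀ p : K[X], N (algebraMap K[X] (RatFunc K) p) = gaussNorm (absOfVal v) c p := fun p => by
    rw [← hG, ← hW]; rfl
  obtain ⟨L, i1, i2, i3, V, hV⟩ := exists_algClosed_extension N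
    (fun x y => by exact_mod_cast W.map_add x y) (by
      obtain ⟨x, hx0, hx⟩ := hv
      rcases lt_or_gt_of_ne hx with h | h
      · refine ⟨algebraMap K[X] _ (C x), ?_⟩
        rw [hN, gaussNorm_C, absOfVal_apply, ← expNeg_zero]
        exact expNeg_strictAnti h
      · refine ⟨algebraMap K[X] _ (C x⁻¹), ?_⟩
        rw [hN, gaussNorm_C, map_inv₀]
        refine (one_lt_inv₀ ((absOfVal v).pos hx0)).2 ?_
        rw [absOfVal_apply, ← expNeg_zero]
        exact expNeg_strictAnti h)
  let j : K[X] →+* L := (algebraMap (RatFunc K) L).comp (algebraMap K[X] (RatFunc K))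
  let iK : Algebra K L := (j.comp C).toAlgebra
  have hp : ∀ p : K[X], aeval (j X) p = j p := fun p => by
    have : eval₂RingHom (j.comp C) (j X) = j := by ext <;> simp
    exact congrArg (fun φ : K[X] →+* L => φ p) this
  have hj : ∀ p : K[X], expNeg (V (j p)) = gaussNorm (absOfVal v) c p := fun p => by
    rw [← hN, ← hV]; rfl
  refine ⟨L, i1, iK, i3, V, j X, fun x => ?_, fun p => ⟨fun a => ?_, ?_⟩⟩
  · apply expNeg_strictAnti.injective
    exact (hj (C x)).trans (gaussNorm_C _ _ _)
  · rw [hp, ← expNeg_le_iff, ← hcoe, hj]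
    exact le_gaussNorm _ _ hc.le a
  · obtain ⟨a, ha⟩ := exists_eq_gaussNorm (absOfVal v) c p
    exact ⟨a, by rw [hp]; apply expNeg_strictAnti.injective; rw [← hcoe, hj, ha]⟩

end

/-! ### Newton polygons: roots of prescribed value -/

section

open Polynomial

variable {L : Type*} [Field L]

/-- The tropical polynomial of `p` has at `w` the value `A`, attained only at the exponent `a`. -/
def UniqueMin (V : AddValuation L (WithTop ℝ)) (w : ℝ) (p : L[X]) (A : ℝ) (a : ℕ) : Prop :=
  V (p.coeff a) = ((A - a * w : ℝ) : WithTop ℝ) ∧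
    ∀ i ≠ a, ((A - i * w : ℝ) : WithTop ℝ) < V (p.coeff i)

variable {V : AddValuation L (WithTop ℝ)} {w : ℝ}

lemma UniqueMin.le {p : L[X]} {A : ℝ} {a : ℕ} (h : UniqueMin V w p A a) (i : ℕ) :
    ((A - i * w : ℝ) : WithTop ℝ) ≤ V (p.coeff i) := by
  rcases eq_or_ne i a with rfl | hi
  · exact h.1.ge
  · exact (h.2 i hi).le

/-- Among all products of a term of `p` and a term of `q`, only the product of the two minimal terms
attains the sum of the minima. Nothing can cancel it, by the ultrametric inequality. -/
lemma UniqueMin.mul {p q : L[X]} {A B : ℝ} {a b : ℕ} (hp : UniqueMin V w p A a)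
    (hq : UniqueMin V w q B b) : UniqueMin V w (p * q) (A + B) (a + b) := by
  have key : ∀ i j : ℕ, (i, j) ≠ (a, b) →
      ((A + B - (i + j : ℕ) * w : ℝ) : WithTop ℝ) < V (p.coeff i * q.coeff j) := by
    intro i j hij
    have e : ((A + B - (i + j : ℕ) * w : ℝ) : WithTop ℝ)
        = ((A - i * w : ℝ) : WithTop ℝ) + ((B - j * w : ℝ) : WithTop ℝ) := by
      rw [← WithTop.coe_add]; congr 1; push_cast; ring
    rw [e, V.map_mul]
    rcases eq_or_ne i a with rfl | hi
    · have hj : j ≠ b := fun h => hij (by rw [h])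
      exact WithTop.add_lt_add_of_le_of_lt (WithTop.coe_ne_top) (hp.le i) (hq.2 j hj)
    · exact WithTop.add_lt_add_of_lt_of_le (WithTop.coe_ne_top) (hp.2 i hi) (hq.le j)
  refine ⟨?_, fun c hc => ?_⟩
  · have hmem : (a, b) ∈ Finset.HasAntidiagonal.antidiagonal (a + b) :=
      Finset.HasAntidiagonal.mem_antidiagonal.2 rfl
    rw [coeff_mul, ← Finset.add_sum_erase _ _ hmem]
    have hab : V (p.coeff a * q.coeff b) = ((A + B - (a + b : ℕ) * w : ℝ) : WithTop ℝ) := by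
      rw [V.map_mul, hp.1, hq.1, ← WithTop.coe_add]; congr 1; push_cast; ring
    rw [AddValuation.map_add_eq_of_lt_left, hab]
    rw [hab]
    refine V.map_lt_sum WithTop.coe_ne_top fun x hx => ?_
    obtain ⟨hx1, hx2⟩ := Finset.mem_erase.1 hx
    rw [← Finset.HasAntidiagonal.mem_antidiagonal.1 hx2]
    exact key x.1 x.2 hx1
  · rw [coeff_mul]
    refine V.map_lt_sum WithTop.coe_ne_top fun x hx => ?_
    rw [← Finset.HasAntidiagonal.mem_antidiagonal.1 hx]
    refine key x.1 x.2 ?_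
    intro hx'
    rw [← Finset.HasAntidiagonal.mem_antidiagonal.1 hx, (Prod.ext_iff.1 hx').1,
      (Prod.ext_iff.1 hx').2] at hc
    exact hc rfl

lemma uniqueMin_C {c : L} (hc : c ≠ 0) : ∃ A a, UniqueMin V w (C c) A a := by
  obtain ⟨A, hA⟩ := WithTop.ne_top_iff_exists.1 (mt V.top_iff.1 hc)
  refine ⟨A, 0, by simp [hA], fun i hi => ?_⟩
  rw [coeff_C_of_ne_zero hi, V.map_zero]
  exact WithTop.coe_lt_top _

/-- The two terms of `X - r` have the values `w` and `V r` at `w`, which differ by assumption; the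
smaller one decides whether the exponent is `0` or `1`. -/
lemma uniqueMin_X_sub_C {r : L} (hr : V r ≠ (w : WithTop ℝ)) :
    ∃ A a, UniqueMin V w (X - C r) A a := by
  have hlarge : ∀ (A : ℝ) (i : ℕ), 2 ≤ i →
      ((A - i * w : ℝ) : WithTop ℝ) < V ((X - C r : L[X]).coeff i) := by
    intro A i hi
    rw [coeff_sub, coeff_X, coeff_C, if_neg (by omega), if_neg (by omega), sub_zero, V.map_zero]
    exact WithTop.coe_lt_top _
  rcases lt_or_gt_of_ne hr with h | h
  · obtain ⟨A, hA⟩ := WithTop.ne_top_iff_exists.1 (h.trans (WithTop.coe_lt_top w)).ne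
    refine ⟨A, 0, by simp [hA, V.map_neg], fun i hi => ?_⟩
    rcases (by omega : i = 1 ∨ 2 ≤ i) with rfl | hi
    · rw [← hA, WithTop.coe_lt_coe] at h
      simp only [coeff_sub, coeff_X_one, coeff_C_succ, sub_zero, V.map_one, Nat.cast_one, one_mul]
      rw [← WithTop.coe_zero, WithTop.coe_lt_coe]
      linarith
    · exact hlarge _ _ hi
  · refine ⟨w, 1, by simp, fun i hi => ?_⟩
    rcases (by omega : i = 0 ∨ 2 ≤ i) with rfl | hi
    · simpa [V.map_neg] using h
    · exact hlarge _ _ hi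

/-- A polynomial over an algebraically closed valued field whose tropical polynomial attains its
minimum at `w` twice has a root of value `w`. -/
theorem exists_root_of_two_min [IsAlgClosed L] (h : L[X]) {M : ℝ}
    (hM : ∀ i : ℕ, ((M - i * w : ℝ) : WithTop ℝ) ≤ V (h.coeff i)) {a b : ℕ} (hab : a ≠ b)
    (ha : V (h.coeff a) = ((M - a * w : ℝ) : WithTop ℝ))
    (hb : V (h.coeff b) = ((M - b * w : ℝ) : WithTop ℝ)) :
    ∃ z, h.eval z = 0 ∧ V z = (w : WithTop ℝ) := by
  by_contra! hno
  have h0 : h ≠ 0 := by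
    rintro rfl
    rw [coeff_zero, V.map_zero] at ha
    exact WithTop.coe_ne_top ha.symm
  -- If no root has value `w`, every linear factor has a unique minimal term, hence so has their
  -- product `h`, against `a ≠ b`.
  have hprod : ∀ s : Multiset L, (∀ r ∈ s, V r ≠ (w : WithTop ℝ)) →
      ∃ A c, UniqueMin V w (s.map fun r => X - C r).prod A c := by
    intro s
    induction s using Multiset.induction with
    | empty => intro _; simpa using uniqueMin_C (V := V) (w := w) (one_ne_zero (α := L))
    | cons r s ih =>
      intro hs
      obtain ⟨A, a, hA⟩ := uniqueMin_X_sub_C (hs r (Multiset.mem_cons_self r s))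
      obtain ⟨B, b, hB⟩ := ih fun r hr => hs r (Multiset.mem_cons_of_mem hr)
      rw [Multiset.map_cons, Multiset.prod_cons]
      exact ⟨_, _, hA.mul hB⟩
  obtain ⟨A, c, hA⟩ := hprod h.roots fun r hr => hno r (isRoot_of_mem_roots hr)
  obtain ⟨B, e, hB⟩ := uniqueMin_C (V := V) (w := w) (leadingCoeff_ne_zero.2 h0)
  have hh := hB.mul hA
  rw [← (IsAlgClosed.splits h).eq_prod_roots] at hh
  have hval : ∀ i, V (h.coeff i) = ((M - i * w : ℝ) : WithTop ℝ) → i = e + c := by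
    intro i hi
    by_contra hne
    have h1 := hh.2 i hne
    rw [hi, WithTop.coe_lt_coe] at h1
    have h2 := hM (e + c)
    rw [hh.1, WithTop.coe_le_coe] at h2
    linarith
  exact hab ((hval a ha).trans (hval b hb).symm)

end

/-! ### Polynomials `p(x₀) + q(x_{i+1})` and their plane curves -/

section

universe u

/-- A zero of `f` over a valued extension field tropicalizes to a point of `𝒯(f)`. -/
theorem mem_tropHypersurface_of_zero {K : Type*} [Field K] {n : ℕ}
    (v : AddValuation K (WithTop ℝ)) {L : Type*} [Field L] [Algebra K L]
    (V : AddValuation L (WithTop ℝ)) (hV : ∀ x, V (algebraMap K L x) = v x)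
    (f : MvPolynomial (Fin n) K) (z : Fin n → L) (w : Fin n → ℝ)
    (hz : ∀ k, V (z k) = ((w k : ℝ) : WithTop ℝ)) (hf : MvPolynomial.aeval z f = 0) :
    w ∈ tropHypersurface v f := by
  by_cases h0 : f = 0
  · exact Or.inl h0
  refine Or.inr ?_
  have hterm : ∀ α, V (algebraMap K L (f.coeff α) * ∏ i, z i ^ α i) = tropTerm v f w α := by
    intro α
    have hprod : ∀ s : Finset (Fin n), V (∏ i ∈ s, z i ^ α i)
        = ((∑ i ∈ s, (α i : ℝ) * w i : ℝ) : WithTop ℝ) := by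
      intro s
      induction s using Finset.induction with
      | empty => simp
      | insert a s ha ih =>
        rw [Finset.prod_insert ha, Finset.sum_insert ha, V.map_mul, ih, V.map_pow, hz,
          WithTop.coe_add, ← WithTop.coe_nsmul, nsmul_eq_mul]
    rw [V.map_mul, hV, hprod, tropTerm]
  obtain ⟨α, hα, hmin⟩ := Finset.exists_min_image f.support (tropTerm v f w)
    (MvPolynomial.support_nonempty.2 h0)
  by_contra hnt
  rw [Set.not_nontrivial_iff] at hnt
  -- A minimum attained only once would give one dominant summand of `f(z)`, so that `f(z)` would
  -- have finite value and could not vanish.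
  have hlt : ∀ β ∈ f.support.erase α, tropTerm v f w α < tropTerm v f w β := by
    intro β hβ
    obtain ⟨hne, hβ⟩ := Finset.mem_erase.1 hβ
    refine lt_of_le_of_ne (hmin β hβ) fun h => hne (hnt ⟨hβ, fun γ hγ => ?_⟩ ⟨hα, hmin⟩)
    rw [← h]
    exact hmin γ hγ
  have hfin : tropTerm v f w α ≠ ⊤ := by
    rw [tropTerm]
    exact WithTop.add_ne_top.2 ⟨mt v.top_iff.1 (MvPolynomial.mem_support_iff.1 hα),
      WithTop.coe_ne_top⟩
  rw [MvPolynomial.aeval_def, MvPolynomial.eval₂_eq', ← Finset.add_sum_erase _ _ hα] at hf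
  have := congrArg V hf
  rw [AddValuation.map_add_eq_of_lt_left, hterm, V.map_zero] at this
  · exact hfin this
  · rw [hterm]
    refine V.map_lt_sum hfin fun β hβ => ?_
    rw [hterm]
    exact hlt β hβ

/-- The value of the tropical monomial `a` with coefficient of value `P a`. -/
def term (P : ℕ → ℝ) (s : ℝ) (a : ℕ) : ℝ := P a + a * s

/-- The term `a` of the polynomial in the first variable is minimal at `(s, y)`. -/
def MinA (d : ℕ) (P Q : ℕ → ℝ) (s y : ℝ) (a : ℕ) : Prop :=
  a ≤ d ∧ (∀ a' ≤ d, term P s a ≤ term P s a') ∧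
    ∀ b', 1 ≤ b' → b' ≤ d → term P s a ≤ term Q y b'

/-- The term `b` of the polynomial in the second variable is minimal at `(s, y)`. -/
def MinB (d : ℕ) (P Q : ℕ → ℝ) (s y : ℝ) (b : ℕ) : Prop :=
  (1 ≤ b ∧ b ≤ d) ∧ (∀ a' ≤ d, term Q y b ≤ term P s a') ∧
    ∀ b', 1 ≤ b' → b' ≤ d → term Q y b ≤ term Q y b'

/-- The plane tropical curve of a polynomial `p(x) + q(y)`. -/
def planeCurve (d : ℕ) (P Q : ℕ → ℝ) : Set (ℝ × ℝ) :=
  {x | (∃ a a', a ≠ a' ∧ MinA d P Q x.1 x.2 a ∧ MinA d P Q x.1 x.2 a') ∨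
    (∃ b b', b ≠ b' ∧ MinB d P Q x.1 x.2 b ∧ MinB d P Q x.1 x.2 b') ∨
    ∃ a b, MinA d P Q x.1 x.2 a ∧ MinB d P Q x.1 x.2 b}

variable {K : Type u} [Field K] {m : ℕ}

/-- The polynomial `p(x₀) + q(x_{i+1})` where `p` has the coefficients `p 0, …, p d` and `q` has
the coefficients `q 1, …, q d`. -/
def splitPoly (i : Fin m) (d : ℕ) (p q : ℕ → K) : MvPolynomial (Fin (m + 1)) K :=
  ∑ a ∈ Finset.range (d + 1), MvPolynomial.monomial (Finsupp.single 0 a) (p a) +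
    ∑ b ∈ Finset.Icc 1 d, MvPolynomial.monomial (Finsupp.single i.succ b) (q b)

variable {i : Fin m} {d : ℕ} {p q : ℕ → K}

/-- The bound `1 ≤ b` is essential: for exponent zero both families would contain the constant
monomial, which is counted with `p`. -/
lemma single_zero_ne_single_succ (a b : ℕ) (hb : 1 ≤ b) :
    (Finsupp.single 0 a : Fin (m + 1) →₀ ℕ) ≠ Finsupp.single i.succ b := by
  intro h
  have := DFunLike.congr_fun h i.succ
  rw [Finsupp.single_eq_same, Finsupp.single_eq_of_ne (Fin.succ_ne_zero i)] at this
  omega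

lemma coeff_splitPoly_zero {a : ℕ} (ha : a ≤ d) :
    (splitPoly i d p q).coeff (Finsupp.single 0 a) = p a := by
  rw [splitPoly, MvPolynomial.coeff_add, MvPolynomial.coeff_sum, MvPolynomial.coeff_sum,
    Finset.sum_eq_single a, Finset.sum_eq_zero, MvPolynomial.coeff_monomial, if_pos rfl, add_zero]
  · intro b hb
    rw [MvPolynomial.coeff_monomial, if_neg]
    exact (single_zero_ne_single_succ a b (Finset.mem_Icc.1 hb).1).symm
  · intro b _ hb
    rw [MvPolynomial.coeff_monomial, if_neg]
    exact fun h => hb (Finsupp.single_injective _ h)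
  · intro h
    exact absurd (Finset.mem_range.2 (by omega)) h

lemma coeff_splitPoly_succ {b : ℕ} (hb1 : 1 ≤ b) (hb : b ≤ d) :
    (splitPoly i d p q).coeff (Finsupp.single i.succ b) = q b := by
  rw [splitPoly, MvPolynomial.coeff_add, MvPolynomial.coeff_sum, MvPolynomial.coeff_sum,
    Finset.sum_eq_zero, Finset.sum_eq_single b, MvPolynomial.coeff_monomial, if_pos rfl, zero_add]
  · intro b _ hb
    rw [MvPolynomial.coeff_monomial, if_neg]
    exact fun h => hb (Finsupp.single_injective _ h)
  · intro h
    exact absurd (Finset.mem_Icc.2 ⟨hb1, hb⟩) h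
  · intro a _
    rw [MvPolynomial.coeff_monomial, if_neg]
    exact single_zero_ne_single_succ a b hb1

lemma mem_support_splitPoly (hp : ∀ a ≤ d, p a ≠ 0) (hq : ∀ b, 1 ≤ b → b ≤ d → q b ≠ 0)
    (α : Fin (m + 1) →₀ ℕ) : α ∈ (splitPoly i d p q).support ↔
      (∃ a ≤ d, α = Finsupp.single 0 a) ∨ ∃ b, (1 ≤ b ∧ b ≤ d) ∧ α = Finsupp.single i.succ b := by
  constructor
  · intro h
    by_contra! hno
    rw [MvPolynomial.mem_support_iff, splitPoly, MvPolynomial.coeff_add, MvPolynomial.coeff_sum,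
      MvPolynomial.coeff_sum, Finset.sum_eq_zero, Finset.sum_eq_zero, add_zero] at h
    · exact h rfl
    · intro b hb
      rw [MvPolynomial.coeff_monomial, if_neg]
      exact fun h => hno.2 b (Finset.mem_Icc.1 hb) h.symm
    · intro a ha
      rw [MvPolynomial.coeff_monomial, if_neg]
      exact fun h => hno.1 a (by have := Finset.mem_range.1 ha; omega) h.symm
  · rintro (⟨a, ha, rfl⟩ | ⟨b, hb, rfl⟩)
    · rw [MvPolynomial.mem_support_iff, coeff_splitPoly_zero ha]
      exact hp a ha
    · rw [MvPolynomial.mem_support_iff, coeff_splitPoly_succ hb.1 hb.2]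
      exact hq b hb.1 hb.2

lemma sum_single_mul (k : Fin (m + 1)) (a : ℕ) (w : Fin (m + 1) → ℝ) :
    ∑ j, ((Finsupp.single k a : Fin (m + 1) →₀ ℕ) j : ℝ) * w j = a * w k := by
  rw [Finset.sum_eq_single k, Finsupp.single_eq_same]
  · intro j _ hj
    rw [Finsupp.single_eq_of_ne hj, Nat.cast_zero, zero_mul]
  · exact fun h => absurd (Finset.mem_univ _) h

variable {v : AddValuation K (WithTop ℝ)} {P Q : ℕ → ℝ}

lemma tropTerm_splitPoly_zero (hP : ∀ a ≤ d, v (p a) = (P a : WithTop ℝ)) {a : ℕ} (ha : a ≤ d)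
    (w : Fin (m + 1) → ℝ) :
    tropTerm v (splitPoly i d p q) w (Finsupp.single 0 a) = (term P (w 0) a : WithTop ℝ) := by
  rw [tropTerm, coeff_splitPoly_zero ha, hP a ha, sum_single_mul, ← WithTop.coe_add, term]

lemma tropTerm_splitPoly_succ (hQ : ∀ b, 1 ≤ b → b ≤ d → v (q b) = (Q b : WithTop ℝ)) {b : ℕ}
    (hb1 : 1 ≤ b) (hb : b ≤ d) (w : Fin (m + 1) → ℝ) :
    tropTerm v (splitPoly i d p q) w (Finsupp.single i.succ b)
      = (term Q (w i.succ) b : WithTop ℝ) := by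
  rw [tropTerm, coeff_splitPoly_succ hb1 hb, hQ b hb1 hb, sum_single_mul, ← WithTop.coe_add, term]

lemma ne_zero_of_val {x : K} {r : ℝ} (h : v x = (r : WithTop ℝ)) : x ≠ 0 := by
  rintro rfl
  rw [v.map_zero] at h
  exact WithTop.coe_ne_top h.symm

/-- The reduction to plane data: every monomial involves only `x₀` or only `x_{i+1}`, so minimality
depends on these two coordinates alone. -/
lemma mem_argmin_splitPoly (hP : ∀ a ≤ d, v (p a) = (P a : WithTop ℝ))
    (hQ : ∀ b, 1 ≤ b → b ≤ d → v (q b) = (Q b : WithTop ℝ)) (w : Fin (m + 1) → ℝ)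
    (α : Fin (m + 1) →₀ ℕ) : α ∈ argmin v (splitPoly i d p q) w ↔
      (∃ a, α = Finsupp.single 0 a ∧ MinA d P Q (w 0) (w i.succ) a) ∨
      ∃ b, α = Finsupp.single i.succ b ∧ MinB d P Q (w 0) (w i.succ) b := by
  have hs := mem_support_splitPoly (i := i) (fun a ha => ne_zero_of_val (hP a ha))
    (fun b hb1 hb => ne_zero_of_val (hQ b hb1 hb))
  have hall : ∀ T : ℝ, (∀ β ∈ (splitPoly i d p q).support,
      (T : WithTop ℝ) ≤ tropTerm v (splitPoly i d p q) w β) ↔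
      (∀ a' ≤ d, T ≤ term P (w 0) a') ∧ ∀ b', 1 ≤ b' → b' ≤ d → T ≤ term Q (w i.succ) b' := by
    intro T
    constructor
    · intro h
      refine ⟨fun a ha => ?_, fun b hb1 hb => ?_⟩
      · have := h _ ((hs _).2 (Or.inl ⟨a, ha, rfl⟩))
        rwa [tropTerm_splitPoly_zero hP ha, WithTop.coe_le_coe] at this
      · have := h _ ((hs _).2 (Or.inr ⟨b, ⟨hb1, hb⟩, rfl⟩))
        rwa [tropTerm_splitPoly_succ hQ hb1 hb, WithTop.coe_le_coe] at this
    · rintro ⟨h1, h2⟩ β hβ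
      rcases (hs β).1 hβ with ⟨a, ha, rfl⟩ | ⟨b, hb, rfl⟩
      · rw [tropTerm_splitPoly_zero hP ha, WithTop.coe_le_coe]
        exact h1 a ha
      · rw [tropTerm_splitPoly_succ hQ hb.1 hb.2, WithTop.coe_le_coe]
        exact h2 b hb.1 hb.2
  constructor
  · rintro ⟨h1, h2⟩
    rcases (hs α).1 h1 with ⟨a, ha, rfl⟩ | ⟨b, hb, rfl⟩
    · rw [tropTerm_splitPoly_zero hP ha, hall] at h2
      exact Or.inl ⟨a, rfl, ha, h2⟩
    · rw [tropTerm_splitPoly_succ hQ hb.1 hb.2, hall] at h2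
      exact Or.inr ⟨b, rfl, hb, h2⟩
  · rintro (⟨a, rfl, ha, h⟩ | ⟨b, rfl, hb, h⟩)
    · refine ⟨(hs _).2 (Or.inl ⟨a, ha, rfl⟩), ?_⟩
      rw [tropTerm_splitPoly_zero hP ha, hall]
      exact h
    · refine ⟨(hs _).2 (Or.inr ⟨b, hb, rfl⟩), ?_⟩
      rw [tropTerm_splitPoly_succ hQ hb.1 hb.2, hall]
      exact h

lemma splitPoly_ne_zero (hP : ∀ a ≤ d, v (p a) = (P a : WithTop ℝ)) : splitPoly i d p q ≠ 0 := by
  intro h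
  have := coeff_splitPoly_zero (i := i) (p := p) (q := q) (Nat.zero_le d)
  rw [h, MvPolynomial.coeff_zero] at this
  exact ne_zero_of_val (hP 0 (Nat.zero_le d)) this.symm

lemma mem_tropHypersurface_splitPoly (hP : ∀ a ≤ d, v (p a) = (P a : WithTop ℝ))
    (hQ : ∀ b, 1 ≤ b → b ≤ d → v (q b) = (Q b : WithTop ℝ)) (w : Fin (m + 1) → ℝ) :
    w ∈ tropHypersurface v (splitPoly i d p q) ↔ (w 0, w i.succ) ∈ planeCurve d P Q := by
  have hm := mem_argmin_splitPoly (i := i) hP hQ w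
  constructor
  · rintro (h | ⟨α, hα, β, hβ, hne⟩)
    · exact absurd h (splitPoly_ne_zero hP)
    rcases (hm α).1 hα with ⟨a, rfl, ha⟩ | ⟨a, rfl, ha⟩ <;>
      rcases (hm β).1 hβ with ⟨b, rfl, hb⟩ | ⟨b, rfl, hb⟩
    · exact Or.inl ⟨a, b, fun h => hne (by rw [h]), ha, hb⟩
    · exact Or.inr (Or.inr ⟨a, b, ha, hb⟩)
    · exact Or.inr (Or.inr ⟨b, a, hb, ha⟩)
    · exact Or.inr (Or.inl ⟨a, b, fun h => hne (by rw [h]), ha, hb⟩)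
  · rintro (⟨a, b, hne, ha, hb⟩ | ⟨a, b, hne, ha, hb⟩ | ⟨a, b, ha, hb⟩)
    · exact Or.inr ⟨_, (hm _).2 (Or.inl ⟨a, rfl, ha⟩), _, (hm _).2 (Or.inl ⟨b, rfl, hb⟩),
        fun h => hne (Finsupp.single_injective _ h)⟩
    · exact Or.inr ⟨_, (hm _).2 (Or.inr ⟨a, rfl, ha⟩), _, (hm _).2 (Or.inr ⟨b, rfl, hb⟩),
        fun h => hne (Finsupp.single_injective _ h)⟩
    · exact Or.inr ⟨_, (hm _).2 (Or.inl ⟨a, rfl, ha⟩), _, (hm _).2 (Or.inr ⟨b, rfl, hb⟩),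
        single_zero_ne_single_succ a b hb.1.1⟩

end

/-! ### Lifting points of the intersection to common zeros -/

section

universe u

open Polynomial

/-- `s` is a tropical root of the polynomial with the coefficient values `P 0, …, P d`. -/
def IsTropRoot (d : ℕ) (P : ℕ → ℝ) (s : ℝ) : Prop :=
  ∃ a a', a ≠ a' ∧ a ≤ d ∧ a' ≤ d ∧ (∀ c ≤ d, term P s a ≤ term P s c) ∧
    ∀ c ≤ d, term P s a' ≤ term P s c

/-- `M` is the value at `s` of the tropical polynomial with coefficient values `P 0, …, P d`. -/
def IsTropValue (d : ℕ) (P : ℕ → ℝ) (s M : ℝ) : Prop :=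
  (∃ a ≤ d, M = term P s a) ∧ ∀ a ≤ d, M ≤ term P s a

lemma exists_isTropValue (d : ℕ) (P : ℕ → ℝ) (s : ℝ) : ∃ M, IsTropValue d P s M := by
  obtain ⟨a, ha, hmin⟩ := Finset.exists_min_image (Finset.range (d + 1)) (term P s) ⟨0, by simp⟩
  exact ⟨_, ⟨a, by have := Finset.mem_range.1 ha; omega, rfl⟩,
    fun b hb => hmin b (Finset.mem_range.2 (by omega))⟩

lemma coeff_sum_monomial {R : Type*} [Semiring R] (S : Finset ℕ) (p : ℕ → R) (a : ℕ) :
    (∑ b ∈ S, monomial b (p b)).coeff a = if a ∈ S then p a else 0 := by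
  simp only [finsetSum_coeff, coeff_monomial, Finset.sum_ite_eq']

variable {K : Type u} [Field K] {v : AddValuation K (WithTop ℝ)}
  {L : Type u} [Field L] [Algebra K L] {V : AddValuation L (WithTop ℝ)}
  {d : ℕ} {p q : ℕ → K} {P Q : ℕ → ℝ}

lemma val_mul_pow (hV : ∀ x, V (algebraMap K L x) = v x) {a : ℕ} (hP : v (p a) = (P a : WithTop ℝ))
    {z : L} {s : ℝ} (hz : V z = (s : WithTop ℝ)) :
    V (algebraMap K L (p a) * z ^ a) = (term P s a : WithTop ℝ) := by
  rw [V.map_mul, hV, hP, V.map_pow, hz, ← WithTop.coe_nsmul, ← WithTop.coe_add, nsmul_eq_mul, term]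

lemma aeval_splitPoly {m : ℕ} (i : Fin m) (z : Fin (m + 1) → L) :
    MvPolynomial.aeval z (splitPoly i d p q)
      = ∑ a ∈ Finset.range (d + 1), algebraMap K L (p a) * z 0 ^ a +
        ∑ b ∈ Finset.Icc 1 d, algebraMap K L (q b) * z i.succ ^ b := by
  simp [splitPoly, MvPolynomial.aeval_monomial]

/-- Away from the tropical roots the value of `p(z)` is determined by the value of `z`. -/
lemma val_sum_of_not_isTropRoot (hV : ∀ x, V (algebraMap K L x) = v x)
    (hP : ∀ a ≤ d, v (p a) = (P a : WithTop ℝ)) {z : L} {s : ℝ} (hz : V z = (s : WithTop ℝ))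
    (hs : ¬ IsTropRoot d P s) {M : ℝ} (hM : IsTropValue d P s M) :
    V (∑ a ∈ Finset.range (d + 1), algebraMap K L (p a) * z ^ a) = (M : WithTop ℝ) := by
  obtain ⟨⟨a, ha, rfl⟩, hmin⟩ := hM
  have hval : ∀ c ≤ d, V (algebraMap K L (p c) * z ^ c) = (term P s c : WithTop ℝ) :=
    fun c hc => val_mul_pow hV (hP c hc) hz
  rw [← Finset.add_sum_erase _ _ (Finset.mem_range.2 (by omega : a < d + 1)),
    AddValuation.map_add_eq_of_lt_left, hval a ha]
  rw [hval a ha]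
  refine V.map_lt_sum WithTop.coe_ne_top fun c hc => ?_
  obtain ⟨hne, hc⟩ := Finset.mem_erase.1 hc
  have hc : c ≤ d := by have := Finset.mem_range.1 hc; omega
  rw [hval c hc, WithTop.coe_lt_coe]
  refine lt_of_le_of_ne (hmin c hc) fun h => hs ⟨a, c, hne.symm, ha, hc, hmin, ?_⟩
  rw [← h]
  exact hmin

/-- The value at a generic element. -/
lemma val_sum_of_generic (S : Finset ℕ) (hS : S.Nonempty)
    (hP : ∀ a ∈ S, v (p a) = (P a : WithTop ℝ)) {t : L} {s : ℝ}
    (ht : ∀ p : K[X], (∀ a, V (aeval t p) ≤ v (p.coeff a) + ((a * s : ℝ) : WithTop ℝ)) ∧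
        ∃ a, V (aeval t p) = v (p.coeff a) + ((a * s : ℝ) : WithTop ℝ)) :
    ∃ a ∈ S, V (∑ a ∈ S, algebraMap K L (p a) * t ^ a) = (term P s a : WithTop ℝ) ∧
      ∀ c ∈ S, term P s a ≤ term P s c := by
  have heval : aeval t (∑ a ∈ S, monomial a (p a)) = ∑ a ∈ S, algebraMap K L (p a) * t ^ a := by
    simp [aeval_monomial]
  obtain ⟨h1, a, ha⟩ := ht (∑ a ∈ S, monomial a (p a))
  rw [heval] at h1 ha
  simp only [coeff_sum_monomial] at h1 ha
  have h1' : ∀ c ∈ S, V (∑ a ∈ S, algebraMap K L (p a) * t ^ a) ≤ (term P s c : WithTop ℝ) := by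
    intro c hc
    have := h1 c
    rwa [if_pos hc, hP c hc, ← WithTop.coe_add] at this
  have haS : a ∈ S := by
    by_contra hno
    rw [if_neg hno, v.map_zero, top_add] at ha
    obtain ⟨c, hc⟩ := hS
    have := h1' c hc
    rw [ha, top_le_iff] at this
    exact WithTop.coe_ne_top this
  rw [if_pos haS, hP a haS, ← WithTop.coe_add] at ha
  refine ⟨a, haS, ha, fun c hc => ?_⟩
  have := h1' c hc
  rw [ha, WithTop.coe_le_coe] at this
  exact this

/-- Solving `c + q(y) = 0` with prescribed value of `y`. -/
lemma exists_root_second [IsAlgClosed L] (hV : ∀ x, V (algebraMap K L x) = v x)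
    (hQ : ∀ b, 1 ≤ b → b ≤ d → v (q b) = (Q b : WithTop ℝ)) {c : L} {s y M : ℝ}
    (hM : IsTropValue d P s M) (hc : V c = (M : WithTop ℝ)) (hcurve : (s, y) ∈ planeCurve d P Q)
    (hB : ∃ b, MinB d P Q s y b) :
    ∃ ζ, V ζ = (y : WithTop ℝ) ∧ c + ∑ b ∈ Finset.Icc 1 d, algebraMap K L (q b) * ζ ^ b = 0 := by
  obtain ⟨b, hb⟩ := hB
  -- All terms of `p` are merged into the constant coefficient `c`, whose value `M` is their
  -- minimum. A point of the plane curve therefore makes the minimum of `h` at `y` be attained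
  -- twice.
  set h : L[X] := C c + ∑ b ∈ Finset.Icc 1 d, monomial b (algebraMap K L (q b)) with hh
  have hcoef0 : h.coeff 0 = c := by
    rw [hh, coeff_add, coeff_sum_monomial, coeff_C_zero, if_neg (by simp), add_zero]
  have hcoef : ∀ b, 1 ≤ b → b ≤ d → h.coeff b = algebraMap K L (q b) := by
    intro b hb1 hb
    rw [hh, coeff_add, coeff_sum_monomial, coeff_C_of_ne_zero (by omega),
      if_pos (Finset.mem_Icc.2 ⟨hb1, hb⟩), zero_add]
  have hcoef' : ∀ b, d < b → h.coeff b = 0 := by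
    intro b hb
    rw [hh, coeff_add, coeff_sum_monomial, coeff_C_of_ne_zero (by omega),
      if_neg (fun h => by have := (Finset.mem_Icc.1 h).2; omega), zero_add]
  obtain ⟨⟨a, ha, rfl⟩, hmin⟩ := hM
  have hle : ∀ i : ℕ, ((term Q y b - i * y : ℝ) : WithTop ℝ) ≤ V (h.coeff i) := by
    intro i
    rcases Nat.eq_zero_or_pos i with rfl | hi
    · rw [hcoef0, hc, WithTop.coe_le_coe]
      simpa using hb.2.1 a ha
    rcases le_or_gt i d with hid | hid
    · rw [hcoef i hi hid, hV, hQ i hi hid, WithTop.coe_le_coe]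
      have := hb.2.2 i hi hid
      unfold term at this ⊢
      linarith
    · rw [hcoef' i hid, V.map_zero]
      exact le_top
  have heqB : ∀ b', MinB d P Q s y b' →
      V (h.coeff b') = ((term Q y b - b' * y : ℝ) : WithTop ℝ) := by
    intro b' hb'
    have e : term Q y b = term Q y b' :=
      le_antisymm (hb.2.2 b' hb'.1.1 hb'.1.2) (hb'.2.2 b hb.1.1 hb.1.2)
    rw [e, hcoef b' hb'.1.1 hb'.1.2, hV, hQ b' hb'.1.1 hb'.1.2, term]
    congr 1
    ring
  have heqA : ∀ a', MinA d P Q s y a' →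
      V (h.coeff 0) = ((term Q y b - (0 : ℕ) * y : ℝ) : WithTop ℝ) := by
    intro a' ha'
    rw [hcoef0, hc]
    congr 1
    have h1 := ha'.2.2 b hb.1.1 hb.1.2
    have h2 := hb.2.1 a ha
    have h3 := hmin a' ha'.1
    push_cast
    linarith
  have hroot : ∃ z, h.eval z = 0 ∧ V z = (y : WithTop ℝ) := by
    -- When the tie is between two terms of `p`, both are hidden in the constant coefficient of `h`;
    -- the second minimal term is then supplied by `hB`.
    rcases hcurve with ⟨a, a', -, h1, -⟩ | ⟨b, b', hne, h1, h2⟩ | ⟨a, b', h1, h2⟩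
    · exact exists_root_of_two_min h hle (by have := hb.1.1; omega) (heqA a h1) (heqB b hb)
    · exact exists_root_of_two_min h hle hne (heqB b h1) (heqB b' h2)
    · exact exists_root_of_two_min h hle (by have := h2.1.1; omega) (heqA a h1) (heqB b' h2)
  obtain ⟨z, hz, hVz⟩ := hroot
  refine ⟨z, hVz, ?_⟩
  rw [← hz, hh, eval_add, eval_C, eval_finsetSum]
  simp [eval_monomial]

/-- Solving `p(x) + c = 0` with prescribed value of `x`. -/
lemma exists_root_first [IsAlgClosed L] (hV : ∀ x, V (algebraMap K L x) = v x)
    (hP : ∀ a ≤ d, v (p a) = (P a : WithTop ℝ)) {c : L} {s : ℝ} {a a' : ℕ} (hne : a ≠ a')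
    (ha : a ≤ d) (ha' : a' ≤ d) (hmin : ∀ c ≤ d, term P s a ≤ term P s c)
    (hmin' : ∀ c ≤ d, term P s a' ≤ term P s c) (hc : (term P s a : WithTop ℝ) < V c) :
    ∃ ζ, V ζ = (s : WithTop ℝ) ∧
      ∑ a ∈ Finset.range (d + 1), algebraMap K L (p a) * ζ ^ a + c = 0 := by
  set h : L[X] := C c + ∑ a ∈ Finset.range (d + 1), monomial a (algebraMap K L (p a)) with hh
  -- The summand `c` perturbs only the constant coefficient, and its value exceeds the minimum, so
  -- neither the minimum nor the places where it is attained change.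
  have hcoef0 : h.coeff 0 = c + algebraMap K L (p 0) := by
    rw [hh, coeff_add, coeff_sum_monomial, coeff_C_zero, if_pos (by simp)]
  have hcoef : ∀ b, 1 ≤ b → b ≤ d → h.coeff b = algebraMap K L (p b) := by
    intro b hb1 hb
    rw [hh, coeff_add, coeff_sum_monomial, coeff_C_of_ne_zero (by omega),
      if_pos (Finset.mem_range.2 (by omega)), zero_add]
  have hcoef' : ∀ b, d < b → h.coeff b = 0 := by
    intro b hb
    rw [hh, coeff_add, coeff_sum_monomial, coeff_C_of_ne_zero (by omega),
      if_neg (fun h => by have := Finset.mem_range.1 h; omega), zero_add]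
  have hle : ∀ i : ℕ, ((term P s a - i * s : ℝ) : WithTop ℝ) ≤ V (h.coeff i) := by
    intro i
    rcases Nat.eq_zero_or_pos i with rfl | hi
    · rw [hcoef0, Nat.cast_zero, zero_mul, sub_zero]
      refine V.map_le_add hc.le ?_
      rw [hV, hP 0 (Nat.zero_le d), WithTop.coe_le_coe]
      simpa [term] using hmin 0 (Nat.zero_le d)
    rcases le_or_gt i d with hid | hid
    · rw [hcoef i hi hid, hV, hP i hid, WithTop.coe_le_coe]
      have := hmin i hid
      unfold term at this ⊢
      linarith
    · rw [hcoef' i hid, V.map_zero]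
      exact le_top
  have heq : ∀ b ≤ d, (∀ c ≤ d, term P s b ≤ term P s c) →
      V (h.coeff b) = ((term P s a - b * s : ℝ) : WithTop ℝ) := by
    intro b hb hbmin
    have e : term P s a = term P s b := le_antisymm (hmin b hb) (hbmin a ha)
    have e' : v (p b) = ((term P s a - b * s : ℝ) : WithTop ℝ) := by
      rw [e, hP b hb, term]
      congr 1
      ring
    rcases Nat.eq_zero_or_pos b with rfl | hb0
    · rw [hcoef0, AddValuation.map_add_eq_of_lt_right, hV, e']
      rw [hV, e', Nat.cast_zero, zero_mul, sub_zero]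
      exact hc
    · rw [hcoef b hb0 hb, hV, e']
  obtain ⟨z, hz, hVz⟩ := exists_root_of_two_min h hle hne (heq a ha hmin) (heq a' ha' hmin')
  refine ⟨z, hVz, ?_⟩
  rw [← hz, hh, eval_add, eval_C, eval_finsetSum, add_comm]
  simp [eval_monomial]

/-- The points of an intersection of the hypersurfaces of polynomials `pᵢ(x₀) + qᵢ(x_{i+1})` such
that no two of the `pᵢ` have a common tropical root are tropicalizations of common zeros of these
polynomials. -/
theorem exists_common_zero {m : ℕ} (hv : ∃ x : K, x ≠ 0 ∧ v x ≠ 0) {d : Fin m → ℕ}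
    (hd : ∀ i, 1 ≤ d i) {p q : Fin m → ℕ → K} {P Q : Fin m → ℕ → ℝ}
    (hP : ∀ i, ∀ a ≤ d i, v (p i a) = (P i a : WithTop ℝ))
    (hQ : ∀ i b, 1 ≤ b → b ≤ d i → v (q i b) = (Q i b : WithTop ℝ))
    (hroot : ∀ i j, i ≠ j → ∀ s, IsTropRoot (d i) (P i) s → ¬ IsTropRoot (d j) (P j) s)
    (w : Fin (m + 1) → ℝ) (hw : ∀ i, (w 0, w i.succ) ∈ planeCurve (d i) (P i) (Q i)) :
    ∃ (L : Type u) (_ : Field L) (_ : Algebra K L) (V : AddValuation L (WithTop ℝ))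
      (z : Fin (m + 1) → L), (∀ x, V (algebraMap K L x) = v x) ∧
      (∀ k, V (z k) = ((w k : ℝ) : WithTop ℝ)) ∧
      ∀ i, MvPolynomial.aeval z (splitPoly i (d i) (p i) (q i)) = 0 := by
  -- If every `qᵢ` contributes a minimal term, `x₀` is taken generic and each equation is solved for
  -- `x_{i+1}`. Otherwise some `pᵢ` has a root at `w 0`; then `x_{i+1}` is taken generic, that
  -- equation is solved for `x₀`, and the remaining ones for their own variables.
  by_cases hA : ∀ i, ∃ b, MinB (d i) (P i) (Q i) (w 0) (w i.succ) b
  · obtain ⟨L, _, _, _, V, t, hV, ht⟩ := exists_generic_extension v hv (w 0)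
    have hsol : ∀ i, ∃ ζ : L, V ζ = ((w i.succ : ℝ) : WithTop ℝ) ∧
        ∑ a ∈ Finset.range (d i + 1), algebraMap K L (p i a) * t ^ a +
          ∑ b ∈ Finset.Icc 1 (d i), algebraMap K L (q i b) * ζ ^ b = 0 := by
      intro i
      obtain ⟨a, ha, hval, hmin⟩ := val_sum_of_generic (p := p i) (P := P i)
        (Finset.range (d i + 1)) ⟨0, by simp⟩
        (fun a ha => hP i a (by have := Finset.mem_range.1 ha; omega)) ht
      exact exists_root_second hV (hQ i) (P := P i) (s := w 0)
        ⟨⟨a, by have := Finset.mem_range.1 ha; omega, rfl⟩,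
          fun c hc => hmin c (Finset.mem_range.2 (by omega))⟩ hval (hw i) (hA i)
    choose ζ hζ hζ0 using hsol
    have ht0 : V t = ((w 0 : ℝ) : WithTop ℝ) := by
      -- Genericity applied to the polynomial `X` gives the value of `t` itself.
      obtain ⟨a, ha, hval, -⟩ := val_sum_of_generic (p := fun _ => (1 : K)) (P := fun _ => 0)
        {1} ⟨1, by simp⟩ (fun a _ => by simp) ht
      rw [Finset.mem_singleton.1 ha] at hval
      simpa [term] using hval
    refine ⟨L, inferInstance, inferInstance, V, Fin.cons t ζ, hV, fun k => ?_, fun i => ?_⟩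
    · refine Fin.cases ?_ (fun i => ?_) k
      · simpa using ht0
      · simpa using hζ i
    · rw [aeval_splitPoly]
      simpa using hζ0 i
  · push Not at hA
    obtain ⟨i, hi⟩ := hA
    obtain ⟨a, a', hne, ha, ha'⟩ : ∃ a a', a ≠ a' ∧ MinA (d i) (P i) (Q i) (w 0) (w i.succ) a ∧
        MinA (d i) (P i) (Q i) (w 0) (w i.succ) a' := by
      rcases hw i with h | ⟨b, -, -, h, -⟩ | ⟨-, b, -, h⟩
      · exact h
      · exact absurd h (hi b)
      · exact absurd h (hi b)
    have hri : IsTropRoot (d i) (P i) (w 0) := ⟨a, a', hne, ha.1, ha'.1, ha.2.1, ha'.2.1⟩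
    obtain ⟨L, _, _, _, V, t, hV, ht⟩ := exists_generic_extension v hv (w i.succ)
    have ht0 : V t = ((w i.succ : ℝ) : WithTop ℝ) := by
      obtain ⟨a, ha, hval, -⟩ := val_sum_of_generic (p := fun _ => (1 : K)) (P := fun _ => 0)
        {1} ⟨1, by simp⟩ (fun a _ => by simp) ht
      rw [Finset.mem_singleton.1 ha] at hval
      simpa [term] using hval
    obtain ⟨b, hb, hval, hmin⟩ := val_sum_of_generic (p := q i) (P := Q i)
        (Finset.Icc 1 (d i)) ⟨1, Finset.mem_Icc.2 ⟨le_rfl, hd i⟩⟩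
        (fun b hb => hQ i b (Finset.mem_Icc.1 hb).1 (Finset.mem_Icc.1 hb).2) ht
    -- No term of `qᵢ` is minimal, so `qᵢ(t)` is a small perturbation of `pᵢ`, as
    -- `exists_root_first` requires.
    have hlt : term (P i) (w 0) a < term (Q i) (w i.succ) b := by
      obtain ⟨hb1, hb2⟩ := Finset.mem_Icc.1 hb
      by_contra hle
      exact hi b ⟨⟨hb1, hb2⟩, fun c hc => (not_lt.1 hle).trans (ha.2.1 c hc),
        fun c hc1 hc => hmin c (Finset.mem_Icc.2 ⟨hc1, hc⟩)⟩
    obtain ⟨z0, hz0, hz0'⟩ := exists_root_first hV (hP i) hne ha.1 ha'.1 ha.2.1 ha'.2.1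
      (c := ∑ b ∈ Finset.Icc 1 (d i), algebraMap K L (q i b) * t ^ b)
      (by rw [hval, WithTop.coe_lt_coe]; exact hlt)
    have hsol : ∀ j, ∃ ζ : L, V ζ = ((w j.succ : ℝ) : WithTop ℝ) ∧
        ∑ a ∈ Finset.range (d j + 1), algebraMap K L (p j a) * z0 ^ a +
          ∑ b ∈ Finset.Icc 1 (d j), algebraMap K L (q j b) * ζ ^ b = 0 := by
      intro j
      rcases eq_or_ne j i with rfl | hj
      · exact ⟨t, ht0, hz0'⟩
      -- The element `z0` need not be generic; but `w 0` is no root of `pⱼ`, which already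
      -- determines the value of `pⱼ(z0)`.
      have hnr := hroot i j hj.symm _ hri
      obtain ⟨M, hM⟩ := exists_isTropValue (d j) (P j) (w 0)
      refine exists_root_second hV (hQ j) hM (val_sum_of_not_isTropRoot hV (hP j) hz0 hnr hM)
        (hw j) ?_
      rcases hw j with ⟨a, a', h1, h2, h3⟩ | ⟨b, -, -, h, -⟩ | ⟨-, b, -, h⟩
      · exact absurd ⟨a, a', h1, h2.1, h3.1, h2.2.1, h3.2.1⟩ hnr
      · exact ⟨b, h⟩
      · exact ⟨b, h⟩
    choose ζ hζ hζ0 using hsol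
    refine ⟨L, inferInstance, inferInstance, V, Fin.cons z0 ζ, hV, fun k => ?_, fun i => ?_⟩
    · refine Fin.cases ?_ (fun i => ?_) k
      · simpa using hz0
      · simpa using hζ i
    · rw [aeval_splitPoly]
      simpa using hζ0 i

end

section

/-! ### Vector spans of Minkowski sums -/

lemma vectorSpan_add_of_nonempty {E : Type*} [AddCommGroup E] [Module ℝ E] {S T : Set E}
    (hS : S.Nonempty) (hT : T.Nonempty) :
    vectorSpan ℝ (S + T) = vectorSpan ℝ S ⊔ vectorSpan ℝ T := by
  obtain ⟨s, hs⟩ := hS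
  obtain ⟨t, ht⟩ := hT
  apply le_antisymm
  · rw [vectorSpan_def, Submodule.span_le]
    rintro _ ⟨_, ⟨a, ha, b, hb, rfl⟩, _, ⟨c, hc, e, he, rfl⟩, rfl⟩
    have : (a + b) -ᵥ (c + e) = (a -ᵥ c) + (b -ᵥ e) := by
      simp only [vsub_eq_sub]; abel
    dsimp only
    rw [this]
    exact Submodule.add_mem_sup (vsub_mem_vectorSpan ℝ ha hc) (vsub_mem_vectorSpan ℝ hb he)
  · rw [sup_le_iff]
    constructor
    · rw [vectorSpan_def, Submodule.span_le]
      rintro _ ⟨a, ha, c, hc, rfl⟩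
      have : a -ᵥ c = (a + t) -ᵥ (c + t) := by simp
      dsimp only
      rw [this]
      exact vsub_mem_vectorSpan ℝ (Set.add_mem_add ha ht) (Set.add_mem_add hc ht)
    · rw [vectorSpan_def, Submodule.span_le]
      rintro _ ⟨a, ha, c, hc, rfl⟩
      have : a -ᵥ c = (s + a) -ᵥ (s + c) := by simp
      dsimp only
      rw [this]
      exact vsub_mem_vectorSpan ℝ (Set.add_mem_add hs ha) (Set.add_mem_add hs hc)

lemma vectorSpan_finsetSum {E ι : Type*} [AddCommGroup E] [Module ℝ E] (J : Finset ι)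
    (S : ι → Set E) (hS : ∀ j ∈ J, (S j).Nonempty) :
    (∑ j ∈ J, S j).Nonempty ∧ vectorSpan ℝ (∑ j ∈ J, S j) = ⨆ j ∈ J, vectorSpan ℝ (S j) := by
  classical
  induction J using Finset.induction with
  | empty => exact ⟨by simp, by simp [vectorSpan_def, ← Set.singleton_zero]⟩
  | insert a J ha ih =>
    obtain ⟨h1, h2⟩ := ih fun j hj => hS j (Finset.mem_insert_of_mem hj)
    have h3 := hS a (Finset.mem_insert_self a J)
    rw [Finset.sum_insert ha]
    exact ⟨h3.add h1, by rw [vectorSpan_add_of_nonempty h3 h1, h2, Finset.iSup_insert]⟩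

/-! ### Independence of spans in coordinate planes through a common axis -/

/-- The planes share only the `x₀`-axis. A vector `y` in `W a` and in the sum of the others has `y
a.succ = 0`. If `W a` meets the axis trivially, then `y = 0`. If not, every other `W k` meets it
trivially; the component of `y` in `W k` has the same coordinate `k.succ` as `y`, which vanishes
because `y ∈ W a`, so all components vanish. -/
lemma finrank_iSup_of_coordinate_planes {m : ℕ} (W : Fin m → Submodule ℝ (Fin (m + 1) → ℝ))
    (hplane : ∀ j, ∀ y ∈ W j, ∀ k, k ≠ 0 → k ≠ j.succ → y k = 0)
    (J : Finset (Fin m)) (hgood : ∀ i ∈ J, ∀ j ∈ J, i ≠ j →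
      (∀ y ∈ W i, y i.succ = 0 → y = 0) ∨ ∀ y ∈ W j, y j.succ = 0 → y = 0) :
    Module.finrank ℝ (⨆ j ∈ J, W j : Submodule ℝ (Fin (m + 1) → ℝ))
      = ∑ j ∈ J, Module.finrank ℝ (W j) := by
  induction J using Finset.induction with
  | empty => simp
  | insert a J ha ih =>
    have ih := ih fun i hi j hj => hgood i (Finset.mem_insert_of_mem hi) j
      (Finset.mem_insert_of_mem hj)
    rw [Finset.iSup_insert, Finset.sum_insert ha, ← ih, ← Submodule.finrank_sup_add_finrank_inf_eq]
    have hdisj : W a ⊓ ⨆ j ∈ J, W j = ⊥ := by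
      rw [eq_bot_iff]
      rintro y ⟨hy1, hy2⟩
      obtain ⟨x, hx⟩ := (Submodule.mem_iSup_finset_iff_exists_sum _ _).1 hy2
      have hcoord : ∀ k ∈ J, (x k : Fin (m + 1) → ℝ) k.succ = y k.succ := by
        intro k hk
        rw [← hx, Finset.sum_apply, Finset.sum_eq_single k]
        · intro j _ hjk
          exact hplane j _ (x j).2 _ (Fin.succ_ne_zero k)
            fun h => hjk (Fin.succ_injective _ h).symm
        · exact fun h => absurd hk h
      have hya : y a.succ = 0 := by
        rw [← hx, Finset.sum_apply]
        refine Finset.sum_eq_zero fun j hj => ?_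
        refine hplane j _ (x j).2 _ (Fin.succ_ne_zero a) fun h => ha ?_
        rwa [Fin.succ_injective _ h]
      by_cases hg : ∀ y ∈ W a, y a.succ = 0 → y = 0
      · exact hg y hy1 hya
      · have hx0 : ∀ k ∈ J, (x k : Fin (m + 1) → ℝ) = 0 := by
          intro k hk
          have hka : k ≠ a := fun h => ha (h ▸ hk)
          refine ((hgood k (Finset.mem_insert_of_mem hk) a (Finset.mem_insert_self a J)
            hka).resolve_right hg) _ (x k).2 ?_
          rw [hcoord k hk]
          exact hplane a y hy1 _ (Fin.succ_ne_zero k) fun h => hka (Fin.succ_injective _ h)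
        rw [← hx, Finset.sum_eq_zero hx0]
        exact Submodule.zero_mem _
    rw [hdisj, finrank_bot, add_zero]

/-! ### Dimensions of cells -/

variable {K : Type*} [Field K] {n k : ℕ} {v : AddValuation K (WithTop ℝ)}

/-- The exponent as a real vector. -/
def expVec (α : Fin n →₀ ℕ) : Fin n → ℝ := fun i => α i

lemma vectorSpan_dualCell (f : MvPolynomial (Fin n) K) (w : Fin n → ℝ) :
    vectorSpan ℝ (dualCell v f w) = vectorSpan ℝ (expVec '' argmin v f w) := by
  rw [← direction_affineSpan, dualCell, affineSpan_convexHull, direction_affineSpan]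
  rfl

lemma tropTerm_eq_coe {f : MvPolynomial (Fin n) K} {α : Fin n →₀ ℕ} (hα : α ∈ f.support) :
    ∃ c : ℝ, ∀ w : Fin n → ℝ, tropTerm v f w α = ((c + expVec α ⬝ᵥ w : ℝ) : WithTop ℝ) := by
  obtain ⟨c, hc⟩ := WithTop.ne_top_iff_exists.1
    (mt v.top_iff.1 (MvPolynomial.mem_support_iff.1 hα))
  exact ⟨c, fun w => by rw [tropTerm, ← hc, WithTop.coe_add]; rfl⟩

lemma argmin_nonempty {f : MvPolynomial (Fin n) K} (hf : f ≠ 0) (w : Fin n → ℝ) :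
    (argmin v f w).Nonempty := by
  obtain ⟨α, hα, hmin⟩ := Finset.exists_min_image f.support (tropTerm v f w)
    (MvPolynomial.support_nonempty.2 hf)
  exact ⟨α, hα, hmin⟩

/-- Directions in which the minimal monomials of `f` at `w` change their values equally stay in
the cell of `w`. -/
lemma exists_pos_argmin_subset {f : MvPolynomial (Fin n) K} {w u : Fin n → ℝ}
    (hu : ∀ α ∈ argmin v f w, ∀ β ∈ argmin v f w, (expVec α - expVec β) ⬝ᵥ u = 0) :
    ∃ ε : ℝ, 0 < ε ∧ ∀ t : ℝ, 0 ≤ t → t ≤ ε → argmin v f w ⊆ argmin v f (w + t • u) := by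
  have key : ∀ α ∈ argmin v f w, ∀ β ∈ f.support, ∀ᶠ t in nhdsWithin (0 : ℝ) (Set.Ici 0),
      tropTerm v f (w + t • u) α ≤ tropTerm v f (w + t • u) β := by
    intro α hα β hβ
    obtain ⟨c, hc⟩ := tropTerm_eq_coe (v := v) hα.1
    obtain ⟨e, he⟩ := tropTerm_eq_coe (v := v) hβ
    simp only [hc, he, WithTop.coe_le_coe, dotProduct_add, dotProduct_smul, smul_eq_mul]
    have h1 := hα.2 β hβ
    rw [hc, he, WithTop.coe_le_coe] at h1
    -- A tie at `w` persists along `u` by `hu`; a strict inequality persists for small `t` by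
    -- continuity.
    rcases h1.eq_or_lt with h | h
    · have hβ' : β ∈ argmin v f w := by
        refine ⟨hβ, fun γ hγ => ?_⟩
        rw [he, ← h, ← hc]
        exact hα.2 γ hγ
      have h2 := hu α hα β hβ'
      rw [sub_dotProduct, sub_eq_zero] at h2
      refine Filter.Eventually.of_forall fun t => ?_
      rw [h2]
      linarith
    · have hcont : Continuous fun t : ℝ => (e + (expVec β ⬝ᵥ w + t * (expVec β ⬝ᵥ u)))
          - (c + (expVec α ⬝ᵥ w + t * (expVec α ⬝ᵥ u))) := by fun_prop
      have hpos : (0 : ℝ) < (e + (expVec β ⬝ᵥ w + 0 * (expVec β ⬝ᵥ u)))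
          - (c + (expVec α ⬝ᵥ w + 0 * (expVec α ⬝ᵥ u))) := by linarith
      have := (hcont.tendsto 0).eventually (lt_mem_nhds hpos)
      exact (this.filter_mono nhdsWithin_le_nhds).mono fun t ht => by linarith
  have hall : ∀ᶠ t in nhdsWithin (0 : ℝ) (Set.Ici 0), ∀ α ∈ argmin v f w, ∀ β ∈ f.support,
      tropTerm v f (w + t • u) α ≤ tropTerm v f (w + t • u) β := by
    have hfin : (argmin v f w).Finite := f.support.finite_toSet.subset fun α hα => hα.1
    rw [hfin.eventually_all]
    intro α hα
    rw [Filter.eventually_all_finset]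
    exact key α hα
  obtain ⟨ε, hε, h⟩ := (mem_nhdsGE_iff_exists_Icc_subset).1 hall
  exact ⟨ε, hε, fun t h0 ht α hα => ⟨hα.1, h ⟨h0, ht⟩ α hα⟩⟩

/-- The dimension of a cell is complementary to the dimension of the sum of the dual cells. -/
theorem polyDim_cell_add (f : Fin k → MvPolynomial (Fin n) K) (J : Finset (Fin k))
    (w : Fin n → ℝ) :
    polyDim (cell v f J w)
      + Module.finrank ℝ (⨆ j ∈ J, vectorSpan ℝ (dualCell v (f j) w) :
          Submodule ℝ (Fin n → ℝ)) = n := by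
  set W : Submodule ℝ (Fin n → ℝ) := ⨆ j ∈ J, vectorSpan ℝ (dualCell v (f j) w) with hW
  set φ : (Fin n → ℝ) ≃ₗ[ℝ] Module.Dual ℝ (Fin n → ℝ) := dotProductEquiv ℝ (Fin n)
  -- The directions of the cell are exactly those orthogonal to all differences of simultaneously
  -- minimal exponents.
  have hD : vectorSpan ℝ (cell v f J w)
      = W.dualAnnihilator.comap φ.toLinearMap := by
    have hmem : ∀ u : Fin n → ℝ,
        u ∈ W.dualAnnihilator.comap φ.toLinearMap ↔
        ∀ j ∈ J, ∀ α ∈ argmin v (f j) w, ∀ β ∈ argmin v (f j) w,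
          (expVec α - expVec β) ⬝ᵥ u = 0 := by
      intro u
      rw [Submodule.mem_comap, Submodule.mem_dualAnnihilator]
      have e : ∀ x : Fin n → ℝ, φ.toLinearMap u x = x ⬝ᵥ u := fun x => by
        rw [dotProduct_comm]; rfl
      simp only [e]
      constructor
      · intro h j hj α hα β hβ
        refine h _ (Submodule.mem_iSup_of_mem j (Submodule.mem_iSup_of_mem hj ?_))
        rw [vectorSpan_dualCell]
        exact vsub_mem_vectorSpan ℝ (Set.mem_image_of_mem _ hα) (Set.mem_image_of_mem _ hβ)
      · intro h
        have hle : W ≤ LinearMap.ker (φ.toLinearMap u) := by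
          rw [hW, iSup₂_le_iff]
          intro j hj
          rw [vectorSpan_dualCell, vectorSpan_def, Submodule.span_le]
          rintro _ ⟨_, ⟨α, hα, rfl⟩, _, ⟨β, hβ, rfl⟩, rfl⟩
          rw [SetLike.mem_coe, LinearMap.mem_ker, e]
          exact h j hj α hα β hβ
        intro x hx
        have := hle hx
        rwa [LinearMap.mem_ker, e] at this
    apply le_antisymm
    · rw [vectorSpan_def, Submodule.span_le]
      rintro _ ⟨x, hx, y, hy, rfl⟩
      rw [SetLike.mem_coe, hmem]
      intro j hj α hα β hβ
      have key : ∀ x ∈ cell v f J w, ∀ c e : ℝ,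
          (∀ w, tropTerm v (f j) w α = ((c + expVec α ⬝ᵥ w : ℝ) : WithTop ℝ)) →
          (∀ w, tropTerm v (f j) w β = ((e + expVec β ⬝ᵥ w : ℝ) : WithTop ℝ)) →
          c + expVec α ⬝ᵥ x = e + expVec β ⬝ᵥ x := by
        intro x hx c e hc he
        have h1 := hx j hj hα
        have h2 := hx j hj hβ
        have := le_antisymm (h1.2 β h2.1) (h2.2 α h1.1)
        rw [hc, he] at this
        exact_mod_cast this
      obtain ⟨c, hc⟩ := tropTerm_eq_coe (v := v) hα.1
      obtain ⟨e, he⟩ := tropTerm_eq_coe (v := v) hβ.1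
      have h1 := key x hx c e hc he
      have h2 := key y hy c e hc he
      dsimp only
      rw [vsub_eq_sub, sub_dotProduct, dotProduct_sub, dotProduct_sub]
      linarith
    -- An orthogonal direction keeps `w` in the cell for a short time `δ`, so `u` is a multiple of a
    -- difference of two points of the cell.
    · intro u hu
      rw [hmem] at hu
      choose! ε hε h using fun j (hj : j ∈ J) => exists_pos_argmin_subset (hu j hj)
      obtain ⟨δ, hδ, hδε⟩ : ∃ δ : ℝ, 0 < δ ∧ ∀ j ∈ J, δ ≤ ε j := by
        rcases J.eq_empty_or_nonempty with rfl | hJ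
        · exact ⟨1, one_pos, by simp⟩
        · exact ⟨J.inf' hJ ε, (Finset.lt_inf'_iff hJ).2 hε, fun j hj => Finset.inf'_le _ hj⟩
      have h1 : w + δ • u ∈ cell v f J w := fun j hj => h j hj δ hδ.le (hδε j hj)
      have h2 : w ∈ cell v f J w := fun j hj => subset_rfl
      have h3 := vsub_mem_vectorSpan ℝ h1 h2
      rw [vsub_eq_sub, add_sub_cancel_left] at h3
      have := Submodule.smul_mem _ δ⁻¹ h3
      rwa [smul_smul, inv_mul_cancel₀ (ne_of_gt hδ), one_smul] at this
  have hfr : Module.finrank ℝ (W.dualAnnihilator.comap φ.toLinearMap)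
      = Module.finrank ℝ W.dualAnnihilator :=
    (φ.ofSubmodule' W.dualAnnihilator).finrank_eq
  rw [polyDim, hD, hfr, add_comm, Subspace.finrank_add_finrank_dualAnnihilator_eq,
    Module.finrank_fin_fun]

end

/-! ### Transversality without common critical values -/

section

universe u

/-- The vertical line through `s` contains a vertex or a vertical ray of the plane curve. -/
def IsCritical (d : ℕ) (P Q : ℕ → ℝ) (s : ℝ) : Prop :=
  IsTropRoot d P s ∨
    ∃ y a b b', b ≠ b' ∧ MinA d P Q s y a ∧ MinB d P Q s y b ∧ MinB d P Q s y b'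

/-- The largest of the solutions `(M - Q b) / b` of `M = term Q y b` works: increasing `y` increases
every term with `b ≥ 1`. This provides a point of the plane curve over every `s`. -/
lemma exists_forall_le_term {d : ℕ} (hd : 1 ≤ d) (Q : ℕ → ℝ) (M : ℝ) :
    ∃ y, (∃ b, (1 ≤ b ∧ b ≤ d) ∧ M = term Q y b) ∧ ∀ b, 1 ≤ b → b ≤ d → M ≤ term Q y b := by
  obtain ⟨b, hb, hmax⟩ := Finset.exists_max_image (Finset.Icc 1 d) (fun b => (M - Q b) / b)
    ⟨1, Finset.mem_Icc.2 ⟨le_rfl, hd⟩⟩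
  have hb' := Finset.mem_Icc.1 hb
  have hpos : ∀ c : ℕ, 1 ≤ c → (0 : ℝ) < c := fun c hc => by exact_mod_cast hc
  refine ⟨(M - Q b) / b, ⟨b, hb', ?_⟩, fun c hc1 hc => ?_⟩
  · have := hpos b hb'.1
    rw [term]
    field_simp
    ring
  · have h1 := hmax c (Finset.mem_Icc.2 ⟨hc1, hc⟩)
    rw [div_le_iff₀ (hpos c hc1)] at h1
    rw [term]
    linarith

lemma mem_planeCurve_of_isTropValue {d : ℕ} {P Q : ℕ → ℝ} {s y M : ℝ}
    (hM : IsTropValue d P s M) (h1 : ∃ b, (1 ≤ b ∧ b ≤ d) ∧ M = term Q y b)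
    (h2 : ∀ b, 1 ≤ b → b ≤ d → M ≤ term Q y b) : (s, y) ∈ planeCurve d P Q := by
  obtain ⟨⟨a, ha, rfl⟩, hmin⟩ := hM
  obtain ⟨b, hb, he⟩ := h1
  exact Or.inr (Or.inr ⟨a, b, ⟨ha, hmin, h2⟩, hb, fun c hc => he ▸ hmin c hc,
    fun c hc1 hc => he ▸ h2 c hc1 hc⟩)

variable {K : Type u} [Field K] {m : ℕ} {v : AddValuation K (WithTop ℝ)}
  {i : Fin m} {d : ℕ} {p q : ℕ → K} {P Q : ℕ → ℝ}

lemma expVec_single (k : Fin (m + 1)) (a : ℕ) (l : Fin (m + 1)) :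
    expVec (Finsupp.single k a) l = if l = k then (a : ℝ) else 0 := by
  rw [expVec, Finsupp.single_apply]
  by_cases h : k = l
  · rw [if_pos h, if_pos h.symm]
  · rw [if_neg h, if_neg (Ne.symm h), Nat.cast_zero]

lemma vectorSpan_dualCell_le_ker (f : MvPolynomial (Fin (m + 1)) K) (w : Fin (m + 1) → ℝ)
    (φ : (Fin (m + 1) → ℝ) →ₗ[ℝ] ℝ)
    (h : ∀ α ∈ argmin v f w, ∀ β ∈ argmin v f w, φ (expVec α) = φ (expVec β)) :
    vectorSpan ℝ (dualCell v f w) ≤ LinearMap.ker φ := by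
  rw [vectorSpan_dualCell, vectorSpan_def, Submodule.span_le]
  rintro _ ⟨_, ⟨α, hα, rfl⟩, _, ⟨β, hβ, rfl⟩, rfl⟩
  dsimp only
  rw [SetLike.mem_coe, LinearMap.mem_ker, vsub_eq_sub, map_sub, h α hα β hβ, sub_self]

lemma dualCell_splitPoly_plane (hP : ∀ a ≤ d, v (p a) = (P a : WithTop ℝ))
    (hQ : ∀ b, 1 ≤ b → b ≤ d → v (q b) = (Q b : WithTop ℝ)) (w : Fin (m + 1) → ℝ)
    (y : Fin (m + 1) → ℝ) (hy : y ∈ vectorSpan ℝ (dualCell v (splitPoly i d p q) w))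
    (k : Fin (m + 1)) (hk0 : k ≠ 0) (hk : k ≠ i.succ) : y k = 0 := by
  refine vectorSpan_dualCell_le_ker _ w (LinearMap.proj k) (fun α hα β hβ => ?_) hy
  have : ∀ α ∈ argmin v (splitPoly i d p q) w,
      (LinearMap.proj k : (Fin (m + 1) → ℝ) →ₗ[ℝ] ℝ) (expVec α) = 0 := by
    intro α hα
    rcases (mem_argmin_splitPoly hP hQ w α).1 hα with ⟨a, rfl, -⟩ | ⟨b, rfl, -⟩
    · rw [LinearMap.proj_apply, expVec_single, if_neg hk0]
    · rw [LinearMap.proj_apply, expVec_single, if_neg hk]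
  rw [this α hα, this β hβ]

/-- Away from critical values, the minimal terms are one of `p` and one of `q`, a single one of `p`,
or only terms of `q`. The span is generated by `(a, -b)` with `b ≠ 0`, is zero, or lies in the axis
of `x_{i+1}`; in no case does it meet the `x₀`-axis outside the origin. -/
lemma dualCell_splitPoly_good (hP : ∀ a ≤ d, v (p a) = (P a : WithTop ℝ))
    (hQ : ∀ b, 1 ≤ b → b ≤ d → v (q b) = (Q b : WithTop ℝ)) (w : Fin (m + 1) → ℝ)
    (hs : ¬ IsCritical d P Q (w 0))
    (y : Fin (m + 1) → ℝ) (hy : y ∈ vectorSpan ℝ (dualCell v (splitPoly i d p q) w))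
    (hyi : y i.succ = 0) : y = 0 := by
  have hmem := mem_argmin_splitPoly (i := i) hP hQ w
  suffices h0 : y 0 = 0 by
    funext k
    by_cases hk0 : k = 0
    · rw [hk0, h0]; rfl
    by_cases hk : k = i.succ
    · rw [hk, hyi]; rfl
    exact dualCell_splitPoly_plane hP hQ w y hy k hk0 hk
  -- A form `b x₀ + a x_{i+1}` that is constant on the minimal exponents kills the span; with `y
  -- i.succ = 0` and `b ≠ 0` this leaves `y 0 = 0`.
  have hker : ∀ a b : ℝ, b ≠ 0 → (∀ α ∈ argmin v (splitPoly i d p q) w,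
      ∀ β ∈ argmin v (splitPoly i d p q) w,
        b * expVec α 0 + a * expVec α i.succ = b * expVec β 0 + a * expVec β i.succ) →
      y 0 = 0 := by
    intro a b hb h
    have := vectorSpan_dualCell_le_ker (splitPoly i d p q) w
      (b • LinearMap.proj 0 + a • LinearMap.proj i.succ) (fun α hα β hβ => by
        simpa using h α hα β hβ) hy
    rw [LinearMap.mem_ker] at this
    simp only [LinearMap.add_apply, LinearMap.smul_apply, LinearMap.proj_apply, hyi,
      smul_eq_mul, mul_zero, add_zero] at this
    exact (mul_eq_zero.1 this).resolve_left hb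
  have hne : (0 : Fin (m + 1)) ≠ i.succ := (Fin.succ_ne_zero i).symm
  by_cases hA : ∃ a, MinA d P Q (w 0) (w i.succ) a
  · obtain ⟨a, ha⟩ := hA
    have hAu : ∀ a', MinA d P Q (w 0) (w i.succ) a' → a' = a := fun a' ha' => by
      by_contra hne
      exact hs (Or.inl ⟨a', a, hne, ha'.1, ha.1, ha'.2.1, ha.2.1⟩)
    by_cases hB : ∃ b, MinB d P Q (w 0) (w i.succ) b
    · obtain ⟨b, hb⟩ := hB
      have hBu : ∀ b', MinB d P Q (w 0) (w i.succ) b' → b' = b := fun b' hb' => by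
        by_contra hne
        exact hs (Or.inr ⟨_, a, b', b, hne, ha, hb', hb⟩)
      refine hker a b (by exact_mod_cast (by have := hb.1.1; omega : b ≠ 0)) ?_
      have : ∀ α ∈ argmin v (splitPoly i d p q) w,
          (b : ℝ) * expVec α 0 + a * expVec α i.succ = a * b := by
        intro α hα
        rcases (hmem α).1 hα with ⟨a', rfl, h⟩ | ⟨b', rfl, h⟩
        · rw [expVec_single, expVec_single, if_pos rfl, if_neg hne.symm, hAu a' h]
          ring
        · rw [expVec_single, expVec_single, if_pos rfl, if_neg hne, hBu b' h]
          ring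
      intro α hα β hβ
      rw [this α hα, this β hβ]
    · refine hker 0 1 one_ne_zero ?_
      intro α hα β hβ
      rcases (hmem α).1 hα with ⟨a1, rfl, h1⟩ | ⟨b', rfl, h⟩
      · rcases (hmem β).1 hβ with ⟨a2, rfl, h2⟩ | ⟨b', rfl, h⟩
        · rw [hAu a1 h1, hAu a2 h2]
        · exact absurd ⟨b', h⟩ hB
      · exact absurd ⟨b', h⟩ hB
  · refine hker 0 1 one_ne_zero ?_
    have : ∀ α ∈ argmin v (splitPoly i d p q) w, expVec α 0 = 0 := by
      intro α hα
      rcases (hmem α).1 hα with ⟨a', rfl, h⟩ | ⟨b', rfl, h⟩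
      · exact absurd ⟨a', h⟩ hA
      · rw [expVec_single, if_neg hne]
    intro α hα β hβ
    rw [this α hα, this β hβ]
    ring

lemma one_le_polyDim_dualCell {n : ℕ} {f : MvPolynomial (Fin n) K} (hf : f ≠ 0)
    {w : Fin n → ℝ} (hw : w ∈ tropHypersurface v f) : 1 ≤ polyDim (dualCell v f w) := by
  obtain ⟨α, hα, β, hβ, hne⟩ := hw.resolve_left hf
  rw [polyDim, Nat.one_le_iff_ne_zero, Ne, Submodule.finrank_eq_zero]
  intro h
  have := vsub_mem_vectorSpan ℝ (Set.mem_image_of_mem (expVec (n := n)) hα)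
    (Set.mem_image_of_mem expVec hβ)
  rw [← vectorSpan_dualCell, h, Submodule.mem_bot, vsub_eq_zero_iff_eq] at this
  refine hne (Finsupp.ext fun k => ?_)
  exact Nat.cast_injective (R := ℝ) (congrFun this k)

/-- Hypersurfaces of polynomials `pᵢ(x₀) + qᵢ(x_{i+1})` without common critical values intersect
transversally. -/
theorem isTransversalInter_splitPoly {d : Fin m → ℕ} (hd : ∀ i, 1 ≤ d i) {p q : Fin m → ℕ → K}
    {P Q : Fin m → ℕ → ℝ} (hP : ∀ i, ∀ a ≤ d i, v (p i a) = (P i a : WithTop ℝ))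
    (hQ : ∀ i b, 1 ≤ b → b ≤ d i → v (q i b) = (Q i b : WithTop ℝ))
    (hcrit : ∀ i j, i ≠ j → ∀ s, IsCritical (d i) (P i) (Q i) s →
      ¬ IsCritical (d j) (P j) (Q j) s)
    (hs : ∃ s, ∀ i, ¬ IsCritical (d i) (P i) (Q i) s) :
    IsTransversalInter v fun i => splitPoly i (d i) (p i) (q i) := by
  set f := fun i => splitPoly i (d i) (p i) (q i) with hf
  have hf0 : ∀ i, f i ≠ 0 := fun i => splitPoly_ne_zero (hP i)
  have hfin : ∀ (J : Finset (Fin m)) (w : Fin (m + 1) → ℝ),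
      Module.finrank ℝ (⨆ j ∈ J, vectorSpan ℝ (dualCell v (f j) w) :
        Submodule ℝ (Fin (m + 1) → ℝ)) = ∑ j ∈ J, polyDim (dualCell v (f j) w) := by
    intro J w
    refine finrank_iSup_of_coordinate_planes _ (fun j y hy k hk0 hk =>
      dualCell_splitPoly_plane (hP j) (hQ j) w y hy k hk0 hk) J fun i _ j _ hij => ?_
    by_cases h : IsCritical (d i) (P i) (Q i) (w 0)
    · exact Or.inr fun y hy => dualCell_splitPoly_good (hP j) (hQ j) w (hcrit i j hij _ h) y hy
    · exact Or.inl fun y hy => dualCell_splitPoly_good (hP i) (hQ i) w h y hy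
  have hinter : ∀ (J : Finset (Fin m)) (w : Fin (m + 1) → ℝ), w ∈ interOf v f J ↔
      ∀ j ∈ J, w ∈ tropHypersurface v (f j) := fun J w => by simp [interOf]
  intro J _
  refine ⟨⟨?_, ?_⟩, fun w _ => ?_⟩
  -- Over a value that is critical for none of the curves every dual cell is a segment, so the cell
  -- there has codimension exactly `J.card`.
  · obtain ⟨s, hs⟩ := hs
    have hy : ∀ i, ∃ y, (s, y) ∈ planeCurve (d i) (P i) (Q i) := fun i => by
      obtain ⟨M, hM⟩ := exists_isTropValue (d i) (P i) s
      obtain ⟨y, h1, h2⟩ := exists_forall_le_term (hd i) (Q i) M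
      exact ⟨y, mem_planeCurve_of_isTropValue hM h1 h2⟩
    choose y hy using hy
    set w : Fin (m + 1) → ℝ := Fin.cons s y
    have hw : ∀ j, w ∈ tropHypersurface v (f j) := fun j =>
      (mem_tropHypersurface_splitPoly (hP j) (hQ j) w).2 (hy j)
    refine ⟨w, (hinter J w).2 fun j _ => hw j, ?_⟩
    have hdim : ∀ j, polyDim (dualCell v (f j) w) = 1 := by
      intro j
      refine le_antisymm ?_ (one_le_polyDim_dualCell (hf0 j) (hw j))
      have hinj : Function.Injective ((LinearMap.proj j.succ : (Fin (m + 1) → ℝ) →ₗ[ℝ] ℝ).comp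
          (vectorSpan ℝ (dualCell v (f j) w)).subtype) := by
        rw [← LinearMap.ker_eq_bot, LinearMap.ker_eq_bot']
        rintro ⟨x, hx⟩ h
        exact Subtype.ext (dualCell_splitPoly_good (hP j) (hQ j) w (hs j) x hx h)
      simpa [polyDim] using LinearMap.finrank_le_finrank_of_injective hinj
    have := polyDim_cell_add (v := v) f J w
    rw [hfin J w, Finset.sum_congr rfl fun j _ => hdim j, Finset.sum_const, smul_eq_mul,
      mul_one] at this
    exact this
  · rintro _ ⟨w, hw, rfl⟩
    have h1 := polyDim_cell_add (v := v) f J w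
    rw [hfin J w] at h1
    -- Every dual cell at a point of the hypersurface has dimension at least one, which bounds the
    -- dimension of all cells.
    have h2 : J.card ≤ ∑ j ∈ J, polyDim (dualCell v (f j) w) := by
      rw [Finset.card_eq_sum_ones]
      exact Finset.sum_le_sum fun j hj =>
        one_le_polyDim_dualCell (hf0 j) ((hinter J w).1 hw j hj)
    dsimp only
    omega
  · have hne : ∀ j ∈ J, (dualCell v (f j) w).Nonempty := fun j _ =>
      ((argmin_nonempty (hf0 j) w).image _).mono (subset_convexHull ℝ _)
    rw [IsTransversalAlong, polyDim, (vectorSpan_finsetSum J _ hne).2]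
    exact hfin J w

end

section

/-! ### Generic rational projections to the plane -/

variable {n m : ℕ}

/-- The determinant of the images of `x` and `y` under the map `ℝⁿ → ℝ²` with the rows
`A.1` and `A.2`. -/
def bracket (A : (Fin n → ℝ) × (Fin n → ℝ)) (x y : Fin n → ℝ) : ℝ :=
  (A.1 ⬝ᵥ x) * (A.2 ⬝ᵥ y) - (A.2 ⬝ᵥ x) * (A.1 ⬝ᵥ y)

lemma analyticOnNhd_dotProduct_fst (x : Fin n → ℝ) :
    AnalyticOnNhd ℝ (fun A : (Fin n → ℝ) × (Fin n → ℝ) => A.1 ⬝ᵥ x) Set.univ := by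
  have : (fun A : (Fin n → ℝ) × (Fin n → ℝ) => A.1 ⬝ᵥ x)
      = (LinearMap.toContinuousLinearMap (((dotProductEquiv ℝ (Fin n)) x).comp
        (LinearMap.fst ℝ (Fin n → ℝ) (Fin n → ℝ)))) := by
    funext A
    simp [dotProduct_comm]
  rw [this]
  exact ContinuousLinearMap.analyticOnNhd _ _

lemma analyticOnNhd_dotProduct_snd (x : Fin n → ℝ) :
    AnalyticOnNhd ℝ (fun A : (Fin n → ℝ) × (Fin n → ℝ) => A.2 ⬝ᵥ x) Set.univ := by
  have : (fun A : (Fin n → ℝ) × (Fin n → ℝ) => A.2 ⬝ᵥ x)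
      = (LinearMap.toContinuousLinearMap (((dotProductEquiv ℝ (Fin n)) x).comp
        (LinearMap.snd ℝ (Fin n → ℝ) (Fin n → ℝ)))) := by
    funext A
    simp [dotProduct_comm]
  rw [this]
  exact ContinuousLinearMap.analyticOnNhd _ _

lemma analyticOnNhd_bracket (x y : Fin n → ℝ) :
    AnalyticOnNhd ℝ (fun A => bracket A x y) Set.univ :=
  ((analyticOnNhd_dotProduct_fst x).mul (analyticOnNhd_dotProduct_snd y)).sub
    ((analyticOnNhd_dotProduct_snd x).mul (analyticOnNhd_dotProduct_fst y))

lemma continuous_bracket (x y : Fin n → ℝ) : Continuous fun A => bracket A x y :=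
  continuousOn_univ.1 (analyticOnNhd_bracket x y).continuousOn

/-- By the identity theorem an analytic function that vanishes on a non-empty open subset of the
connected space `E` vanishes identically. -/
lemma isOpen_dense_ne_zero {E : Type*} [NormedAddCommGroup E] [NormedSpace ℝ E] {F : E → ℝ}
    (hF : AnalyticOnNhd ℝ F Set.univ) (h : ∃ z, F z ≠ 0) :
    IsOpen {z | F z ≠ 0} ∧ Dense {z | F z ≠ 0} := by
  refine ⟨isOpen_ne_fun (continuousOn_univ.1 hF.continuousOn) continuous_const, ?_⟩
  rw [← interior_eq_empty_iff_dense_compl.trans (by rw [compl_compl] : _ ↔ Dense {z | F z ≠ 0})]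
  by_contra hne
  obtain ⟨z₀, hz₀⟩ := Set.nonempty_iff_ne_empty.2 hne
  obtain ⟨z, hz⟩ := h
  refine hz (hF.eqOn_zero_of_preconnected_of_eventuallyEq_zero isPreconnected_univ
    (Set.mem_univ z₀) ?_ (Set.mem_univ z))
  filter_upwards [mem_interior_iff_mem_nhds.1 hz₀] with x hx
  simpa using hx

/-- A non-empty open set contains a rational point at which finitely many non-zero analytic
functions do not vanish. -/
lemma exists_rational_ne_zero {U : Set ((Fin n → ℝ) × (Fin n → ℝ))} (hU : IsOpen U)
    (hne : U.Nonempty) (S : Set ((Fin n → ℝ) × (Fin n → ℝ) → ℝ)) (hS : S.Finite)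
    (hF : ∀ F ∈ S, AnalyticOnNhd ℝ F Set.univ ∧ ∃ z, F z ≠ 0) :
    ∃ a b : Fin n → ℚ, ((fun k => (a k : ℝ), fun k => (b k : ℝ)) : (Fin n → ℝ) × (Fin n → ℝ)) ∈ U ∧
      ∀ F ∈ S, F (fun k => (a k : ℝ), fun k => (b k : ℝ)) ≠ 0 := by
  have hd : Dense (⋂ F ∈ S, {z | F z ≠ 0}) :=
    dense_biInter_of_isOpen (fun F hFS => (isOpen_dense_ne_zero (hF F hFS).1 (hF F hFS).2).1)
      hS.countable fun F hFS => (isOpen_dense_ne_zero (hF F hFS).1 (hF F hFS).2).2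
  have ho : IsOpen (⋂ F ∈ S, {z | F z ≠ 0}) :=
    hS.isOpen_biInter fun F hFS => (isOpen_dense_ne_zero (hF F hFS).1 (hF F hFS).2).1
  have hQ : DenseRange fun a : Fin n → ℚ => fun k => (a k : ℝ) :=
    DenseRange.piMap fun _ => Rat.denseRange_cast
  obtain ⟨⟨a, b⟩, hab⟩ := (hQ.prodMap hQ).exists_mem_open (hU.inter ho)
    (hd.inter_open_nonempty U hU hne)
  refine ⟨a, b, hab.1, fun F hFS => ?_⟩
  have := Set.mem_iInter₂.1 hab.2 F hFS
  exact this

/-- Linear independence of two vectors. -/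
def Indep (x y : Fin n → ℝ) : Prop := ∃ k l, x k * y l ≠ x l * y k

lemma exists_bracket_ne_zero {x y : Fin n → ℝ} (h : Indep x y) : ∃ A, bracket A x y ≠ 0 := by
  obtain ⟨k, l, h⟩ := h
  refine ⟨(Pi.single k 1, Pi.single l 1), ?_⟩
  simp only [bracket, single_one_dotProduct]
  exact sub_ne_zero.2 h

/-- This expression vanishes if the images of the lines through `x`, `x'`, `x''` in the directions
`e_i`, `e_i'`, `e_i''` have a common point. -/
def concurrency (A : (Fin n → ℝ) × (Fin n → ℝ)) (i i' i'' : Fin n) (x x' x'' : Fin n → ℝ) : ℝ :=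
  bracket A (Pi.single i' 1) (Pi.single i'' 1) * bracket A (Pi.single i 1) x +
  bracket A (Pi.single i'' 1) (Pi.single i 1) * bracket A (Pi.single i' 1) x' +
  bracket A (Pi.single i 1) (Pi.single i' 1) * bracket A (Pi.single i'' 1) x''

lemma exists_concurrency_ne_zero {i i' i'' : Fin m} (h1 : i ≠ i') (h2 : i' ≠ i'') (h3 : i ≠ i'')
    {x x' x'' : Fin (m + 1) → ℝ} (hx : x 0 ≠ x'' 0) :
    ∃ A, concurrency A i.succ i'.succ i''.succ x x' x'' ≠ 0 := by
  have e1 : i.succ ≠ i'.succ := fun h => h1 (Fin.succ_injective _ h)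
  have e2 : i'.succ ≠ i''.succ := fun h => h2 (Fin.succ_injective _ h)
  have e3 : i.succ ≠ i''.succ := fun h => h3 (Fin.succ_injective _ h)
  have hx' : x'' 0 - x 0 ≠ 0 := sub_ne_zero.2 hx.symm
  -- The projection chosen below sends `e_{i+1}` and `e_{i''+1}` to `(1, 0)` and `e_{i'+1}` to `(0,
  -- 1)`. The expression becomes the second coordinate of the image of `x'' - x`, and this `c` makes
  -- it equal to `1`.
  set c : ℝ := (1 - (x'' i'.succ - x i'.succ)) / (x'' 0 - x 0) with hc
  refine ⟨(Pi.single i.succ 1 + Pi.single i''.succ 1, Pi.single i'.succ 1 + c • Pi.single 0 1), ?_⟩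
  have h0 : ∀ j : Fin m, (0 : Fin (m + 1)) ≠ j.succ := fun j => (Fin.succ_ne_zero j).symm
  simp only [concurrency, bracket, add_dotProduct, smul_dotProduct, single_one_dotProduct,
    Pi.single_eq_same, Pi.single_eq_of_ne e1, Pi.single_eq_of_ne e2, Pi.single_eq_of_ne e3,
    Pi.single_eq_of_ne e1.symm, Pi.single_eq_of_ne e2.symm, Pi.single_eq_of_ne e3.symm,
    Pi.single_eq_of_ne (h0 _), smul_eq_mul]
  have : c * (x'' 0 - x 0) = 1 - (x'' i'.succ - x i'.succ) := div_mul_cancel₀ _ hx'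
  ring_nf
  intro h
  linarith

/-- A projection which orders the directions `e₁, …, e_m` by slope and for which finitely many
directions with positive first coordinate are clockwise from all of them. -/
lemma exists_projection_ordering (S : Set (Fin (m + 1) → ℝ)) (hS : S.Finite)
    (hpos : ∀ u ∈ S, 0 < u 0) : ∃ A : (Fin (m + 1) → ℝ) × (Fin (m + 1) → ℝ),
      (∀ i i' : Fin m, i < i' → 0 < bracket A (Pi.single i.succ 1) (Pi.single i'.succ 1)) ∧
      ∀ u ∈ S, ∀ i : Fin m, 0 < bracket A u (Pi.single i.succ 1) := by
  -- The image of `e₀` is `(R, 0)` and that of `e_k` is `(1, k)` for `k ≥ 1`. For large `R`, vectors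
  -- with positive `x₀` turn towards the horizontal axis.
  let A : ℝ → (Fin (m + 1) → ℝ) × (Fin (m + 1) → ℝ) := fun R =>
    (Fin.cons R fun _ => 1, fun k => (k : ℕ))
  have hev : ∀ᶠ R in Filter.atTop, ∀ u ∈ S, ∀ i : Fin m,
      0 < bracket (A R) u (Pi.single i.succ 1) := by
    rw [hS.eventually_all]
    intro u hu
    rw [Filter.eventually_all]
    intro i
    have hform : ∀ R, bracket (A R) u (Pi.single i.succ 1)
        = (u 0 * ((i : ℕ) + 1)) * R + ((∑ j : Fin m, u j.succ) * ((i : ℕ) + 1)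
          - ∑ k : Fin (m + 1), (k : ℕ) * u k) := by
      intro R
      simp only [bracket, A, dotProduct_single_one]
      rw [dotProduct, Fin.sum_univ_succ]
      simp only [Fin.cons_zero, Fin.cons_succ, one_mul, Fin.val_succ, dotProduct]
      push_cast
      ring
    simp only [hform]
    have h1 : 0 < u 0 * ((i : ℕ) + 1 : ℝ) := mul_pos (hpos u hu) (by positivity)
    exact (Filter.tendsto_atTop_add_const_right _ _
      (Filter.tendsto_id.const_mul_atTop h1)).eventually_gt_atTop 0
  obtain ⟨R, hR⟩ := hev.exists
  refine ⟨A R, fun i i' hii => ?_, hR⟩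
  simp only [bracket, A, dotProduct_single_one, Fin.cons_succ, Fin.val_succ]
  have : ((i : ℕ) : ℝ) < (i' : ℕ) := by exact_mod_cast hii
  push_cast
  linarith

/-- The data of a line in `ℝᵐ⁺¹` of direction `e_{i+1}`. -/
abbrev VertLine (m : ℕ) := Fin m × (Fin (m + 1) → ℝ)

/-- The positivity conditions define an open set, non-empty by `exists_projection_ordering`. The
others say that finitely many analytic functions, none identically zero, do not vanish, which holds
on an open dense set. Rational projections are dense, so one of them meets all conditions. -/
theorem exists_generic_projection (S : Set (Fin (m + 1) → ℝ)) (hS : S.Finite)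
    (hpos : ∀ u ∈ S, 0 < u 0)
    (I : Set ((Fin (m + 1) → ℝ) × (Fin (m + 1) → ℝ))) (hI : I.Finite)
    (hind : ∀ u ∈ I, Indep u.1 u.2) (T : Set (VertLine m)) (hT : T.Finite)
    (hT0 : ∀ t ∈ T, ∀ t' ∈ T, t.1 ≠ t'.1 → t.2 0 ≠ t'.2 0) :
    ∃ a b : Fin (m + 1) → ℚ, ∀ A : (Fin (m + 1) → ℝ) × (Fin (m + 1) → ℝ),
      A = (fun k => (a k : ℝ), fun k => (b k : ℝ)) →
      (∀ i i' : Fin m, i < i' → 0 < bracket A (Pi.single i.succ 1) (Pi.single i'.succ 1)) ∧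
      (∀ u ∈ S, ∀ i : Fin m, 0 < bracket A u (Pi.single i.succ 1)) ∧
      (∀ u ∈ I, bracket A u.1 u.2 ≠ 0) ∧
      ∀ t ∈ T, ∀ t' ∈ T, ∀ t'' ∈ T, t.1 ≠ t'.1 → t'.1 ≠ t''.1 → t.1 ≠ t''.1 →
        concurrency A t.1.succ t'.1.succ t''.1.succ t.2 t'.2 t''.2 ≠ 0 := by
  let U : Set ((Fin (m + 1) → ℝ) × (Fin (m + 1) → ℝ)) := {A |
    (∀ i i' : Fin m, i < i' → 0 < bracket A (Pi.single i.succ 1) (Pi.single i'.succ 1)) ∧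
      ∀ u ∈ S, ∀ i : Fin m, 0 < bracket A u (Pi.single i.succ 1)}
  have hUo : IsOpen U := by
    have e : U = (⋂ i : Fin m, ⋂ i' : Fin m, ⋂ _ : i < i',
          {A | 0 < bracket A (Pi.single i.succ 1) (Pi.single i'.succ 1)}) ∩
        ⋂ u ∈ S, ⋂ i : Fin m, {A | 0 < bracket A u (Pi.single i.succ 1)} := by
      ext A
      simp [U]
    rw [e]
    refine IsOpen.inter ?_ (hS.isOpen_biInter fun u _ => ?_)
    · exact isOpen_iInter_of_finite fun i => isOpen_iInter_of_finite fun i' =>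
        isOpen_iInter_of_finite fun _ => isOpen_lt continuous_const (continuous_bracket _ _)
    · exact isOpen_iInter_of_finite fun i => isOpen_lt continuous_const (continuous_bracket _ _)
  have hUne : U.Nonempty := exists_projection_ordering S hS hpos
  let F1 : Set ((Fin (m + 1) → ℝ) × (Fin (m + 1) → ℝ) → ℝ) :=
    (fun u A => bracket A u.1 u.2) '' I
  let F2 : Set ((Fin (m + 1) → ℝ) × (Fin (m + 1) → ℝ) → ℝ) :=
    (fun (x : VertLine m × VertLine m × VertLine m) A =>
      concurrency A x.1.1.succ x.2.1.1.succ x.2.2.1.succ x.1.2 x.2.1.2 x.2.2.2) ''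
      ((T ×ˢ (T ×ˢ T)) ∩ {x | x.1.1 ≠ x.2.1.1 ∧ x.2.1.1 ≠ x.2.2.1 ∧ x.1.1 ≠ x.2.2.1})
  obtain ⟨a, b, hU, hne⟩ := exists_rational_ne_zero hUo hUne (F1 ∪ F2)
    ((hI.image _).union (((hT.prod (hT.prod hT)).inter_of_left _).image _)) (by
      rintro F (⟨u, hu, rfl⟩ | ⟨⟨t, t', t''⟩, ⟨⟨h1, h2, h3⟩, h4, h5, h6⟩, rfl⟩)
      · exact ⟨analyticOnNhd_bracket _ _, exists_bracket_ne_zero (hind u hu)⟩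
      · refine ⟨?_, exists_concurrency_ne_zero h4 h5 h6 (hT0 t h1 t'' h3 h6)⟩
        exact (((analyticOnNhd_bracket _ _).mul (analyticOnNhd_bracket _ _)).add
          ((analyticOnNhd_bracket _ _).mul (analyticOnNhd_bracket _ _))).add
          ((analyticOnNhd_bracket _ _).mul (analyticOnNhd_bracket _ _)))
  refine ⟨a, b, ?_⟩
  rintro A rfl
  refine ⟨hU.1, hU.2, fun u hu => hne _ (Or.inl ⟨u, hu, rfl⟩), ?_⟩
  intro t ht t' ht' t'' ht'' h1 h2 h3
  exact hne _ (Or.inr ⟨(t, t', t''), ⟨⟨ht, ht', ht''⟩, h1, h2, h3⟩, rfl⟩)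

end

section

/-! ### Self-intersections of a curve contained in finitely many lines -/

variable {n m : ℕ}

/-- The real matrix rows of a pair of rational vectors. -/
def castRows (a b : Fin n → ℚ) : (Fin n → ℝ) × (Fin n → ℝ) :=
  (fun k => (a k : ℝ), fun k => (b k : ℝ))

/-- The linear map `ℝⁿ → ℝ²` given by two rows. -/
def rowMap (A : (Fin n → ℝ) × (Fin n → ℝ)) (w : Fin n → ℝ) : Fin 2 → ℝ := ![A.1 ⬝ᵥ w, A.2 ⬝ᵥ w]

lemma ratMap_apply (a b : Fin n → ℚ) (w : Fin n → ℝ) :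
    ratMap (Matrix.of ![a, b]) w = rowMap (castRows a b) w := by
  funext k
  rw [ratMap, Matrix.mulVecLin_apply]
  fin_cases k <;> rfl

lemma rank_of_bracket_ne_zero {a b : Fin n → ℚ} {k l : Fin n}
    (h : bracket (castRows a b) (Pi.single k 1) (Pi.single l 1) ≠ 0) :
    (Matrix.of ![a, b]).rank = 2 := by
  have hli : LinearIndependent ℚ (Matrix.of ![a, b]).row := by
    change LinearIndependent ℚ ![a, b]
    rw [LinearIndependent.pair_iff]
    intro s t hst
    have hk := congrFun hst k
    have hl := congrFun hst l
    simp only [Pi.add_apply, Pi.smul_apply, smul_eq_mul, Pi.zero_apply] at hk hl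
    have hdet : a k * b l - b k * a l ≠ 0 := by
      intro h0
      apply h
      simp only [bracket, castRows, dotProduct_single_one]
      exact_mod_cast h0
    constructor
    · have : s * (a k * b l - b k * a l) = 0 := by linear_combination b l * hk - b k * hl
      exact (mul_eq_zero.1 this).resolve_right hdet
    · have : t * (a k * b l - b k * a l) = 0 := by linear_combination a k * hl - a l * hk
      exact (mul_eq_zero.1 this).resolve_right hdet
  rw [hli.rank_matrix, Fintype.card_fin]

lemma rowMap_eq_iff {A : (Fin n → ℝ) × (Fin n → ℝ)} {w w' : Fin n → ℝ} :
    rowMap A w = rowMap A w' ↔ A.1 ⬝ᵥ w = A.1 ⬝ᵥ w' ∧ A.2 ⬝ᵥ w = A.2 ⬝ᵥ w' := by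
  constructor
  · intro h
    exact ⟨congrFun h 0, congrFun h 1⟩
  · rintro ⟨h1, h2⟩
    rw [rowMap, rowMap, h1, h2]

lemma bracket_eq_of_rowMap_eq {A : (Fin n → ℝ) × (Fin n → ℝ)} {w w' : Fin n → ℝ}
    (h : rowMap A w = rowMap A w') (u : Fin n → ℝ) : bracket A u w = bracket A u w' := by
  obtain ⟨h1, h2⟩ := rowMap_eq_iff.1 h
  rw [bracket, bracket, h1, h2]

lemma bracket_add_smul (A : (Fin n → ℝ) × (Fin n → ℝ)) (u x y : Fin n → ℝ) (t : ℝ) :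
    bracket A u (x + t • y) = bracket A u x + t * bracket A u y := by
  simp only [bracket, dotProduct_add, dotProduct_smul, smul_eq_mul]
  ring

lemma bracket_sub (A : (Fin n → ℝ) × (Fin n → ℝ)) (u x y : Fin n → ℝ) :
    bracket A u (x - y) = bracket A u x - bracket A u y := by
  simp only [bracket, dotProduct_sub]
  ring

lemma bracket_self (A : (Fin n → ℝ) × (Fin n → ℝ)) (u : Fin n → ℝ) : bracket A u u = 0 := by
  rw [bracket]; ring

lemma bracket_comm (A : (Fin n → ℝ) × (Fin n → ℝ)) (u w : Fin n → ℝ) :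
    bracket A u w = - bracket A w u := by
  rw [bracket, bracket]; ring

lemma bracket_smul (A : (Fin n → ℝ) × (Fin n → ℝ)) (u y : Fin n → ℝ) (t : ℝ) :
    bracket A u (t • y) = t * bracket A u y := by
  simp only [bracket, dotProduct_smul, smul_eq_mul]
  ring

lemma exists_smul_of_not_indep {u z : Fin n → ℝ} (hu : u ≠ 0) (h : ¬ Indep u z) :
    ∃ c : ℝ, z = c • u := by
  obtain ⟨k, hk⟩ := Function.ne_iff.1 hu
  rw [Pi.zero_apply] at hk
  refine ⟨z k / u k, ?_⟩
  funext l
  have : u k * z l = u l * z k := by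
    by_contra hne
    exact h ⟨k, l, hne⟩
  rw [Pi.smul_apply, smul_eq_mul]
  field_simp
  linarith

lemma faces_subset {X F : Set (Fin n → ℝ)} (hX : IsClosed X) (hF : F ∈ faces X) : F ⊆ X := by
  obtain ⟨x, -, rfl⟩ := hF
  exact closure_minimal (fun y hy => (connectedComponentIn_subset _ _ hy).1) hX

/-- A line in `ℝⁿ`, given by a point and a direction. -/
abbrev LineData (n : ℕ) := (Fin n → ℝ) × (Fin n → ℝ)

lemma lines_inter_subsingleton {A : (Fin n → ℝ) × (Fin n → ℝ)} {x x' u u' : Fin n → ℝ}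
    (h : bracket A u u' ≠ 0) :
    {y | (∃ t : ℝ, y = rowMap A (x + t • u)) ∧ ∃ t : ℝ, y = rowMap A (x' + t • u')}.Subsingleton := by
  rintro _ ⟨⟨t, rfl⟩, s, hs⟩ _ ⟨⟨t', rfl⟩, s', hs'⟩
  have h1 := bracket_eq_of_rowMap_eq hs u'
  have h2 := bracket_eq_of_rowMap_eq hs' u'
  rw [bracket_add_smul, bracket_add_smul, bracket_self, bracket_comm A u' u] at h1 h2
  have : (t - t') * bracket A u u' = 0 := by linarith
  rw [sub_eq_zero.1 ((mul_eq_zero.1 this).resolve_right h)]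

/-- The self-intersections of a curve contained in finitely many lines are finite under a
projection that is in general position with respect to these lines. -/
theorem finite_selfIntersections {X : Set (Fin n → ℝ)} (hX : IsClosed X)
    (Ls : Set (LineData n)) (hLs : Ls.Finite) (hne : ∀ l ∈ Ls, l.2 ≠ 0)
    (hcov : ∀ w ∈ X, ∃ l ∈ Ls, ∃ t : ℝ, w = l.1 + t • l.2) (a b : Fin n → ℚ)
    (hinj : ∀ l ∈ Ls, ∃ z, bracket (castRows a b) l.2 z ≠ 0)
    (hdir : ∀ l ∈ Ls, ∀ l' ∈ Ls, Indep l.2 l'.2 → bracket (castRows a b) l.2 l'.2 ≠ 0)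
    (hpar : ∀ l ∈ Ls, ∀ l' ∈ Ls, Indep l.2 (l'.1 - l.1) →
      bracket (castRows a b) l.2 (l'.1 - l.1) ≠ 0) :
    (selfIntersections (ratMap (Matrix.of ![a, b])) X).Finite := by
  set A := castRows a b
  have hfin : (⋃ l ∈ Ls, ⋃ l' ∈ Ls, ⋃ _ : bracket A l.2 l'.2 ≠ 0,
      {y | (∃ t : ℝ, y = rowMap A (l.1 + t • l.2)) ∧
        ∃ t : ℝ, y = rowMap A (l'.1 + t • l'.2)}).Finite :=
    hLs.biUnion fun l _ => hLs.biUnion fun l' _ => Set.finite_iUnion fun h =>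
      (lines_inter_subsingleton h).finite
  refine hfin.subset ?_
  rintro y ⟨F₁, hF₁, F₂, hF₂, hdisj, ⟨w, hw, rfl⟩, w', hw', hww⟩
  rw [ratMap_apply, ratMap_apply] at hww
  rw [ratMap_apply]
  have hneq : w ≠ w' := fun h => Set.disjoint_left.1 hdisj hw (h ▸ hw')
  obtain ⟨l, hl, t, rfl⟩ := hcov w (faces_subset hX hF₁ hw)
  obtain ⟨l', hl', t', rfl⟩ := hcov w' (faces_subset hX hF₂ hw')
  simp only [Set.mem_iUnion]
  refine ⟨l, hl, l', hl', ?_, ⟨t, rfl⟩, t', hww.symm⟩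
  refine hdir l hl l' hl' ?_
  -- If the directions are parallel, equality of the images forces the two lines to coincide
  -- (`hpar`), and the projection is injective on this line (`hinj`), contradicting `w ≠ w'`.
  by_contra hdep
  obtain ⟨c, hc⟩ := exists_smul_of_not_indep (hne l hl) hdep
  have h1 := bracket_eq_of_rowMap_eq hww l.2
  rw [bracket_add_smul, bracket_add_smul, bracket_self, hc, bracket_smul, bracket_self] at h1
  have hdep2 : ¬ Indep l.2 (l'.1 - l.1) := by
    intro h
    apply hpar l hl l' hl' h
    rw [bracket_sub]
    linarith
  obtain ⟨e, he⟩ := exists_smul_of_not_indep (hne l hl) hdep2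
  have hl1 : l'.1 = l.1 + e • l.2 := by rw [← he]; abel
  obtain ⟨z, hz⟩ := hinj l hl
  have h2 := bracket_eq_of_rowMap_eq hww z
  rw [hl1, hc, smul_smul, add_assoc, ← add_smul, bracket_add_smul, bracket_add_smul] at h2
  have h3 : (e + t' * c - t) * bracket A l.2 z = 0 := by
    rw [bracket_comm A l.2 z]
    linarith
  have h4 : e + t' * c = t := sub_eq_zero.1 ((mul_eq_zero.1 h3).resolve_right hz)
  apply hneq
  rw [hl1, hc, smul_smul, add_assoc, ← add_smul, h4]

/-- The bracket with `e_j` does not change along a line of direction `e_j`. Hence all three base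
points may be replaced by one point over the common image, and what remains is the Plücker relation
in the plane. -/
lemma concurrency_eq_zero {A : (Fin n → ℝ) × (Fin n → ℝ)} {i i' i'' : Fin n}
    {x x' x'' : Fin n → ℝ} {t t' t'' : ℝ}
    (h1 : rowMap A (x + t • Pi.single i 1) = rowMap A (x' + t' • Pi.single i' 1))
    (h2 : rowMap A (x + t • Pi.single i 1) = rowMap A (x'' + t'' • Pi.single i'' 1)) :
    concurrency A i i' i'' x x' x'' = 0 := by
  have e : ∀ (j : Fin n) (y : Fin n → ℝ) (s : ℝ), bracket A (Pi.single j 1) y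
      = bracket A (Pi.single j 1) (y + s • Pi.single j 1) := fun j y s => by
    rw [bracket_add_smul, bracket_self, mul_zero, add_zero]
  rw [concurrency, e i x t, e i' x' t', e i'' x'' t'', ← bracket_eq_of_rowMap_eq h1,
    ← bracket_eq_of_rowMap_eq h2]
  simp only [bracket]
  ring

/-- Two rays in the plane in the directions of `e_i` and `e_i'` meet. -/
lemma exists_crossing {A : (Fin n → ℝ) × (Fin n → ℝ)} {i i' : Fin n} {x x' : Fin n → ℝ}
    (h : 0 < bracket A (Pi.single i 1) (Pi.single i' 1))
    (h1 : 0 < bracket A (x' - x) (Pi.single i 1)) (h2 : 0 < bracket A (x' - x) (Pi.single i' 1)) :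
    ∃ t t' : ℝ, 0 < t ∧ 0 < t' ∧
      rowMap A (x + t • Pi.single i 1) = rowMap A (x' + t' • Pi.single i' 1) := by
  -- The parameters are given by Cramer's rule; the sign conditions are exactly their positivity.
  refine ⟨_, _, div_pos h2 h, div_pos h1 h, ?_⟩
  rw [rowMap_eq_iff]
  simp only [dotProduct_add, dotProduct_smul, smul_eq_mul]
  have h0 := ne_of_gt h
  constructor <;>
  · field_simp
    simp only [bracket, dotProduct_sub]
    ring

end

/-! ### Fibred curves and the crossings of their rays -/

section

/-- A curve in `ℝᵐ⁺¹` which is the fibre product over the first coordinate axis of plane curves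
`Γ i`, where `Γ i` has `d i` vertical rays (over the roots) and over each root of another of the
curves at least `d i` points. -/
structure FiberedCurve (m : ℕ) (d : Fin m → ℕ) where
  Γ : Fin m → Set (ℝ × ℝ)
  closed : ∀ i, IsClosed (Γ i)
  root : (i : Fin m) → Fin (d i) → ℝ
  root_injective : ∀ i, Function.Injective (root i)
  root_lt : ∀ i i', i < i' → ∀ k k', root i k < root i' k'
  lines : Fin m → Finset (ℝ × ℝ)
  mem_lines : ∀ i s y, (s, y) ∈ Γ i → s ∉ Set.range (root i) → ∃ l ∈ lines i, y = l.1 + l.2 * s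
  bound : Fin m → ℝ
  mem_iff : ∀ i s y, bound i < y → ((s, y) ∈ Γ i ↔ s ∈ Set.range (root i))
  sheet : (j : Fin m) → ℝ → Fin (d j) → ℝ
  sheet_mem : ∀ i j, i ≠ j → ∀ k c, (root i k, sheet j (root i k) c) ∈ Γ j
  sheet_injective : ∀ i j, i ≠ j → ∀ k, Function.Injective (sheet j (root i k))

namespace FiberedCurve

variable {m : ℕ} {d : Fin m → ℕ} (C : FiberedCurve m d)

/-- The underlying set of the curve. -/
def carrier : Set (Fin (m + 1) → ℝ) := {w | ∀ i, (w 0, w (Fin.succ i)) ∈ C.Γ i}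

lemma isClosed_carrier : IsClosed C.carrier := by
  have : C.carrier = ⋂ i : Fin m, (fun w : Fin (m + 1) → ℝ => (w 0, w i.succ)) ⁻¹' C.Γ i := by
    ext w
    simp [carrier]
  rw [this]
  exact isClosed_iInter fun i => (C.closed i).preimage (by fun_prop)

lemma root_ne {i i' : Fin m} (h : i ≠ i') (k : Fin (d i)) (k' : Fin (d i')) :
    C.root i k ≠ C.root i' k' := by
  rcases lt_or_gt_of_ne h with h | h
  · exact (C.root_lt i i' h k k').ne
  · exact (C.root_lt i' i h k' k).ne'

lemma root_notMem_range {i i' : Fin m} (h : i ≠ i') (k : Fin (d i)) :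
    C.root i k ∉ Set.range (C.root i') := by
  rintro ⟨k', hk'⟩
  exact C.root_ne h k k' hk'.symm

/-- The starting point of a ray of direction `e_{i+1}`. -/
def base (i : Fin m) (ρ : (j : Fin m) → Fin (d j)) : Fin (m + 1) → ℝ :=
  Fin.cons (C.root i (ρ i)) fun j =>
    if j = i then C.bound i else C.sheet j (C.root i (ρ i)) (ρ j)

lemma base_zero (i : Fin m) (ρ : (j : Fin m) → Fin (d j)) : C.base i ρ 0 = C.root i (ρ i) := rfl

lemma base_succ_self (i : Fin m) (ρ : (j : Fin m) → Fin (d j)) :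
    C.base i ρ i.succ = C.bound i := by
  rw [base, Fin.cons_succ, if_pos rfl]

lemma base_succ {i j : Fin m} (h : j ≠ i) (ρ : (j : Fin m) → Fin (d j)) :
    C.base i ρ j.succ = C.sheet j (C.root i (ρ i)) (ρ j) := by
  rw [base, Fin.cons_succ, if_neg h]

/-- The points of the ray of direction `e_{i+1}`. -/
def rayPt (i : Fin m) (ρ : (j : Fin m) → Fin (d j)) (t : ℝ) : Fin (m + 1) → ℝ :=
  C.base i ρ + t • Pi.single i.succ 1

lemma rayPt_zero (i : Fin m) (ρ : (j : Fin m) → Fin (d j)) (t : ℝ) :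
    C.rayPt i ρ t 0 = C.root i (ρ i) := by
  rw [rayPt, Pi.add_apply, Pi.smul_apply, Pi.single_eq_of_ne (Fin.succ_ne_zero i).symm,
    smul_zero, add_zero, base_zero]

lemma rayPt_succ_self (i : Fin m) (ρ : (j : Fin m) → Fin (d j)) (t : ℝ) :
    C.rayPt i ρ t i.succ = C.bound i + t := by
  rw [rayPt, Pi.add_apply, Pi.smul_apply, Pi.single_eq_same, base_succ_self, smul_eq_mul, mul_one]

lemma rayPt_succ {i j : Fin m} (h : j ≠ i) (ρ : (j : Fin m) → Fin (d j)) (t : ℝ) :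
    C.rayPt i ρ t j.succ = C.sheet j (C.root i (ρ i)) (ρ j) := by
  rw [rayPt, Pi.add_apply, Pi.smul_apply,
    Pi.single_eq_of_ne (fun e => h (Fin.succ_injective _ e)), smul_zero, add_zero, C.base_succ h]

lemma rayPt_mem (i : Fin m) (ρ : (j : Fin m) → Fin (d j)) {t : ℝ} (ht : 0 < t) :
    C.rayPt i ρ t ∈ C.carrier := by
  intro j
  rw [rayPt_zero]
  rcases eq_or_ne j i with rfl | h
  · rw [rayPt_succ_self, C.mem_iff _ _ _ (by linarith)]
    exact ⟨_, rfl⟩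
  · rw [C.rayPt_succ h]
    exact C.sheet_mem i j h.symm _ _

lemma rayPt_add (i : Fin m) (ρ : (j : Fin m) → Fin (d j)) (t s : ℝ) :
    C.rayPt i ρ t + s • Pi.single i.succ 1 = C.rayPt i ρ (t + s) := by
  rw [rayPt, rayPt, add_assoc, ← add_smul]

/-- The face of a point of a ray. -/
def rayFace (i : Fin m) (ρ : (j : Fin m) → Fin (d j)) (t : ℝ) : Set (Fin (m + 1) → ℝ) :=
  closure (connectedComponentIn
    {z ∈ C.carrier | localCone C.carrier z = localCone C.carrier (C.rayPt i ρ t)} (C.rayPt i ρ t))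

lemma rayFace_mem (i : Fin m) (ρ : (j : Fin m) → Fin (d j)) {t : ℝ} (ht : 0 < t) :
    C.rayFace i ρ t ∈ faces C.carrier := ⟨_, C.rayPt_mem i ρ ht, rfl⟩

lemma rayPt_mem_rayFace (i : Fin m) (ρ : (j : Fin m) → Fin (d j)) {t : ℝ} (ht : 0 < t) :
    C.rayPt i ρ t ∈ C.rayFace i ρ t :=
  subset_closure (mem_connectedComponentIn ⟨C.rayPt_mem i ρ ht, rfl⟩)

/-- The curve can only move in the direction `e_{i+1}` over the roots of the `i`-th curve. -/
lemma mem_range_root_of_localCone {i : Fin m} {z : Fin (m + 1) → ℝ}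
    (hz : Pi.single i.succ 1 ∈ localCone C.carrier z) : z 0 ∈ Set.range (C.root i) := by
  by_contra hno
  obtain ⟨ε, hε, h⟩ := hz
  -- Away from the roots the fibres of `Γ i` are finite, so they contain no interval.
  have hsub : (fun t => z i.succ + t) '' Set.Icc 0 ε ⊆
      (fun l : ℝ × ℝ => l.1 + l.2 * z 0) '' (C.lines i : Set (ℝ × ℝ)) := by
    rintro _ ⟨t, ht, rfl⟩
    have h1 := h t ht.1 ht.2 i
    simp only [Pi.add_apply, Pi.smul_apply, Pi.single_eq_same,
      Pi.single_eq_of_ne (Fin.succ_ne_zero i).symm, smul_eq_mul, mul_zero, add_zero, mul_one] at h1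
    obtain ⟨l, hl, he⟩ := C.mem_lines i _ _ h1 hno
    exact ⟨l, hl, he.symm⟩
  have hinf : ((fun t => z i.succ + t) '' Set.Icc 0 ε).Infinite :=
    (Set.Icc_infinite hε).image (add_right_injective _).injOn
  exact hinf (((C.lines i).finite_toSet.image _).subset hsub)

/-- All points of the locus that defines the face have the same local cone, which contains
`e_{i+1}`, so they lie over the finite set of roots of `Γ i`. By connectedness `x₀` is constant
there, hence also on the closure. This is what makes faces of rays of different directions disjoint.
-/
lemma rayFace_zero (i : Fin m) (ρ : (j : Fin m) → Fin (d j)) {t : ℝ} (ht : 0 < t)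
    {y : Fin (m + 1) → ℝ} (hy : y ∈ C.rayFace i ρ t) : y 0 = C.root i (ρ i) := by
  have hcone : Pi.single i.succ 1 ∈ localCone C.carrier (C.rayPt i ρ t) :=
    ⟨1, one_pos, fun s hs _ => by
      rw [rayPt_add]
      exact C.rayPt_mem i ρ (by linarith)⟩
  set Z := connectedComponentIn
    {z ∈ C.carrier | localCone C.carrier z = localCone C.carrier (C.rayPt i ρ t)} (C.rayPt i ρ t)
  have hself : C.rayPt i ρ t ∈ Z := mem_connectedComponentIn ⟨C.rayPt_mem i ρ ht, rfl⟩
  have hconn : IsPreconnected ((fun z : Fin (m + 1) → ℝ => z 0) '' Z) :=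
    isPreconnected_connectedComponentIn.image _ (by fun_prop)
  have hsub : (fun z : Fin (m + 1) → ℝ => z 0) '' Z ⊆ Set.range (C.root i) := by
    rintro _ ⟨z, hz, rfl⟩
    refine C.mem_range_root_of_localCone ?_
    rw [(connectedComponentIn_subset _ _ hz).2]
    exact hcone
  have hss : ((fun z : Fin (m + 1) → ℝ => z 0) '' Z).Subsingleton :=
    (Set.finite_range (C.root i)).countable.isTotallyDisconnected _ hsub hconn
  have hcl : Z ⊆ {z | z 0 = C.root i (ρ i)} := fun z hz => by
    have := hss (Set.mem_image_of_mem _ hz) (Set.mem_image_of_mem _ hself)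
    exact this.trans (C.rayPt_zero i ρ t)
  exact closure_minimal hcl (isClosed_eq (by fun_prop) continuous_const) hy

/-- The common image of points of two rays of different directions is a self-intersection. -/
lemma mem_selfIntersections {i i' : Fin m} (h : i ≠ i') (ρ ρ' : (j : Fin m) → Fin (d j))
    {t t' : ℝ} (ht : 0 < t) (ht' : 0 < t') (a b : Fin (m + 1) → ℚ)
    (he : rowMap (castRows a b) (C.rayPt i ρ t) = rowMap (castRows a b) (C.rayPt i' ρ' t')) :
    rowMap (castRows a b) (C.rayPt i ρ t)
      ∈ selfIntersections (ratMap (Matrix.of ![a, b])) C.carrier := by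
  refine ⟨_, C.rayFace_mem i ρ ht, _, C.rayFace_mem i' ρ' ht', ?_,
    ⟨_, C.rayPt_mem_rayFace i ρ ht, ratMap_apply _ _ _⟩,
    ⟨_, C.rayPt_mem_rayFace i' ρ' ht', by rw [ratMap_apply, he]⟩⟩
  rw [Set.disjoint_left]
  intro y hy hy'
  exact C.root_ne h _ _ ((C.rayFace_zero i ρ ht hy).symm.trans (C.rayFace_zero i' ρ' ht' hy'))

/-- The curve is contained in finitely many lines. -/
lemma exists_lines : ∃ Ls : Set (LineData (m + 1)), Ls.Finite ∧ (∀ l ∈ Ls, l.2 ≠ 0) ∧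
    ∀ w ∈ C.carrier, ∃ l ∈ Ls, ∃ t : ℝ, w = l.1 + t • l.2 := by
  classical
  -- The pair `(0, 0)` is a filler for the coordinate along a vertical line, where `lines` need not
  -- offer a candidate.
  let Φ : Set (Fin m → ℝ × ℝ) := {l | ∀ i, l i ∈ (↑(insert (0, 0) (C.lines i)) : Set (ℝ × ℝ))}
  have hΦ : Φ.Finite := Set.Finite.pi' fun i => Finset.finite_toSet _
  let vert : (i : Fin m) → Fin (d i) → (Fin m → ℝ × ℝ) → LineData (m + 1) := fun i k l =>
    (Fin.cons (C.root i k) fun j => if j = i then 0 else (l j).1 + (l j).2 * C.root i k,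
      Pi.single i.succ 1)
  let horiz : (Fin m → ℝ × ℝ) → LineData (m + 1) := fun l =>
    (Fin.cons 0 fun j => (l j).1, Fin.cons 1 fun j => (l j).2)
  refine ⟨(⋃ i, ⋃ k, vert i k '' Φ) ∪ horiz '' Φ,
    (Set.finite_iUnion fun i => Set.finite_iUnion fun k => hΦ.image _).union (hΦ.image _), ?_, ?_⟩
  · rintro l (hl | ⟨l, -, rfl⟩) h0
    · simp only [Set.mem_iUnion] at hl
      obtain ⟨i, k, l, -, rfl⟩ := hl
      have := congrFun h0 i.succ
      simp [vert] at this
    · have := congrFun h0 0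
      simp [horiz] at this
  · intro w hw
    by_cases hr : ∃ i, w 0 ∈ Set.range (C.root i)
    · obtain ⟨i, k, hk⟩ := hr
      have hl : ∀ j, ∃ l ∈ insert (0, 0) (C.lines j), j ≠ i → w j.succ = l.1 + l.2 * w 0 := by
        intro j
        rcases eq_or_ne j i with rfl | h
        · exact ⟨_, Finset.mem_insert_self _ _, fun h => absurd rfl h⟩
        · obtain ⟨l, hl, he⟩ := C.mem_lines j _ _ (hw j) (hk ▸ C.root_notMem_range h.symm k)
          exact ⟨l, Finset.mem_insert_of_mem hl, fun _ => he⟩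
      choose l hl he using hl
      refine ⟨vert i k l, Or.inl (Set.mem_iUnion.2 ⟨i, Set.mem_iUnion.2 ⟨k, l, hl, rfl⟩⟩),
        w i.succ, ?_⟩
      funext j
      refine Fin.cases ?_ (fun j => ?_) j
      · simp [vert, hk]
      · rcases eq_or_ne j i with rfl | h
        · simp [vert]
        · have h' : j.succ ≠ i.succ := fun e => h (Fin.succ_injective _ e)
          simp [vert, h, hk, he j h]
    · push Not at hr
      have hl : ∀ j, ∃ l ∈ insert (0, 0) (C.lines j), w j.succ = l.1 + l.2 * w 0 := by
        intro j
        obtain ⟨l, hl, he⟩ := C.mem_lines j _ _ (hw j) (hr j)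
        exact ⟨l, Finset.mem_insert_of_mem hl, he⟩
      choose l hl he using hl
      refine ⟨horiz l, Or.inr ⟨l, hl, rfl⟩, w 0, ?_⟩
      funext j
      refine Fin.cases ?_ (fun j => ?_) j
      · simp [horiz]
      · simp [horiz, he j, mul_comm]

/-- Distinct parallel rays start over different roots or, over the same root, on different sheets of
some other curve, so their base points differ in a coordinate other than `i.succ`. A generic
projection therefore keeps their images apart. -/
lemma indep_base_sub (i : Fin m) {ρ ρ' : (j : Fin m) → Fin (d j)} (h : ρ ≠ ρ') :
    Indep (Pi.single i.succ 1) (C.base i ρ' - C.base i ρ) := by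
  have hk : ∃ k, k ≠ i.succ ∧ C.base i ρ' k ≠ C.base i ρ k := by
    by_cases hi : ρ' i = ρ i
    · obtain ⟨j, hj⟩ := Function.ne_iff.1 h
      have hji : j ≠ i := fun e => hj (e ▸ hi.symm)
      refine ⟨j.succ, fun e => hji (Fin.succ_injective _ e), ?_⟩
      rw [C.base_succ hji, C.base_succ hji, hi]
      exact fun e => hj (C.sheet_injective i j hji.symm _ e).symm
    · exact ⟨0, (Fin.succ_ne_zero i).symm, fun e => hi (C.root_injective i e)⟩
  obtain ⟨k, hk, hne⟩ := hk
  refine ⟨i.succ, k, ?_⟩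
  rw [Pi.single_eq_same, Pi.single_eq_of_ne hk, one_mul, zero_mul, Pi.sub_apply]
  exact sub_ne_zero.2 hne

/-- The index set of the crossings of the rays of the curve: a pair of directions and for each of
them a ray. -/
abbrev CrossIdx (m : ℕ) (d : Fin m → ℕ) : Type :=
  (Σ i' : Fin m, Fin i'.val) × ((j : Fin m) → Fin (d j)) × ((j : Fin m) → Fin (d j))

/-- The first of the two directions. -/
def fstDir {m : ℕ} (x : Σ i' : Fin m, Fin i'.val) : Fin m := ⟨x.2, x.2.2.trans x.1.2⟩

lemma fstDir_lt {m : ℕ} (x : Σ i' : Fin m, Fin i'.val) : fstDir x < x.1 := x.2.2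

lemma card_crossIdx (m : ℕ) (d : Fin m → ℕ) :
    Fintype.card (CrossIdx m d) = (∏ i, d i) ^ 2 * m.choose 2 := by
  rw [Fintype.card_prod, Fintype.card_prod, Fintype.card_sigma, Fintype.card_pi]
  simp only [Fintype.card_fin]
  rw [Fin.sum_univ_eq_sum_range (fun i => i) m, Finset.sum_range_id, ← Nat.choose_two_right]
  ring

/-- In general position the rays of a fibred curve cross in distinct points, and the curve has
finitely many self-intersections. -/
theorem exists_projection (hm : 2 ≤ m) (S : Set (Fin (m + 1) → ℝ)) (hS : S.Finite)
    (hpos : ∀ u ∈ S, 0 < u 0) :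
    ∃ a b : Fin (m + 1) → ℚ, (Matrix.of ![a, b]).rank = 2 ∧
      (selfIntersections (ratMap (Matrix.of ![a, b])) C.carrier).Finite ∧
      (∀ i i' : Fin m, i < i' →
        0 < bracket (castRows a b) (Pi.single i.succ 1) (Pi.single i'.succ 1)) ∧
      (∀ u ∈ S, ∀ i : Fin m, 0 < bracket (castRows a b) u (Pi.single i.succ 1)) ∧
      ∃ c : CrossIdx m d → Fin 2 → ℝ, Function.Injective c ∧
        (∀ x, c x ∈ selfIntersections (ratMap (Matrix.of ![a, b])) C.carrier) ∧
        ∀ x, ∃ t t', c x = rowMap (castRows a b) (C.rayPt (fstDir x.1) x.2.1 t) ∧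
          c x = rowMap (castRows a b) (C.rayPt x.1.1 x.2.2 t') := by
  obtain ⟨Ls, hLs, hLs0, hcov⟩ := C.exists_lines
  -- For `i < i'` the difference of base points has positive `x₀` by `root_lt`; positive brackets
  -- with these differences make the rays meet at positive parameters.
  let S' : Set (Fin (m + 1) → ℝ) := S ∪ Set.range fun x : CrossIdx m d =>
    C.base x.1.1 x.2.2 - C.base (fstDir x.1) x.2.1
  have hind : ∀ u : Fin (m + 1) → ℝ, u ≠ 0 → ∃ z, Indep u z := by
    intro u hu
    obtain ⟨k, hk⟩ := Function.ne_iff.1 hu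
    obtain ⟨l, hl⟩ : ∃ l, l ≠ k := by
      have : Nontrivial (Fin (m + 1)) := Fin.nontrivial_iff_two_le.2 (by omega)
      exact exists_ne k
    refine ⟨Pi.single l 1, k, l, ?_⟩
    rw [Pi.single_eq_same, Pi.single_eq_of_ne hl.symm, mul_one, mul_zero]
    exact hk
  choose! ζ hζ using hind
  -- The pairs ensure, in this order, injectivity on each line, non-parallel images of non-parallel
  -- lines, separation of parallel lines, and separation of parallel rays.
  let I0 : Set (LineData (m + 1)) := (fun l : LineData (m + 1) => (l.2, ζ l.2)) '' Ls ∪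
    ((fun x : LineData (m + 1) × LineData (m + 1) => (x.1.2, x.2.2)) '' Ls ×ˢ Ls ∪
    (fun x : LineData (m + 1) × LineData (m + 1) => (x.1.2, x.2.1 - x.1.1)) '' Ls ×ˢ Ls ∪
    Set.range fun x : Fin m × ((j : Fin m) → Fin (d j)) × ((j : Fin m) → Fin (d j)) =>
      (Pi.single x.1.succ 1, C.base x.1 x.2.2 - C.base x.1 x.2.1))
  have hI0 : I0.Finite := (hLs.image _).union
    ((((hLs.prod hLs).image _).union ((hLs.prod hLs).image _)).union (Set.finite_range _))
  let I : Set (LineData (m + 1)) := I0 ∩ {x | Indep x.1 x.2}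
  let T : Set (VertLine m) := Set.range fun x : Fin m × ((j : Fin m) → Fin (d j)) =>
    (x.1, C.base x.1 x.2)
  obtain ⟨a, b, hab⟩ := exists_generic_projection S' (hS.union (Set.finite_range _)) (by
    rintro u (hu | ⟨x, rfl⟩)
    · exact hpos u hu
    · simp only [Pi.sub_apply, base_zero]
      linarith [C.root_lt _ _ (fstDir_lt x.1) (x.2.1 (fstDir x.1)) (x.2.2 x.1.1)])
    I (hI0.inter_of_left _) (fun u hu => hu.2) T (Set.finite_range _) (by
      rintro _ ⟨x, rfl⟩ _ ⟨x', rfl⟩ h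
      exact C.root_ne h _ _)
  obtain ⟨h1, h2, h3, h4⟩ := hab (castRows a b) rfl
  set A := castRows a b with hA
  have hne : ∀ i i' : Fin m, i ≠ i' →
      bracket A (Pi.single i.succ 1) (Pi.single i'.succ 1) ≠ 0 := by
    intro i i' h
    rcases lt_or_gt_of_ne h with h | h
    · exact (h1 i i' h).ne'
    · rw [bracket_comm]
      exact neg_ne_zero.2 (h1 i' i h).ne'
  have hcross : ∀ x : CrossIdx m d, ∃ t t' : ℝ, 0 < t ∧ 0 < t' ∧
      rowMap A (C.rayPt (fstDir x.1) x.2.1 t) = rowMap A (C.rayPt x.1.1 x.2.2 t') := fun x =>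
    exists_crossing (h1 _ _ (fstDir_lt x.1)) (h2 _ (Or.inr ⟨x, rfl⟩) _)
      (h2 _ (Or.inr ⟨x, rfl⟩) _)
  choose t t' ht ht' he using hcross
  have hsame : ∀ (i : Fin m) (ρ ρ' : (j : Fin m) → Fin (d j)) (s s' : ℝ),
      rowMap A (C.rayPt i ρ s) = rowMap A (C.rayPt i ρ' s') → ρ = ρ' := by
    intro i ρ ρ' s s' h
    by_contra hρ
    apply h3 (Pi.single i.succ 1, C.base i ρ' - C.base i ρ)
      ⟨Or.inr (Or.inr ⟨(i, ρ, ρ'), rfl⟩), C.indep_base_sub i hρ⟩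
    have := bracket_eq_of_rowMap_eq h (Pi.single i.succ 1)
    rw [rayPt, rayPt, bracket_add_smul, bracket_add_smul, bracket_self] at this
    rw [bracket_sub]
    linarith
  have hthree : ∀ (i i' i'' : Fin m) (ρ ρ' ρ'' : (j : Fin m) → Fin (d j)) (s s' s'' : ℝ),
      i ≠ i' → i' ≠ i'' → i ≠ i'' → rowMap A (C.rayPt i ρ s) = rowMap A (C.rayPt i' ρ' s') →
      rowMap A (C.rayPt i ρ s) ≠ rowMap A (C.rayPt i'' ρ'' s'') := by
    intro i i' i'' ρ ρ' ρ'' s s' s'' e1 e2 e3 h h'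
    exact h4 _ ⟨(i, ρ), rfl⟩ _ ⟨(i', ρ'), rfl⟩ _ ⟨(i'', ρ''), rfl⟩ e1 e2 e3
      (concurrency_eq_zero h h')
  refine ⟨a, b, ?_, ?_, h1, fun u hu => h2 u (Or.inl hu),
    fun x => rowMap A (C.rayPt (fstDir x.1) x.2.1 (t x)), ?_, ?_, ?_⟩
  · exact rank_of_bracket_ne_zero (h1 ⟨0, by omega⟩ ⟨1, by omega⟩ (by simp)).ne'
  · refine finite_selfIntersections C.isClosed_carrier Ls hLs hLs0 hcov a b ?_ ?_ ?_
    · exact fun l hl => ⟨ζ l.2, h3 (l.2, ζ l.2) ⟨Or.inl ⟨l, hl, rfl⟩, hζ _ (hLs0 l hl)⟩⟩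
    · exact fun l hl l' hl' h => h3 (l.2, l'.2)
        ⟨Or.inr (Or.inl (Or.inl ⟨(l, l'), ⟨hl, hl'⟩, rfl⟩)), h⟩
    · exact fun l hl l' hl' h => h3 (l.2, l'.1 - l.1)
        ⟨Or.inr (Or.inl (Or.inr ⟨(l, l'), ⟨hl, hl'⟩, rfl⟩)), h⟩
  -- Equal crossings involve the same two directions, since a third one is excluded by `hthree`;
  -- then `hsame` identifies the rays.
  · rintro ⟨p, ρ, ρ'⟩ ⟨q, σ, σ'⟩ h
    dsimp only at h
    have hp := fstDir_lt p
    have hq := fstDir_lt q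
    have e1 := he (p, ρ, ρ')
    have e2 := he (q, σ, σ')
    dsimp only at e1 e2
    by_cases hpq : fstDir p = fstDir q
    · by_cases hpq' : p.1 = q.1
      · have : p = q := by
          obtain ⟨p1, p2⟩ := p
          obtain ⟨q1, q2⟩ := q
          dsimp only at hpq'
          subst hpq'
          congr 1
          simpa [fstDir, Fin.ext_iff] using hpq
        subst this
        rw [hsame _ _ _ _ _ h, hsame _ _ _ _ _ (e1.symm.trans (h.trans e2))]
      · exact absurd (h.trans e2)
          (hthree _ _ _ _ _ _ _ _ _ hp.ne hpq' (hpq ▸ hq.ne) e1)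
    · by_cases hpq' : p.1 = fstDir q
      · exact absurd (h.trans e2)
          (hthree _ _ _ _ _ _ _ _ _ hp.ne (hpq' ▸ hq.ne) (hp.trans (hpq' ▸ hq)).ne e1)
      · exact absurd h (hthree _ _ _ _ _ _ _ _ _ hp.ne hpq' hpq e1)
  · exact fun x => C.mem_selfIntersections (fstDir_lt x.1).ne _ _ (ht x) (ht' x) a b (he x)
  · exact fun x => ⟨t x, t' x, rfl, he x⟩

end FiberedCurve

end

section

/-! ### Strictly convex coefficient values -/

/-- The values of the coefficients of `p`. -/
def valP (g lam : ℝ) (d a : ℕ) : ℝ := g * (((d : ℝ) - a) * ((d : ℝ) - a + 1 + lam))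

/-- The values of the coefficients of `q`. -/
def valQ (g E : ℝ) (b : ℕ) : ℝ := g * E * (b * ((b : ℝ) - 1))

/-- A strictly convex quadratic sequence has its minimum at most twice, at consecutive places. -/
lemma consecutive_of_quadratic {T : ℕ → ℝ} {A B c : ℝ} (hA : 0 < A)
    (hT : ∀ k : ℕ, T k = A * (k : ℝ) ^ 2 + B * k + c) {a a' : ℕ} (haa : a < a')
    (h1 : T a = T a') (h2 : T a ≤ T (a + 1)) : a' = a + 1 ∧ A * (2 * a + 1) + B = 0 := by
  rw [hT, hT] at h1 h2
  push_cast at h2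
  have hlt : (0 : ℝ) < (a' : ℝ) - a := sub_pos.2 (by exact_mod_cast haa)
  have h3 : A * (a + a') + B = 0 := by
    have : ((a' : ℝ) - a) * (A * (a + a') + B) = 0 := by linear_combination -h1
    exact (mul_eq_zero.1 this).resolve_left hlt.ne'
  have h4 : (a' : ℝ) ≤ a + 1 := by
    by_contra hlt
    have := mul_pos hA (sub_pos.2 (not_le.1 hlt))
    linarith
  have h5 : a' = a + 1 := by
    have : a' ≤ a + 1 := by exact_mod_cast h4
    omega
  refine ⟨h5, ?_⟩
  rw [h5] at h3
  push_cast at h3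
  linarith

/-- No integer lies strictly between `0` and `1`. Applied to a difference of exponents, this shows
that two consecutive terms of a quadratic sequence share the minimum. -/
lemma int_mul_pred_nonneg (x : ℤ) : (0 : ℝ) ≤ (x : ℝ) * (x - 1) := by
  have : (0 : ℤ) ≤ x * (x - 1) := by
    rcases le_or_gt x 0 with h | h
    · exact mul_nonneg_of_nonpos_of_nonpos h (by omega)
    · exact mul_nonneg h.le (by omega)
  exact_mod_cast this

variable {g lam E : ℝ} {d : ℕ}

lemma term_valP (s : ℝ) (a : ℕ) : term (valP g lam d) s a
    = g * (a : ℝ) ^ 2 + (s - g * (2 * d + 1 + lam)) * a + g * (d * (d + 1 + lam)) := by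
  rw [term, valP]; ring

lemma term_valQ (y : ℝ) (b : ℕ) : term (valQ g E) y b
    = g * E * (b : ℝ) ^ 2 + (y - g * E) * b + 0 := by
  rw [term, valQ]; ring

lemma valP_nonneg (hg : 0 < g) (hlam : 0 ≤ lam) {a : ℕ} (ha : a ≤ d) : 0 ≤ valP g lam d a := by
  have : (a : ℝ) ≤ d := by exact_mod_cast ha
  exact mul_nonneg hg.le (mul_nonneg (by linarith) (by linarith))

/-- The drop of `valP` from `a` to `a + 1` is `g * (2 * e + lam)` with `e = d - a`, strictly
decreasing in `a`, so ties at the minimum occur exactly between consecutive terms and at these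
values. -/
lemma isTropRoot_valP_iff (hg : 0 < g) {s : ℝ} :
    IsTropRoot d (valP g lam d) s ↔ ∃ e : ℕ, 1 ≤ e ∧ e ≤ d ∧ s = g * (2 * e + lam) := by
  constructor
  · have key : ∀ a a' : ℕ, a < a' → a' ≤ d →
        (∀ c ≤ d, term (valP g lam d) s a ≤ term (valP g lam d) s c) →
        (∀ c ≤ d, term (valP g lam d) s a' ≤ term (valP g lam d) s c) →
        ∃ e : ℕ, 1 ≤ e ∧ e ≤ d ∧ s = g * (2 * e + lam) := by
      intro a a' h ha' h1 h2
      obtain ⟨-, h3⟩ := consecutive_of_quadratic hg (term_valP s) h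
        (le_antisymm (h1 a' ha') (h2 a (by omega))) (h1 _ (by omega))
      refine ⟨d - a, by omega, by omega, ?_⟩
      rw [Nat.cast_sub (by omega)]
      linarith
    rintro ⟨a, a', hne, ha, ha', h1, h2⟩
    rcases lt_or_gt_of_ne hne with h | h
    · exact key a a' h ha' h1 h2
    · exact key a' a h ha h2 h1
  · rintro ⟨e, he1, hed, rfl⟩
    have hmin : ∀ a : ℕ, (a = d - e ∨ a = d - e + 1) → ∀ c : ℕ,
        term (valP g lam d) (g * (2 * e + lam)) a ≤ term (valP g lam d) (g * (2 * e + lam)) c := by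
      intro a ha c
      have hx := mul_nonneg hg.le (int_mul_pred_nonneg ((c : ℤ) - (d - e)))
      push_cast at hx
      rw [term_valP, term_valP]
      rcases ha with rfl | rfl
      · rw [Nat.cast_sub hed]
        linarith
      · rw [Nat.cast_add, Nat.cast_sub hed]
        push_cast
        linarith
    exact ⟨d - e, d - e + 1, by omega, by omega, by omega, fun c _ => hmin _ (Or.inl rfl) c,
      fun c _ => hmin _ (Or.inr rfl) c⟩

lemma minB_minB (hg : 0 < g) (hE : 0 < E) {P : ℕ → ℝ} {s y : ℝ} {b b' : ℕ} (hne : b ≠ b')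
    (h1 : MinB d P (valQ g E) s y b) (h2 : MinB d P (valQ g E) s y b') :
    ∃ k : ℕ, 1 ≤ k ∧ k < d ∧ y = -2 * g * E * k ∧ MinB d P (valQ g E) s y k := by
  have key : ∀ b b' : ℕ, b < b' → MinB d P (valQ g E) s y b → MinB d P (valQ g E) s y b' →
      ∃ k : ℕ, 1 ≤ k ∧ k < d ∧ y = -2 * g * E * k ∧ MinB d P (valQ g E) s y k := by
    intro b b' h h1 h2
    have hb := h1.1
    have hb' := h2.1
    obtain ⟨-, h3⟩ := consecutive_of_quadratic (mul_pos hg hE) (term_valQ y) h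
      (le_antisymm (h1.2.2 b' hb'.1 hb'.2) (h2.2.2 b hb.1 hb.2)) (h1.2.2 _ (by omega) (by omega))
    exact ⟨b, hb.1, by omega, by linarith, h1⟩
  rcases lt_or_gt_of_ne hne with h | h
  · exact key b b' h h1 h2
  · exact key b' b h h2 h1

/-- At a tie of two terms of `q` the common value `-gE k(k + 1)` is negative. Since `valP` is
non-negative, `s` must be negative, and then the minimum of `p` is the value `d * s` of its top
term, whose coefficient has value zero. -/
lemma isCritical_cases (hg : 0 < g) (hlam : 0 ≤ lam) (hE : 0 < E) {s : ℝ}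
    (h : IsCritical d (valP g lam d) (valQ g E) s) :
    (∃ e : ℕ, 1 ≤ e ∧ e ≤ d ∧ s = g * (2 * e + lam)) ∨
      ∃ k : ℕ, 1 ≤ k ∧ k < d ∧ d * s = - (g * E * (k * (k + 1))) := by
  rcases h with h | ⟨y, a, b, b', hne, ha, hb, hb'⟩
  · exact Or.inl ((isTropRoot_valP_iff hg).1 h)
  · right
    obtain ⟨k, hk1, hkd, hy, hk⟩ := minB_minB hg hE hne hb hb'
    refine ⟨k, hk1, hkd, ?_⟩
    have h1 : term (valQ g E) y k = - (g * E * (k * (k + 1))) := by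
      rw [term_valQ, hy]; ring
    have h2 : term (valP g lam d) s a = term (valQ g E) y k :=
      le_antisymm (ha.2.2 k hk1 hkd.le) (hk.2.1 a ha.1)
    have h3 : term (valP g lam d) s d = d * s := by rw [term, valP]; ring
    have h4 := ha.2.1 d le_rfl
    have h5 := valP_nonneg hg hlam ha.1
    have hkpos : (0 : ℝ) < k := by exact_mod_cast hk1
    have h6 : 0 < g * E * (k * (k + 1)) := by positivity
    have h7 : (a : ℝ) ≤ d := by exact_mod_cast ha.1
    have hs : s < 0 := by
      by_contra hs
      have : 0 ≤ (a : ℝ) * s := mul_nonneg (Nat.cast_nonneg a) (not_lt.1 hs)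
      rw [term] at h2
      linarith
    have h8 : (d : ℝ) * s ≤ a * s := mul_le_mul_of_nonpos_right h7 hs.le
    rw [h3, h2, h1] at h4
    rw [h1, term] at h2
    linarith

lemma le_term_valQ (hg : 0 < g) (hE : 0 < E) {y : ℝ} (hy : 0 ≤ y) {b : ℕ} (hb : 1 ≤ b) :
    y ≤ term (valQ g E) y b := by
  have hb' : (1 : ℝ) ≤ b := by exact_mod_cast hb
  have h1 : 0 ≤ g * E * (b * ((b : ℝ) - 1)) :=
    mul_nonneg (mul_pos hg hE).le (mul_nonneg (by linarith) (by linarith))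
  have h2 : 1 * y ≤ b * y := mul_le_mul_of_nonneg_right hb' hy
  rw [term, valQ]
  linarith

lemma term_valQ_one (y : ℝ) : term (valQ g E) y 1 = y := by rw [term, valQ]; simp

lemma term_valP_pos (hg : 0 < g) (hlam : 0 ≤ lam) (hd : 1 ≤ d) {s : ℝ} (hs : 0 < s) {a : ℕ}
    (ha : a ≤ d) : 0 < term (valP g lam d) s a := by
  rcases Nat.eq_zero_or_pos a with rfl | h
  · have : (1 : ℝ) ≤ d := by exact_mod_cast hd
    rw [term, valP, Nat.cast_zero, zero_mul, add_zero, sub_zero]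
    positivity
  · have h1 := valP_nonneg hg hlam ha
    have h2 : (0 : ℝ) < a := by exact_mod_cast h
    have := mul_pos h2 hs
    rw [term]
    linarith

lemma isClosed_planeCurve (d : ℕ) (P Q : ℕ → ℝ) : IsClosed (planeCurve d P Q) := by
  have hcP : ∀ a, Continuous fun x : ℝ × ℝ => term P x.1 a := fun a => by unfold term; fun_prop
  have hcQ : ∀ a, Continuous fun x : ℝ × ℝ => term Q x.2 a := fun a => by unfold term; fun_prop
  have hA : ∀ a, IsClosed {x : ℝ × ℝ | MinA d P Q x.1 x.2 a} := by
    intro a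
    simp only [MinA, Set.ofPred_and, Set.ofPred_forall]
    exact isClosed_const.inter ((isClosed_iInter fun c => isClosed_iInter fun _ =>
      isClosed_le (hcP a) (hcP c)).inter (isClosed_iInter fun c => isClosed_iInter fun _ =>
      isClosed_iInter fun _ => isClosed_le (hcP a) (hcQ c)))
  have hB : ∀ a, IsClosed {x : ℝ × ℝ | MinB d P Q x.1 x.2 a} := by
    intro a
    simp only [MinB, Set.ofPred_and, Set.ofPred_forall]
    exact (isClosed_const.inter isClosed_const).inter ((isClosed_iInter fun c =>
      isClosed_iInter fun _ => isClosed_le (hcQ a) (hcP c)).inter (isClosed_iInter fun c =>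
      isClosed_iInter fun _ => isClosed_iInter fun _ => isClosed_le (hcQ a) (hcQ c)))
  have e : planeCurve d P Q = ⋃ a ∈ Finset.range (d + 1), ⋃ b ∈ Finset.range (d + 1),
      (({_x | a ≠ b} ∩ ({x | MinA d P Q x.1 x.2 a} ∩ {x | MinA d P Q x.1 x.2 b})) ∪
      (({_x | a ≠ b} ∩ ({x | MinB d P Q x.1 x.2 a} ∩ {x | MinB d P Q x.1 x.2 b})) ∪
      ({x | MinA d P Q x.1 x.2 a} ∩ {x | MinB d P Q x.1 x.2 b}))) := by
    ext x
    simp only [Set.mem_iUnion, Finset.mem_range, exists_prop]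
    constructor
    · rintro (⟨a, b, h, h1, h2⟩ | ⟨a, b, h, h1, h2⟩ | ⟨a, b, h1, h2⟩)
      · exact ⟨a, Nat.lt_succ_of_le h1.1, b, Nat.lt_succ_of_le h2.1, Or.inl ⟨h, h1, h2⟩⟩
      · exact ⟨a, Nat.lt_succ_of_le h1.1.2, b, Nat.lt_succ_of_le h2.1.2,
          Or.inr (Or.inl ⟨h, h1, h2⟩)⟩
      · exact ⟨a, Nat.lt_succ_of_le h1.1, b, Nat.lt_succ_of_le h2.1.2, Or.inr (Or.inr ⟨h1, h2⟩)⟩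
    · rintro ⟨a, -, b, -, ⟨h, h1, h2⟩ | ⟨h, h1, h2⟩ | ⟨h1, h2⟩⟩
      · exact Or.inl ⟨a, b, h, h1, h2⟩
      · exact Or.inr (Or.inl ⟨a, b, h, h1, h2⟩)
      · exact Or.inr (Or.inr ⟨a, b, h1, h2⟩)
  rw [e]
  exact Set.Finite.isClosed_biUnion (Finset.finite_toSet _) fun a _ =>
    Set.Finite.isClosed_biUnion (Finset.finite_toSet _) fun b _ =>
      (isClosed_const.inter ((hA a).inter (hA b))).union
        ((isClosed_const.inter ((hB a).inter (hB b))).union ((hA a).inter (hB b)))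

/-! ### The fibred curve -/

/-- The slope parameter of the `i`-th curve. -/
def lamOf (N i : ℕ) : ℕ := 2 * (i * N)

/-- The scaling of the `i`-th curve. -/
def scaleOf (N i : ℕ) : ℕ := N ^ (3 * (i + 1))

lemma scaleOf_pos {N : ℕ} (hN : 1 ≤ N) (i : ℕ) : 0 < scaleOf N i := Nat.pow_pos (by omega)

lemma mul_scaleOf_le {N : ℕ} (hN : 1 ≤ N) {i j : ℕ} (h : i < j) :
    N ^ 3 * scaleOf N i ≤ scaleOf N j := by
  rw [scaleOf, scaleOf, ← pow_add]
  exact Nat.pow_le_pow_right (by omega) (by omega)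

variable {m : ℕ}

/-- Different curves have different critical values. -/
lemma not_isCritical_of_ne (hg : 0 < g) {N : ℕ} {d : Fin m → ℕ}
    (hd : ∀ i, 1 ≤ d i) (hN : ∀ i, d i ≤ N) {i j : Fin m} (hij : i ≠ j) {s : ℝ}
    (hi : IsCritical (d i) (valP g (lamOf N i) (d i)) (valQ g (scaleOf N i)) s) :
    ¬ IsCritical (d j) (valP g (lamOf N j) (d j)) (valQ g (scaleOf N j)) s := by
  have hN1 : 1 ≤ N := (hd i).trans (hN i)
  have hlam : ∀ k : Fin m, (0 : ℝ) ≤ lamOf N k := fun k => Nat.cast_nonneg _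
  have hE : ∀ k : Fin m, (0 : ℝ) < scaleOf N k := fun k => by exact_mod_cast scaleOf_pos hN1 k
  intro hj
  wlog hlt : i < j generalizing i j
  · exact this hij.symm hj hi (lt_of_le_of_ne (not_lt.1 hlt) hij.symm)
  have hpos : ∀ (k : Fin m) (e : ℕ), 1 ≤ e → 0 < g * (2 * e + lamOf N k) := by
    intro k e he
    have : (1 : ℝ) ≤ e := by exact_mod_cast he
    have := hlam k
    exact mul_pos hg (by linarith)
  have hneg : ∀ (k : Fin m) (e : ℕ), 1 ≤ e → d k * s = -(g * scaleOf N k * (e * (e + 1))) →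
      s < 0 := by
    intro k e he h
    have h1 : (0 : ℝ) < e := by exact_mod_cast he
    have h2 : 0 < g * scaleOf N k * (e * (e + 1)) := mul_pos (mul_pos hg (hE k)) (by positivity)
    by_contra hs
    have := mul_nonneg (Nat.cast_nonneg (α := ℝ) (d k)) (not_lt.1 hs)
    linarith
  rcases isCritical_cases hg (hlam i) (hE i) hi with ⟨e, he1, he, hs⟩ | ⟨k, hk1, hk, hs⟩ <;>
    rcases isCritical_cases hg (hlam j) (hE j) hj with ⟨e', he1', he', hs'⟩ | ⟨k', hk1', hk', hs'⟩
  -- The equality `e + i * N = e' + j * N` is impossible, because `e ≤ N`, `1 ≤ e'` and `i < j`.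
  · rw [hs] at hs'
    have h1 := mul_left_cancel₀ hg.ne' hs'
    have h2 : e + i * N = e' + j * N := by
      have : (2 * e + lamOf N i : ℕ) = 2 * e' + lamOf N j := by exact_mod_cast h1
      unfold lamOf at this
      omega
    have h3 : ((i : ℕ) + 1) * N ≤ j * N := Nat.mul_le_mul_right _ hlt
    have := hN i
    rw [add_mul, one_mul] at h3
    omega
  · exact absurd (hs ▸ hpos i e he1) (not_lt.2 (hneg j k' hk1' hs').le)
  · exact absurd (hs' ▸ hpos j e' he1') (not_lt.2 (hneg i k hk1 hs).le)
  -- After cross-multiplication the left side is at most `N ^ 3 * scaleOf N i ≤ scaleOf N j`, while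
  -- the right side is at least `2 * scaleOf N j`.
  · have h1 : g * (scaleOf N i * (k * (k + 1)) * d j) = g * (scaleOf N j * (k' * (k' + 1)) * d i) := by
      linear_combination (d j : ℝ) * hs - (d i : ℝ) * hs'
    have h2 : scaleOf N i * (k * (k + 1)) * d j = scaleOf N j * (k' * (k' + 1)) * d i := by
      exact_mod_cast mul_left_cancel₀ hg.ne' h1
    have h3 : k * (k + 1) * d j ≤ N ^ 3 := by
      have a1 : k ≤ N := hk.le.trans (hN i)
      have a2 : k + 1 ≤ N := le_trans hk (hN i)
      calc k * (k + 1) * d j ≤ N * N * N := Nat.mul_le_mul (Nat.mul_le_mul a1 a2) (hN j)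
        _ = N ^ 3 := by ring
    have h4 : 2 ≤ k' * (k' + 1) * d i := by
      calc 2 = 1 * (1 + 1) * 1 := rfl
        _ ≤ _ := Nat.mul_le_mul (Nat.mul_le_mul hk1' (by omega)) (hd i)
    have h5 := mul_scaleOf_le hN1 (show (i : ℕ) < j from hlt)
    have h6 := scaleOf_pos hN1 i
    have h7 : 0 < N ^ 3 * scaleOf N i := Nat.mul_pos (Nat.pow_pos (by omega)) h6
    have h8 : scaleOf N i * (k * (k + 1)) * d j ≤ N ^ 3 * scaleOf N i := by
      calc scaleOf N i * (k * (k + 1)) * d j = k * (k + 1) * d j * scaleOf N i := by ring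
        _ ≤ _ := Nat.mul_le_mul_right _ h3
    have h9 : 2 * scaleOf N j ≤ scaleOf N j * (k' * (k' + 1)) * d i := by
      calc 2 * scaleOf N j ≤ k' * (k' + 1) * d i * scaleOf N j := Nat.mul_le_mul_right _ h4
        _ = _ := by ring
    omega

/-- Critical values from roots of `p` are positive and those from ties in `q` are negative, so `0`
is non-critical for all curves at once. -/
lemma not_isCritical_zero (hg : 0 < g) (hlam : 0 ≤ lam) (hE : 0 < E) :
    ¬ IsCritical d (valP g lam d) (valQ g E) 0 := by
  intro h
  rcases isCritical_cases hg hlam hE h with ⟨e, he1, -, hs⟩ | ⟨k, hk1, -, hs⟩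
  · have : (1 : ℝ) ≤ e := by exact_mod_cast he1
    have : 0 < g * (2 * e + lam) := mul_pos hg (by linarith)
    linarith
  · have h1 : (0 : ℝ) < k := by exact_mod_cast hk1
    have h2 : 0 < g * E * (k * (k + 1)) := mul_pos (mul_pos hg hE) (by positivity)
    rw [mul_zero] at hs
    linarith

/-- The value at `s` of a tropical polynomial. -/
def tropVal (d : ℕ) (P : ℕ → ℝ) (s : ℝ) : ℝ := Classical.choose (exists_isTropValue d P s)

lemma tropVal_spec (d : ℕ) (P : ℕ → ℝ) (s : ℝ) : IsTropValue d P s (tropVal d P s) :=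
  Classical.choose_spec (exists_isTropValue d P s)

lemma mem_planeCurve_top (hg : 0 < g) (hlam : 0 ≤ lam) (hE : 0 < E) (hd : 1 ≤ d) {s : ℝ}
    (hs : 0 < s) : 0 < tropVal d (valP g lam d) s ∧
      (s, tropVal d (valP g lam d) s) ∈ planeCurve d (valP g lam d) (valQ g E) := by
  have h := tropVal_spec d (valP g lam d) s
  have hpos : 0 < tropVal d (valP g lam d) s := by
    obtain ⟨⟨a, ha, he⟩, -⟩ := h
    rw [he]
    exact term_valP_pos hg hlam hd hs ha
  exact ⟨hpos, mem_planeCurve_of_isTropValue h ⟨1, ⟨le_rfl, hd⟩, (term_valQ_one _).symm⟩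
    fun b hb _ => le_term_valQ hg hE hpos.le hb⟩

/-- For `s > 0` all terms of `p` are positive, whereas at this `y` the terms `k` and `k + 1` of `q`
tie at a non-positive minimum. These are the horizontal sheets below the one of
`mem_planeCurve_top`. -/
lemma mem_planeCurve_sheet (hg : 0 < g) (hlam : 0 ≤ lam) (hE : 0 < E) {s : ℝ}
    (hs : 0 < s) {k : ℕ} (hk : 1 ≤ k) (hkd : k < d) :
    (s, -2 * g * E * k) ∈ planeCurve d (valP g lam d) (valQ g E) := by
  have hmin : ∀ b : ℕ, (b = k ∨ b = k + 1) →
      MinB d (valP g lam d) (valQ g E) s (-2 * g * E * k) b := by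
    intro b hb
    have hval : term (valQ g E) (-2 * g * E * k) b = -(g * E * (k * (k + 1))) := by
      rcases hb with rfl | rfl <;> rw [term_valQ]
      · ring
      · push_cast; ring
    refine ⟨by omega, fun a ha => ?_, fun c _ _ => ?_⟩
    · have h1 := term_valP_pos hg hlam (by omega) hs ha
      have h2 : 0 ≤ g * E * (k * ((k : ℝ) + 1)) :=
        mul_nonneg (mul_pos hg hE).le (by positivity)
      linarith
    · have := mul_nonneg (mul_pos hg hE).le (int_mul_pred_nonneg ((c : ℤ) - k))
      push_cast at this
      rw [hval, term_valQ]
      linarith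
  exact Or.inr (Or.inl ⟨k, k + 1, by omega, hmin _ (Or.inl rfl), hmin _ (Or.inr rfl)⟩)

lemma valP_zero_pos (hg : 0 < g) (hlam : 0 ≤ lam) (hd : 1 ≤ d) : 0 < valP g lam d 0 := by
  have : (1 : ℝ) ≤ d := by exact_mod_cast hd
  rw [valP, Nat.cast_zero, sub_zero]
  positivity

/-- So high up, every term of `q` exceeds the constant term of `p`; only ties within `p` remain, and
these form the vertical rays. -/
lemma mem_planeCurve_iff_of_lt (hg : 0 < g) (hlam : 0 ≤ lam) (hE : 0 < E) (hd : 1 ≤ d) {s y : ℝ}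
    (hy : valP g lam d 0 < y) :
    (s, y) ∈ planeCurve d (valP g lam d) (valQ g E) ↔ IsTropRoot d (valP g lam d) s := by
  have hy0 : 0 ≤ y := ((valP_zero_pos hg hlam hd).trans hy).le
  have hlt : ∀ b, 1 ≤ b → term (valP g lam d) s 0 < term (valQ g E) y b := by
    intro b hb
    have := le_term_valQ hg hE hy0 hb
    rw [term, Nat.cast_zero, zero_mul, add_zero]
    linarith
  have hno : ∀ b, ¬ MinB d (valP g lam d) (valQ g E) s y b := fun b hb =>
    absurd (hb.2.1 0 (Nat.zero_le _)) (not_le.2 (hlt b hb.1.1))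
  constructor
  · rintro (⟨a, a', hne, h, h'⟩ | ⟨b, -, -, h, -⟩ | ⟨-, b, -, h⟩)
    · exact ⟨a, a', hne, h.1, h'.1, h.2.1, h'.2.1⟩
    · exact absurd h (hno b)
    · exact absurd h (hno b)
  · rintro ⟨a, a', hne, ha, ha', h, h'⟩
    exact Or.inl ⟨a, a', hne,
      ⟨ha, h, fun b hb _ => (h 0 (Nat.zero_le _)).trans (hlt b hb).le⟩,
      ⟨ha', h', fun b hb _ => (h' 0 (Nat.zero_le _)).trans (hlt b hb).le⟩⟩

/-- The fibred curve which is cut out by the polynomials `pᵢ(x₀) + qᵢ(x_{i+1})` whose coefficients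
have the values `valP` and `valQ`. -/
def splitCurve (hg : 0 < g) (N : ℕ) (d : Fin m → ℕ) (hd : ∀ i, 1 ≤ d i)
    (hN : ∀ i, d i ≤ N) : FiberedCurve m d :=
  have hN1 : ∀ _ : Fin m, 1 ≤ N := fun i => (hd i).trans (hN i)
  have hlam : ∀ k : Fin m, (0 : ℝ) ≤ lamOf N k := fun k => Nat.cast_nonneg _
  have hE : ∀ k : Fin m, (0 : ℝ) < scaleOf N k := fun k => by
    exact_mod_cast scaleOf_pos (hN1 k) k
  have hroot : ∀ (i : Fin m) (s : ℝ), IsTropRoot (d i) (valP g (lamOf N i) (d i)) s ↔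
      s ∈ Set.range fun k : Fin (d i) => g * (2 * ((k : ℕ) + 1 : ℕ) + lamOf N i) := by
    intro i s
    rw [isTropRoot_valP_iff hg]
    constructor
    · rintro ⟨e, he1, he, rfl⟩
      exact ⟨⟨e - 1, by omega⟩, by simp only [Nat.sub_add_cancel he1]⟩
    · rintro ⟨k, rfl⟩
      exact ⟨k + 1, by omega, k.2, rfl⟩
  have hpos : ∀ (i : Fin m) (k : Fin (d i)),
      0 < g * (2 * (((k : ℕ) + 1 : ℕ) : ℝ) + lamOf N i) := fun i k =>
    mul_pos hg (by have := hlam i; positivity)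
  { Γ := fun i => planeCurve (d i) (valP g (lamOf N i) (d i)) (valQ g (scaleOf N i))
    closed := fun i => isClosed_planeCurve _ _ _
    root := fun i k => g * (2 * ((k : ℕ) + 1 : ℕ) + lamOf N i)
    root_injective := fun i k k' h => by
      have h1 := mul_left_cancel₀ hg.ne' h
      have h2 : 2 * ((k : ℕ) + 1) + lamOf N i = 2 * ((k' : ℕ) + 1) + lamOf N i := by
        exact_mod_cast h1
      exact Fin.ext (by omega)
    root_lt := fun i i' h k k' => by
      have h3 : ((i : ℕ) + 1) * N ≤ i' * N := Nat.mul_le_mul_right _ h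
      rw [add_mul, one_mul] at h3
      have h4 : 2 * ((k : ℕ) + 1) + lamOf N i < 2 * ((k' : ℕ) + 1) + lamOf N i' := by
        have := hN i
        have := k.2
        unfold lamOf
        omega
      exact mul_lt_mul_of_pos_left (by exact_mod_cast h4) hg
    -- The first family consists of the ties within `q`, the second of the equalities between a term
    -- of `p` and one of `q`, solved for `y`. The value `x.2 = 0` only adds a superfluous line.
    lines := fun i => (Finset.range (d i + 1)).image (fun k : ℕ => (-2 * g * scaleOf N i * k, 0)) ∪
      (Finset.range (d i + 1) ×ˢ Finset.range (d i + 1)).image (fun x : ℕ × ℕ =>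
        ((valP g (lamOf N i) (d i) x.1 - valQ g (scaleOf N i) x.2) / x.2, (x.1 : ℝ) / x.2))
    mem_lines := fun i s y h hs => by
      rw [← hroot] at hs
      simp only [Finset.mem_union, Finset.mem_image, Finset.mem_product, Finset.mem_range]
      rcases h with ⟨a, a', hne, h, h'⟩ | ⟨b, b', hne, h, h'⟩ | ⟨a, b, h, h'⟩
      · exact absurd ⟨a, a', hne, h.1, h'.1, h.2.1, h'.2.1⟩ hs
      · obtain ⟨k, -, hk, hy, -⟩ := minB_minB hg (hE i) hne h h'
        exact ⟨_, Or.inl ⟨k, by omega, rfl⟩, by simpa using hy⟩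
      · refine ⟨_, Or.inr ⟨(a, b), ⟨Nat.lt_succ_of_le h.1, Nat.lt_succ_of_le h'.1.2⟩, rfl⟩, ?_⟩
        have he := le_antisymm (h.2.2 b h'.1.1 h'.1.2) (h'.2.1 a h.1)
        have hb : (b : ℝ) ≠ 0 := by
          have := h'.1.1
          exact_mod_cast (by omega : b ≠ 0)
        unfold term at he
        dsimp only at he ⊢
        field_simp
        linarith
    bound := fun i => valP g (lamOf N i) (d i) 0
    mem_iff := fun i s y hy => by
      rw [← hroot]
      exact mem_planeCurve_iff_of_lt hg (hlam i) (hE i) (hd i) hy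
    -- Index `0` is the sheet of positive height and the indices `1, …, d j - 1` are the horizontal
    -- ones, `d j` in total.
    sheet := fun j s c => if (c : ℕ) = 0 then tropVal (d j) (valP g (lamOf N j) (d j)) s
      else -2 * g * scaleOf N j * (c : ℕ)
    sheet_mem := fun i j _ k c => by
      split_ifs with hc
      · exact (mem_planeCurve_top hg (hlam j) (hE j) (hd j) (hpos i k)).2
      · exact mem_planeCurve_sheet hg (hlam j) (hE j) (hpos i k) (by omega) c.2
    sheet_injective := fun i j _ k c c' h => by
      have htop := (mem_planeCurve_top hg (hlam j) (hE j) (hd j) (hpos i k)).1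
      have hcoef : (0 : ℝ) < 2 * g * scaleOf N j := mul_pos (by linarith) (hE j)
      have hle : ∀ c : ℕ, (-2 * g * scaleOf N j * c : ℝ) ≤ 0 := fun c => by
        have := mul_nonneg hcoef.le (Nat.cast_nonneg (α := ℝ) c)
        linarith
      beta_reduce at h
      split_ifs at h with h1 h2 h2
      · exact Fin.ext (h1.trans h2.symm)
      · exact absurd (h ▸ htop) (not_lt.2 (hle c'))
      · exact absurd (h.symm ▸ htop) (not_lt.2 (hle c))
      · have : (2 * g * scaleOf N j) * ((c : ℕ) : ℝ) = (2 * g * scaleOf N j) * ((c' : ℕ) : ℝ) := by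
          linarith
        exact Fin.ext (by exact_mod_cast mul_left_cancel₀ hcoef.ne' this) }

end

/-! ### The choice of coefficients and the transversal curve -/

section

universe u

variable {K : Type u} [Field K] {v : AddValuation K (WithTop ℝ)} {m : ℕ}

lemma exists_pos_val (hv : ∃ x : K, x ≠ 0 ∧ v x ≠ 0) :
    ∃ (ϖ : K) (g : ℝ), 0 < g ∧ v ϖ = (g : WithTop ℝ) := by
  obtain ⟨x, hx0, hx⟩ := hv
  obtain ⟨r, hr⟩ := WithTop.ne_top_iff_exists.1 (mt v.top_iff.1 hx0)
  have hr0 : r ≠ 0 := by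
    rintro rfl
    exact hx hr.symm
  rcases lt_or_gt_of_ne hr0 with h | h
  · obtain ⟨r', hr'⟩ := WithTop.ne_top_iff_exists.1 (mt v.top_iff.1 (inv_ne_zero hx0))
    have h1 : v x + v x⁻¹ = 0 := by rw [← v.map_mul, mul_inv_cancel₀ hx0, v.map_one]
    rw [← hr, ← hr', ← WithTop.coe_add, ← WithTop.coe_zero, WithTop.coe_inj] at h1
    exact ⟨x⁻¹, r', by linarith, hr'.symm⟩
  · exact ⟨x, r, h, hr.symm⟩

lemma val_pow {ϖ : K} {g : ℝ} (h : v ϖ = (g : WithTop ℝ)) (k : ℕ) :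
    v (ϖ ^ k) = ((k * g : ℝ) : WithTop ℝ) := by
  rw [v.map_pow, h, ← WithTop.coe_nsmul, nsmul_eq_mul]

/-- The coefficients of `p`. -/
def coefP (ϖ : K) (N : ℕ) (d : Fin m → ℕ) (i : Fin m) (a : ℕ) : K :=
  ϖ ^ ((d i - a) * (d i - a + 1 + lamOf N i))

/-- The coefficients of `q`. -/
def coefQ (ϖ : K) (N : ℕ) (i : Fin m) (b : ℕ) : K := ϖ ^ (scaleOf N i * (b * (b - 1)))

variable {ϖ : K} {g : ℝ} {N : ℕ} {d : Fin m → ℕ}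

lemma val_coefP (h : v ϖ = (g : WithTop ℝ)) (i : Fin m) (a : ℕ) (ha : a ≤ d i) :
    v (coefP ϖ N d i a) = (valP g (lamOf N i) (d i) a : WithTop ℝ) := by
  rw [coefP, val_pow h, valP]
  congr 1
  push_cast [Nat.cast_sub ha]
  ring

lemma val_coefQ (h : v ϖ = (g : WithTop ℝ)) (i : Fin m) (b : ℕ) (hb : 1 ≤ b) :
    v (coefQ ϖ N i b) = (valQ g (scaleOf N i) b : WithTop ℝ) := by
  rw [coefQ, val_pow h, valQ]
  congr 1
  push_cast [Nat.cast_sub hb]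
  ring

/-- The polynomials that cut out the curve. -/
def curvePoly (ϖ : K) (N : ℕ) (d : Fin m → ℕ) (i : Fin m) : MvPolynomial (Fin (m + 1)) K :=
  splitPoly i (d i) (coefP ϖ N d i) (coefQ ϖ N i)

lemma carrier_splitCurve (h : v ϖ = (g : WithTop ℝ)) (hg : 0 < g) (hd : ∀ i, 1 ≤ d i)
    (hN : ∀ i, d i ≤ N) :
    (splitCurve hg N d hd hN).carrier = ⋂ i, tropHypersurface v (curvePoly ϖ N d i) := by
  ext w
  rw [Set.mem_iInter]
  exact forall_congr' fun i => (mem_tropHypersurface_splitPoly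
    (fun a ha => val_coefP h i a ha) (fun b hb _ => val_coefQ h i b hb) w).symm

lemma isTransversalInter_curvePoly (h : v ϖ = (g : WithTop ℝ)) (hg : 0 < g) (hd : ∀ i, 1 ≤ d i)
    (hN : ∀ i, d i ≤ N) : IsTransversalInter v (curvePoly ϖ N d) :=
  isTransversalInter_splitPoly hd (fun i a ha => val_coefP h i a ha)
    (fun i b hb _ => val_coefQ h i b hb)
    (fun _ _ hij _ hi => not_isCritical_of_ne hg hd hN hij hi)
    ⟨0, fun i => not_isCritical_zero hg (Nat.cast_nonneg _)
      (by exact_mod_cast scaleOf_pos ((hd i).trans (hN i)) i)⟩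

lemma exists_common_zero_curvePoly (hv : ∃ x : K, x ≠ 0 ∧ v x ≠ 0) (h : v ϖ = (g : WithTop ℝ))
    (hg : 0 < g) (hd : ∀ i, 1 ≤ d i) (hN : ∀ i, d i ≤ N) (w : Fin (m + 1) → ℝ)
    (hw : w ∈ (splitCurve hg N d hd hN).carrier) :
    ∃ (L : Type u) (_ : Field L) (_ : Algebra K L) (V : AddValuation L (WithTop ℝ))
      (z : Fin (m + 1) → L), (∀ x, V (algebraMap K L x) = v x) ∧
      (∀ k, V (z k) = ((w k : ℝ) : WithTop ℝ)) ∧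
      ∀ i, MvPolynomial.aeval z (curvePoly ϖ N d i) = 0 :=
  exists_common_zero hv hd (fun i a ha => val_coefP h i a ha)
    (fun i b hb _ => val_coefQ h i b hb)
    (fun _ _ hij _ hi hj => not_isCritical_of_ne hg hd hN hij (Or.inl hi) (Or.inl hj)) w hw

/-- A lifted common zero of the generators is a zero of the whole ideal, so its tropicalization lies
in the variety; the converse holds because the generators belong to the ideal. -/
lemma carrier_eq_tropVariety (hv : ∃ x : K, x ≠ 0 ∧ v x ≠ 0) (h : v ϖ = (g : WithTop ℝ))
    (hg : 0 < g) (hd : ∀ i, 1 ≤ d i) (hN : ∀ i, d i ≤ N) :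
    (splitCurve hg N d hd hN).carrier
      = tropVariety v (Ideal.span (Set.range (curvePoly ϖ N d))) := by
  apply Set.Subset.antisymm
  · intro w hw
    obtain ⟨L, _, _, V, z, hV, hz, hz0⟩ := exists_common_zero_curvePoly hv h hg hd hN w hw
    rw [tropVariety, Set.mem_iInter₂]
    intro f hf
    refine mem_tropHypersurface_of_zero v V hV f z w hz ?_
    have hle : Ideal.span (Set.range (curvePoly ϖ N d))
        ≤ RingHom.ker (MvPolynomial.aeval z : MvPolynomial (Fin (m + 1)) K →ₐ[K] L) := by
      rw [Ideal.span_le]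
      rintro _ ⟨i, rfl⟩
      exact hz0 i
    exact hle hf
  · rw [carrier_splitCurve h hg hd hN]
    intro w hw
    rw [tropVariety, Set.mem_iInter₂] at hw
    exact Set.mem_iInter.2 fun i => hw _ (Ideal.subset_span ⟨i, rfl⟩)

/-- The power `x₀ ^ d i` occurs, and the non-zero constant term excludes a monomial factor. -/
lemma hasTropDegree_curvePoly (h : v ϖ = (g : WithTop ℝ)) (i : Fin m) :
    HasTropDegree (curvePoly ϖ N d i) (d i) := by
  have hp : ∀ a ≤ d i, coefP ϖ N d i a ≠ 0 := fun a ha => ne_zero_of_val (val_coefP h i a ha)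
  have hq : ∀ b, 1 ≤ b → b ≤ d i → coefQ ϖ N i b ≠ 0 := fun b hb _ =>
    ne_zero_of_val (val_coefQ h i b hb)
  have hsum : ∀ (k : Fin (m + 1)) (a : ℕ), ((Finsupp.single k a).sum fun _ e => e) = a :=
    fun k a => Finsupp.sum_single_index rfl
  refine ⟨le_antisymm ?_ ?_, fun j hj => ?_⟩
  · refine Finset.sup_le fun α hα => ?_
    rcases (mem_support_splitPoly hp hq α).1 hα with ⟨a, ha, rfl⟩ | ⟨b, hb, rfl⟩
    · rw [hsum]; exact ha
    · rw [hsum]; exact hb.2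
  · have := MvPolynomial.le_totalDegree
      ((mem_support_splitPoly (i := i) hp hq _).2 (Or.inl ⟨d i, le_rfl, rfl⟩))
    rwa [hsum] at this
  · obtain ⟨f, hf⟩ := hj
    apply hp 0 (Nat.zero_le _)
    rw [← coeff_splitPoly_zero (i := i) (p := coefP ϖ N d i) (q := coefQ ϖ N i)
      (Nat.zero_le (d i))]
    change (curvePoly ϖ N d i).coeff _ = 0
    rw [Finsupp.single_zero, hf, ← MvPolynomial.constantCoeff_eq, map_mul,
      MvPolynomial.constantCoeff_X, zero_mul]

theorem exists_transversal_curve (hv : ∃ x : K, x ≠ 0 ∧ v x ≠ 0) (hm : 2 ≤ m) (d : Fin m → ℕ)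
    (hd : ∀ i, 1 ≤ d i) :
    ∃ (C : Set (Fin (m + 1) → ℝ)) (f : Fin m → MvPolynomial (Fin (m + 1)) K)
        (A : Matrix (Fin 2) (Fin (m + 1)) ℚ),
        (∀ i, HasTropDegree (f i) (d i)) ∧
        C = ⋂ i, tropHypersurface v (f i) ∧
        C = tropVariety v (Ideal.span (Set.range f)) ∧
        IsTransversalInter v f ∧
        A.rank = 2 ∧
        (selfIntersections (ratMap A) C).Finite ∧
        (∏ i, d i) ^ 2 * m.choose 2 ≤ (selfIntersections (ratMap A) C).ncard := by
  obtain ⟨ϖ, g, hg, h⟩ := exists_pos_val hv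
  have hN : ∀ i, d i ≤ ∑ i, d i := fun i =>
    Finset.single_le_sum (fun _ _ => Nat.zero_le _) (Finset.mem_univ i)
  obtain ⟨a, b, hrank, hfin, -, -, c, hc, hmem, -⟩ :=
    (splitCurve hg _ d hd hN).exists_projection hm ∅ Set.finite_empty (by simp)
  refine ⟨(splitCurve hg _ d hd hN).carrier, curvePoly ϖ _ d, Matrix.of ![a, b],
    fun i => hasTropDegree_curvePoly h i, carrier_splitCurve h hg hd hN,
    carrier_eq_tropVariety hv h hg hd hN, isTransversalInter_curvePoly h hg hd hN, hrank, hfin, ?_⟩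
  rw [← FiberedCurve.card_crossIdx, ← Nat.card_eq_fintype_card, ← Set.ncard_range_of_injective hc]
  exact Set.ncard_le_ncard (by rintro _ ⟨x, rfl⟩; exact hmem x) hfin

/-! ### Tropical lines -/

lemma valP_one_zero (g lam : ℝ) : valP g lam 1 0 = g * (2 + lam) := by
  rw [valP]; push_cast; ring

/-- In degree one the plane curve has its vertex at `(γ, γ)` with `γ = g * (2 + lam)`, from which a
diagonal, a horizontal and a vertical ray start. -/
lemma mem_planeCurve_one {g lam E s y : ℝ} :
    (s, y) ∈ planeCurve 1 (valP g lam 1) (valQ g E) ↔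
      y = min s (g * (2 + lam)) ∨ (s = g * (2 + lam) ∧ g * (2 + lam) ≤ y) := by
  have t0 : term (valP g lam 1) s 0 = g * (2 + lam) := by
    rw [term, valP_one_zero]; simp
  have t1 : term (valP g lam 1) s 1 = s := by rw [term, valP]; simp
  set γ := g * (2 + lam)
  have hA : ∀ a, MinA 1 (valP g lam 1) (valQ g E) s y a ↔
      (a = 0 ∧ γ ≤ s ∧ γ ≤ y) ∨ (a = 1 ∧ s ≤ γ ∧ s ≤ y) := by
    intro a
    constructor
    · rintro ⟨h, h1, h2⟩
      have hy := h2 1 le_rfl le_rfl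
      rw [term_valQ_one] at hy
      rcases (by omega : a = 0 ∨ a = 1) with rfl | rfl
      · have := h1 1 le_rfl
        rw [t0] at hy this
        rw [t1] at this
        exact Or.inl ⟨rfl, this, hy⟩
      · have := h1 0 (by omega)
        rw [t0, t1] at this
        rw [t1] at hy
        exact Or.inr ⟨rfl, this, hy⟩
    · rintro (⟨rfl, h1, h2⟩ | ⟨rfl, h1, h2⟩)
      · refine ⟨by omega, fun c hc => ?_, fun c hc1 hc => ?_⟩
        · rcases (by omega : c = 0 ∨ c = 1) with rfl | rfl
          · exact le_rfl
          · rwa [t0, t1]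
        · obtain rfl : c = 1 := by omega
          rwa [t0, term_valQ_one]
      · refine ⟨by omega, fun c hc => ?_, fun c hc1 hc => ?_⟩
        · rcases (by omega : c = 0 ∨ c = 1) with rfl | rfl
          · rwa [t0, t1]
          · exact le_rfl
        · obtain rfl : c = 1 := by omega
          rwa [t1, term_valQ_one]
  have hB : ∀ b, MinB 1 (valP g lam 1) (valQ g E) s y b ↔ b = 1 ∧ y ≤ γ ∧ y ≤ s := by
    intro b
    constructor
    · rintro ⟨h, h1, -⟩
      obtain rfl : b = 1 := by omega
      have e0 := h1 0 (by omega)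
      have e1 := h1 1 le_rfl
      rw [term_valQ_one] at e0 e1
      rw [t0] at e0
      rw [t1] at e1
      exact ⟨rfl, e0, e1⟩
    · rintro ⟨rfl, h1, h2⟩
      refine ⟨by omega, fun c hc => ?_, fun c hc1 hc => ?_⟩
      · rcases (by omega : c = 0 ∨ c = 1) with rfl | rfl
        · rwa [t0, term_valQ_one]
        · rwa [t1, term_valQ_one]
      · obtain rfl : c = 1 := by omega
        exact le_rfl
  simp only [planeCurve, Set.mem_ofPred_eq, hA, hB]
  constructor
  · rintro (⟨a, a', hne, ⟨rfl, h1, h2⟩ | ⟨rfl, h1, h2⟩, ⟨rfl, h3, h4⟩ | ⟨rfl, h3, h4⟩⟩ |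
      ⟨b, b', hne, ⟨rfl, -⟩, rfl, -⟩ | ⟨a, b, ⟨rfl, h1, h2⟩ | ⟨rfl, h1, h2⟩, rfl, h3, h4⟩)
    · exact absurd rfl hne
    · exact Or.inr ⟨le_antisymm h3 h1, h2⟩
    · exact Or.inr ⟨le_antisymm h1 h3, h4⟩
    · exact absurd rfl hne
    · exact absurd rfl hne
    · exact Or.inl (le_antisymm (le_min h4 h3) ((min_le_right _ _).trans h2))
    · exact Or.inl (le_antisymm (le_min h4 h3) ((min_le_left _ _).trans h2))
  · rintro (h | ⟨h1, h2⟩)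
    · rcases le_total s γ with hs | hs
      · rw [min_eq_left hs] at h
        exact Or.inr (Or.inr ⟨1, 1, Or.inr ⟨rfl, hs, h.ge⟩, rfl, h ▸ hs, h.le⟩)
      · rw [min_eq_right hs] at h
        exact Or.inr (Or.inr ⟨0, 1, Or.inl ⟨rfl, hs, h.ge⟩, rfl, h.le, h ▸ hs⟩)
    · exact Or.inl ⟨0, 1, zero_ne_one, Or.inl ⟨rfl, h1.ge, h2⟩, Or.inr ⟨rfl, h1.le, h1 ▸ h2⟩⟩

/-- The fibred curve of degree one. -/
def lineCurve (m : ℕ) (hg : 0 < g) : FiberedCurve m fun _ => 1 :=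
  splitCurve hg 1 (fun _ => 1) (fun _ => le_rfl) fun _ => le_rfl

/-- The vertices of the line are over these points of the first axis. -/
def lineRoot (g : ℝ) (i : Fin m) : ℝ := g * (2 + lamOf 1 i)

lemma root_lineCurve (hg : 0 < g) (i : Fin m) (k : Fin 1) :
    (lineCurve m hg).root i k = lineRoot g i := by
  have : (k : ℕ) = 0 := by omega
  change g * (2 * (((k : ℕ) + 1 : ℕ) : ℝ) + lamOf 1 i) = _
  rw [this, lineRoot]
  simp

lemma mem_lineCurve_iff (hg : 0 < g) (w : Fin (m + 1) → ℝ) :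
    w ∈ (lineCurve m hg).carrier ↔ ∀ i : Fin m, w i.succ = min (w 0) (lineRoot g i) ∨
      (w 0 = lineRoot g i ∧ lineRoot g i ≤ w i.succ) :=
  forall_congr' fun _ => mem_planeCurve_one

lemma lineRoot_injective (hg : 0 < g) : Function.Injective (lineRoot g : Fin m → ℝ) := by
  intro i j h
  by_contra hne
  exact (lineCurve m hg).root_ne hne 0 0 (by rw [root_lineCurve, root_lineCurve, h])

/-- The part of the line without its rays in the directions `e₁, …, e_m`. -/
def spine (g s : ℝ) : Fin (m + 1) → ℝ := Fin.cons s fun i => min s (lineRoot g i)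

/-- The roots are pairwise distinct, so at most one coordinate at a time can leave the spine. -/
lemma exists_eq_spine_add (hg : 0 < g) (hm : 2 ≤ m) {w : Fin (m + 1) → ℝ}
    (hw : w ∈ (lineCurve m hg).carrier) :
    ∃ (i : Fin m) (τ : ℝ), w = spine g (w 0) + τ • Pi.single i.succ 1 ∧
      (τ ≠ 0 → w 0 = lineRoot g i) := by
  rw [mem_lineCurve_iff] at hw
  by_cases hall : ∀ i : Fin m, w i.succ = min (w 0) (lineRoot g i)
  · refine ⟨⟨0, by omega⟩, 0, ?_, fun h => absurd rfl h⟩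
    rw [zero_smul, add_zero]
    funext k
    refine Fin.cases rfl (fun i => ?_) k
    rw [hall i, spine, Fin.cons_succ]
  · push Not at hall
    obtain ⟨i, hi⟩ := hall
    obtain ⟨h0, -⟩ := (hw i).resolve_left hi
    refine ⟨i, w i.succ - min (w 0) (lineRoot g i), ?_, fun _ => h0⟩
    funext k
    refine Fin.cases ?_ (fun j => ?_) k
    · rw [Pi.add_apply, Pi.smul_apply, Pi.single_eq_of_ne (Fin.succ_ne_zero i).symm, smul_zero,
        add_zero]
      rfl
    · rw [Pi.add_apply, Pi.smul_apply, spine, Fin.cons_succ]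
      rcases eq_or_ne j i with rfl | hne
      · rw [Pi.single_eq_same, smul_eq_mul, mul_one]; ring
      · rw [Pi.single_eq_of_ne (fun e => hne (Fin.succ_injective _ e)), smul_zero, add_zero]
        refine (hw j).resolve_right fun h => hne ?_
        exact lineRoot_injective hg (h.1.symm.trans h0)

lemma bracket_eq_sum {n : ℕ} (A : (Fin n → ℝ) × (Fin n → ℝ)) (u y : Fin n → ℝ) :
    bracket A u y = ∑ k, u k * (A.1 k * (A.2 ⬝ᵥ y) - A.2 k * (A.1 ⬝ᵥ y)) := by
  have h1 : A.1 ⬝ᵥ u = ∑ k, A.1 k * u k := rfl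
  have h2 : A.2 ⬝ᵥ u = ∑ k, A.2 k * u k := rfl
  rw [bracket, h1, h2, Finset.sum_mul, Finset.sum_mul, ← Finset.sum_sub_distrib]
  exact Finset.sum_congr rfl fun k _ => by ring

/-- The sum of `e₀` and some of the other basis vectors. -/
def cubeVertex (T : Finset (Fin m)) : Fin (m + 1) → ℝ := Fin.cons 1 fun j => if j ∈ T then 1 else 0

/-- Since `s ↦ min s r` is monotone and 1-Lipschitz, the increment of the spine is `s' - s` times a
vector with first coordinate `1` and the others in `[0, 1]`. A linear form on this cube is minimal
at a vertex, namely at the set of coordinates with negative coefficient. -/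
lemma bracket_spine_pos {A : (Fin (m + 1) → ℝ) × (Fin (m + 1) → ℝ)} {y : Fin (m + 1) → ℝ}
    (hA : ∀ T : Finset (Fin m), 0 < bracket A (cubeVertex T) y) {s s' : ℝ} (h : s < s') :
    0 < bracket A (spine g s' - spine g s) y := by
  set c : Fin (m + 1) → ℝ := fun k => A.1 k * (A.2 ⬝ᵥ y) - A.2 k * (A.1 ⬝ᵥ y) with hc
  have hT := hA (Finset.univ.filter fun j => c j.succ < 0)
  rw [bracket_eq_sum, Fin.sum_univ_succ] at hT ⊢
  simp only [cubeVertex, Fin.cons_zero, Fin.cons_succ, one_mul, Pi.sub_apply, spine,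
    Finset.mem_filter, Finset.mem_univ, true_and] at hT ⊢
  have hδ : 0 < s' - s := sub_pos.2 h
  have h1 := mul_pos hδ hT
  rw [mul_add, Finset.mul_sum] at h1
  refine h1.trans_le (add_le_add le_rfl (Finset.sum_le_sum fun j _ => ?_))
  have hz0 : 0 ≤ min s' (lineRoot g j) - min s (lineRoot g j) :=
    sub_nonneg.2 (min_le_min_right _ h.le)
  have hz1 : min s' (lineRoot g j) - min s (lineRoot g j) ≤ s' - s := by
    rcases le_total s (lineRoot g j) with hs | hs
    · rw [min_eq_left hs]
      linarith [min_le_left s' (lineRoot g j)]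
    · rw [min_eq_right hs, min_eq_right (hs.trans h.le)]
      linarith
  change (s' - s) * ((if c j.succ < 0 then 1 else 0) * c j.succ) ≤ _ * c j.succ
  split_ifs with hneg
  · rw [one_mul]
    exact mul_le_mul_of_nonpos_right hz1 hneg.le
  · rw [zero_mul, mul_zero]
    exact mul_nonneg hz0 (not_lt.1 hneg)

lemma bracket_spine_injective {A : (Fin (m + 1) → ℝ) × (Fin (m + 1) → ℝ)} {y : Fin (m + 1) → ℝ}
    (hA : ∀ T : Finset (Fin m), 0 < bracket A (cubeVertex T) y) {s s' : ℝ}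
    (h : bracket A y (spine g s) = bracket A y (spine g s')) : s = s' := by
  have key : ∀ s s' : ℝ, bracket A y (spine g s) = bracket A y (spine g s') → ¬ s < s' := by
    intro s s' h hlt
    have := bracket_spine_pos (g := g) hA hlt
    rw [bracket_comm, bracket_sub] at this
    linarith
  exact le_antisymm (not_lt.1 (key s' s h.symm)) (not_lt.1 (key s s' h))

/-- A point of a ray of the line. -/
lemma spine_add_eq_rayPt (hg : 0 < g) (i : Fin m) (τ : ℝ) :
    spine g (lineRoot g i) + τ • Pi.single i.succ 1
      = (lineCurve m hg).rayPt i (fun _ => 0) (lineRoot g i + τ - (lineCurve m hg).bound i) := by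
  funext k
  refine Fin.cases ?_ (fun j => ?_) k
  · rw [FiberedCurve.rayPt_zero, root_lineCurve, Pi.add_apply, Pi.smul_apply,
      Pi.single_eq_of_ne (Fin.succ_ne_zero i).symm, smul_zero, add_zero]
    rfl
  · rw [Pi.add_apply, Pi.smul_apply, spine, Fin.cons_succ]
    rcases eq_or_ne j i with rfl | hne
    · rw [FiberedCurve.rayPt_succ_self, Pi.single_eq_same, min_self, smul_eq_mul, mul_one]
      ring
    · rw [FiberedCurve.rayPt_succ _ hne,
        Pi.single_eq_of_ne (fun e => hne (Fin.succ_injective _ e)), smul_zero, add_zero]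
      have h := (lineCurve m hg).sheet_mem i j hne.symm 0 0
      rw [root_lineCurve] at h ⊢
      exact ((mem_planeCurve_one.1 h).resolve_right fun h' =>
        hne (lineRoot_injective hg h'.1).symm).symm

/-- The projected line has only the crossings of its rays as self-intersections. -/
lemma selfIntersections_subset (hg : 0 < g) (hm : 2 ≤ m) {a b : Fin (m + 1) → ℚ}
    (hdir : ∀ i i' : Fin m, i < i' →
        0 < bracket (castRows a b) (Pi.single i.succ 1) (Pi.single i'.succ 1))
    (hcube : ∀ (T : Finset (Fin m)) (i : Fin m),
      0 < bracket (castRows a b) (cubeVertex T) (Pi.single i.succ 1))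
    {c : FiberedCurve.CrossIdx m (fun _ => 1) → Fin 2 → ℝ}
    (hc : ∀ x, ∃ t t', c x = rowMap (castRows a b)
        ((lineCurve m hg).rayPt (FiberedCurve.fstDir x.1) x.2.1 t) ∧
      c x = rowMap (castRows a b) ((lineCurve m hg).rayPt x.1.1 x.2.2 t')) :
    selfIntersections (ratMap (Matrix.of ![a, b])) (lineCurve m hg).carrier ⊆ Set.range c := by
  set A := castRows a b
  rintro y ⟨F₁, hF₁, F₂, hF₂, hdisj, ⟨w, hw, rfl⟩, w', hw', hww⟩
  rw [ratMap_apply, ratMap_apply] at hww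
  rw [ratMap_apply]
  have hneq : w ≠ w' := fun h => Set.disjoint_left.1 hdisj hw (h ▸ hw')
  have hcl := (lineCurve m hg).isClosed_carrier
  obtain ⟨i, τ, he, hτ⟩ := exists_eq_spine_add hg hm (faces_subset hcl hF₁ hw)
  obtain ⟨i', τ', he', hτ'⟩ := exists_eq_spine_add hg hm (faces_subset hcl hF₂ hw')
  generalize w 0 = s at he hτ
  generalize w' 0 = s' at he' hτ'
  subst he he'
  -- two points on the union of the spine and one ray have different images
  have hsame : ∀ (i : Fin m) (s s' τ τ' : ℝ),
      rowMap A (spine g s + τ • Pi.single i.succ 1)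
        = rowMap A (spine g s' + τ' • Pi.single i.succ 1) →
      spine g s + τ • Pi.single i.succ 1 = spine g s' + τ' • Pi.single i.succ 1 := by
    intro i s s' τ τ' h
    -- The bracket with `e_{i+1}` eliminates the ray parameters and recovers `s`; the bracket with
    -- `cubeVertex ∅`, which is `e₀`, then recovers `τ`.
    have h1 := bracket_eq_of_rowMap_eq h (Pi.single i.succ 1)
    rw [bracket_add_smul, bracket_add_smul, bracket_self, mul_zero, mul_zero, add_zero,
      add_zero] at h1
    obtain rfl := bracket_spine_injective (fun T => hcube T i) h1
    have h2 := bracket_eq_of_rowMap_eq h (cubeVertex ∅)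
    rw [bracket_add_smul, bracket_add_smul, add_right_inj] at h2
    rw [mul_right_cancel₀ (hcube ∅ i).ne' h2]
  -- A point of the spine counts as a point of any ray with parameter zero, so a self-intersection
  -- must involve two proper rays of different directions.
  have hzero : ∀ (i i' : Fin m) (s : ℝ), spine g s + (0 : ℝ) • Pi.single i.succ 1
      = spine g s + (0 : ℝ) • (Pi.single i'.succ 1 : Fin (m + 1) → ℝ) := fun i i' s => by
    rw [zero_smul, zero_smul]
  have hii : i ≠ i' := by
    rintro rfl
    exact hneq (hsame _ _ _ _ _ hww.symm)
  have hτ0 : τ ≠ 0 := by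
    rintro rfl
    rw [hzero i i'] at hww hneq
    exact hneq (hsame _ _ _ _ _ hww.symm)
  have hτ0' : τ' ≠ 0 := by
    rintro rfl
    rw [hzero i' i] at hww hneq
    exact hneq (hsame _ _ _ _ _ hww.symm)
  obtain rfl := hτ hτ0
  obtain rfl := hτ' hτ0'
  rw [spine_add_eq_rayPt hg, spine_add_eq_rayPt hg] at hww
  rw [spine_add_eq_rayPt hg]
  have key : ∀ (i i' : Fin m) (t t' : ℝ), i < i' →
      rowMap A ((lineCurve m hg).rayPt i (fun _ => 0) t)
        = rowMap A ((lineCurve m hg).rayPt i' (fun _ => 0) t') →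
      rowMap A ((lineCurve m hg).rayPt i (fun _ => 0) t) ∈ Set.range c := by
    intro i i' t t' hlt h
    let x : FiberedCurve.CrossIdx m fun _ => 1 := (⟨i', ⟨i, hlt⟩⟩, fun _ => 0, fun _ => 0)
    obtain ⟨r, r', h1, h2⟩ := hc x
    exact ⟨x, lines_inter_subsingleton (hdir i i' hlt).ne' ⟨⟨r, h1⟩, r', h2⟩ ⟨⟨t, rfl⟩, t', h⟩⟩
  rcases lt_or_gt_of_ne hii with hlt | hlt
  · exact key i i' _ _ hlt hww.symm
  · rw [← hww]
    exact key i' i _ _ hlt hww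

/-- Over an infinite field a polynomial is determined by its values, which is needed to pass from
`K`-points of the affine line to points over extensions. -/
lemma infinite_of_val (h : v ϖ = (g : WithTop ℝ)) (hg : 0 < g) : Infinite K :=
  Infinite.of_injective (fun k : ℕ => ϖ ^ k) fun k l hkl => by
    have := congrArg v hkl
    dsimp only at this
    rw [val_pow h, val_pow h, WithTop.coe_inj] at this
    exact_mod_cast mul_right_cancel₀ hg.ne' this

/-- The affine line `x_{i+1} = -cᵢ - x₀`. -/
def affLine (c : Fin m → K) : AffineSubspace K (Fin (m + 1) → K) :=
  AffineSubspace.mk' (Fin.cons 0 fun i => - c i) (Submodule.span K {Fin.cons 1 fun _ => -1})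

lemma mem_affLine {c : Fin m → K} {x : Fin (m + 1) → K} :
    x ∈ affLine c ↔ ∃ t, x = Fin.cons t fun i => - c i - t := by
  rw [affLine, AffineSubspace.mem_mk', Submodule.mem_span_singleton]
  constructor
  · rintro ⟨t, ht⟩
    refine ⟨t, ?_⟩
    have : x = t • (Fin.cons 1 fun _ => -1) + (Fin.cons 0 fun i => - c i : Fin (m + 1) → K) := by
      rw [ht, vsub_eq_sub, sub_add_cancel]
    rw [this]
    funext k
    refine Fin.cases ?_ (fun i => ?_) k
    · simp
    · simp; ring
  · rintro ⟨t, rfl⟩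
    refine ⟨t, ?_⟩
    funext k
    refine Fin.cases ?_ (fun i => ?_) k
    · simp
    · simp; ring

lemma coefP_one (ϖ : K) (i : Fin m) : coefP ϖ 1 (fun _ => 1) i 1 = 1 := by simp [coefP]

lemma coefQ_one (ϖ : K) (i : Fin m) : coefQ ϖ 1 i 1 = 1 := by simp [coefQ]

lemma aeval_curvePoly_one {L : Type*} [Field L] [Algebra K L] (ϖ : K) (i : Fin m)
    (z : Fin (m + 1) → L) :
    MvPolynomial.aeval z (curvePoly ϖ 1 (fun _ => 1) i)
      = algebraMap K L (coefP ϖ 1 (fun _ => 1) i 0) + z 0 + z i.succ := by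
  simp [curvePoly, splitPoly, MvPolynomial.aeval_monomial, Finset.sum_range_succ, coefP_one,
    coefQ_one]

lemma carrier_eq_tropVariety_affLine (hv : ∃ x : K, x ≠ 0 ∧ v x ≠ 0) (h : v ϖ = (g : WithTop ℝ))
    (hg : 0 < g) : (lineCurve m hg).carrier = tropVariety v (MvPolynomial.vanishingIdeal K
      (affLine (fun i => coefP ϖ 1 (fun _ : Fin m => 1) i 0) : Set (Fin (m + 1) → K))) := by
  have := infinite_of_val h hg
  set c : Fin m → K := fun i => coefP ϖ 1 (fun _ : Fin m => 1) i 0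
  apply Set.Subset.antisymm
  · intro w hw
    obtain ⟨L, _, _, V, z, hV, hz, hz0⟩ := exists_common_zero_curvePoly hv h hg _ _ w hw
    rw [tropVariety, Set.mem_iInter₂]
    intro f hf
    refine mem_tropHypersurface_of_zero v V hV f z w hz ?_
    rw [MvPolynomial.mem_vanishingIdeal_iff] at hf
    -- The parametrization of the line: a polynomial vanishing at all its `K`-points vanishes
    -- identically in the parameter, hence also at the lifted point `z`, which satisfies the linear
    -- equations.
    let θ : Fin (m + 1) → Polynomial K :=
      Fin.cons Polynomial.X fun i => - Polynomial.C (c i) - Polynomial.X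
    have hG : MvPolynomial.aeval θ f = 0 := by
      refine Polynomial.funext fun t => ?_
      have hx := hf (fun k => (θ k).eval t) (mem_affLine.2 ⟨t, ?_⟩)
      · rw [Polynomial.eval_zero, ← hx, ← Polynomial.coe_aeval_eq_eval,
          ← AlgHom.comp_apply, MvPolynomial.comp_aeval]
      · funext k
        refine Fin.cases ?_ (fun i => ?_) k
        · simp [θ]
        · simp [θ]
    have hzθ : z = fun k => Polynomial.aeval (z 0) (θ k) := by
      funext k
      refine Fin.cases ?_ (fun i => ?_) k
      · simp [θ]
      · have := hz0 i
        rw [aeval_curvePoly_one] at this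
        simp only [θ, Fin.cons_succ, map_sub, map_neg, Polynomial.aeval_C, Polynomial.aeval_X]
        linear_combination this
    rw [hzθ, ← MvPolynomial.comp_aeval_apply, hG, map_zero]
  · rw [lineCurve, carrier_splitCurve h]
    intro w hw
    rw [tropVariety, Set.mem_iInter₂] at hw
    refine Set.mem_iInter.2 fun i => hw _ ?_
    rw [MvPolynomial.mem_vanishingIdeal_iff]
    intro x hx
    obtain ⟨t, rfl⟩ := mem_affLine.1 hx
    rw [aeval_curvePoly_one]
    simp [c]

lemma isTropLine_lineCurve (hv : ∃ x : K, x ≠ 0 ∧ v x ≠ 0) (h : v ϖ = (g : WithTop ℝ))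
    (hg : 0 < g) : IsTropLine v (lineCurve m hg).carrier := by
  refine ⟨⟨_, ?_, carrier_eq_tropVariety_affLine hv h hg⟩, fun i => ?_, 0, fun t ht => ?_⟩
  · rw [affLine, AffineSubspace.direction_mk']
    refine finrank_span_singleton fun h0 => ?_
    have := congrFun h0 0
    simp at this
  · refine Fin.cases ?_ (fun i => ?_) i
    -- The sum of the non-negative roots lies beyond each of them, where the spine runs in the
    -- direction `e₀`.
    · refine ⟨Fin.cons (∑ j : Fin m, lineRoot g j) fun j => lineRoot g j, fun t ht => ?_⟩
      rw [mem_lineCurve_iff]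
      intro i
      left
      have hpos : ∀ j : Fin m, 0 ≤ lineRoot g j := fun j =>
        mul_nonneg hg.le (by positivity)
      have hle := Finset.single_le_sum (fun j _ => hpos j) (Finset.mem_univ i)
      simp only [Pi.add_apply, Pi.smul_apply, Fin.cons_zero, Fin.cons_succ, Pi.single_eq_same,
        Pi.single_eq_of_ne (Fin.succ_ne_zero i), smul_eq_mul, mul_one, mul_zero, add_zero]
      rw [min_eq_right (by linarith)]
    · refine ⟨(lineCurve m hg).rayPt i (fun _ => 0) 1, fun t ht => ?_⟩
      rw [FiberedCurve.rayPt_add]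
      exact FiberedCurve.rayPt_mem _ _ _ (by linarith)
  · rw [mem_lineCurve_iff]
    intro i
    left
    have : 0 < lineRoot g i := mul_pos hg (by positivity)
    simp only [Pi.add_apply, Pi.smul_apply, Pi.zero_apply, smul_eq_mul, zero_add]
    rw [min_eq_left (by linarith)]

lemma sum_Icc_eq_choose (k : ℕ) : ∑ i ∈ Finset.Icc 1 k, i = (k + 1).choose 2 := by
  induction k with
  | zero => simp
  | succ k ih =>
    rw [Finset.sum_Icc_succ_top (by omega), ih, Nat.choose_succ_succ' (k + 1) 1, Nat.choose_one_right]
    ring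

theorem exists_tropLine (hv : ∃ x : K, x ≠ 0 ∧ v x ≠ 0) (hm : 2 ≤ m) :
    ∃ (L : Set (Fin (m + 1) → ℝ)) (A : Matrix (Fin 2) (Fin (m + 1)) ℚ),
      IsTropLine v L ∧ A.rank = 2 ∧
      (selfIntersections (ratMap A) L).encard = (m.choose 2 : ℕ∞) := by
  obtain ⟨ϖ, g, hg, h⟩ := exists_pos_val hv
  obtain ⟨a, b, hrank, -, hdir, hcube, c, hc, hmem, hpts⟩ :=
    -- The vertices of the cube are added to the directions controlled by the projection so that the
    -- spine produces no crossings.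
    (lineCurve m hg).exists_projection hm (Set.range cubeVertex) (Set.finite_range _) (by
      rintro _ ⟨T, rfl⟩
      exact one_pos)
  refine ⟨_, Matrix.of ![a, b], isTropLine_lineCurve hv h hg, hrank, ?_⟩
  have hrange : selfIntersections (ratMap (Matrix.of ![a, b])) (lineCurve m hg).carrier
      = Set.range c := by
    refine Set.Subset.antisymm (selfIntersections_subset hg hm hdir
      (fun T i => hcube _ ⟨T, rfl⟩ i) hpts) ?_
    rintro _ ⟨x, rfl⟩
    exact hmem x
  rw [hrange, ← Set.image_univ, hc.encard_image, Set.encard_univ, ENat.card_eq_coe_fintype_card, FiberedCurve.card_crossIdx]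
  simp

end

end TropProj

end

theorem theorem5p3 {K : Type*} [Field K] (v : AddValuation K (WithTop ℝ))
    (hv : ∃ x : K, x ≠ 0 ∧ v x ≠ 0) (n : ℕ) (hn : 3 ≤ n) :
    -- (a)
    (∃ (L : Set (Fin n → ℝ)) (A : Matrix (Fin 2) (Fin n) ℚ),
      TropProj.IsTropLine v L ∧ A.rank = 2 ∧
      (TropProj.selfIntersections (TropProj.ratMap A) L).encard
        = ((∑ i ∈ Finset.Icc 1 (n - 2), i : ℕ) : ℕ∞) ∧
      ∑ i ∈ Finset.Icc 1 (n - 2), i = (n - 1).choose 2) ∧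
    -- (b)
    (∀ d : Fin (n - 1) → ℕ, (∀ i, 1 ≤ d i) →
      ∃ (C : Set (Fin n → ℝ)) (f : Fin (n - 1) → MvPolynomial (Fin n) K)
        (A : Matrix (Fin 2) (Fin n) ℚ),
        (∀ i, TropProj.HasTropDegree (f i) (d i)) ∧
        C = ⋂ i, TropProj.tropHypersurface v (f i) ∧
        C = TropProj.tropVariety v (Ideal.span (Set.range f)) ∧
        TropProj.IsTransversalInter v f ∧
        A.rank = 2 ∧
        (TropProj.selfIntersections (TropProj.ratMap A) C).Finite ∧
        (∏ i, d i) ^ 2 * (n - 1).choose 2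
          ≤ (TropProj.selfIntersections (TropProj.ratMap A) C).ncard) := by
  -- In this form `n - 1` reduces to `m + 2` by definition, so the index types of (b) match without
  -- casts.
  obtain ⟨m, rfl⟩ : ∃ m, n = m + 2 + 1 := ⟨n - 3, by omega⟩
  have hsum : ∑ i ∈ Finset.Icc 1 (m + 2 + 1 - 2), i = (m + 2).choose 2 :=
    TropProj.sum_Icc_eq_choose (m + 1)
  refine ⟨?_, fun d hd => TropProj.exists_transversal_curve hv (by omega) d hd⟩
  obtain ⟨L, A, h1, h2, h3⟩ := TropProj.exists_tropLine (m := m + 2) hv (by omega)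
  exact ⟨L, A, h1, h2, by rw [hsum]; exact h3, hsum⟩
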